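/- Let $d\ge 0$ and let $H:\mathbb R^d\times(\mathbb R^d)^*\to\mathbb R$ be a $C^2$ autonomous Hamiltonian for which there are constants $M$ and $m>0$ such that, for all $(q,p)$, $$\|d^2H(q,p)\|\le M,\qquad \partial^2_{pp}H(q,p)\ge m\,\mathrm{Id},\qquad \tfrac m2|p|^2-M\le H(q,p)\le \tfrac M2|p|^2+M,$$ and $H(q+w,p)=H(q,p)$ for each $w\in\mathbb Z^d$. "Periodic" means $\mathbb Z^d$-periodic in $q$, and $\mathbb T^d=\mathbb R^d/\mathbb Z^d$. *Weak KAM solutions.* Let $\varphi^t$ be the flow of $\dot q=\partial_pH$, $\dot p=-\partial_qH$. For $t>0$ small enough, any two points $q_0,q_1$ are joined by a unique orbit $(q(s),p(s))_{s\in[0,t]}$ with $q(0)=q_0$, $q(t)=q_1$; let $S^t(q_0,q_1)=\int_0^t p\cdot\dot q-H(q,p)\,ds$ be its action. For $t>0$, let $$A^t(q_0,q_1)=\min_{\theta_1,\dots,\theta_{n-1}}\big(S^{t/n}(q_0,\theta_1)+S^{t/n}(\theta_1,\theta_2)+\cdots+S^{t/n}(\theta_{n-1},q_1)\big),$$ which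 does not depend on the integer $n$ provided it is large enough. For $u:\mathbb R^d\to\mathbb R$ let $\mathbf T^tu(q)=\inf_{\theta\in\mathbb R^d}\big(u(\theta)+A^t(\theta,q)\big)$ for $t>0$, and $\mathbf T^0u=u$. The function $u$ is a weak KAM solution if there is $a\in\mathbb R$ such that $\mathbf T^tu+ta=u$ for all $t\ge0$. Let $\Gamma_u=\{(q,du(q)) : u \text{ is differentiable at } q\}$ and $$\mathcal I^*(u)=\bigcap_{n\in\mathbb N}\varphi^{-n}\big(\overline{\Gamma_u}\big).$$ If $u$ is periodic, this set is invariant under the translations $(q,p)\mapsto(q+w,p)$, $w\in\mathbb Z^d$, and is seen as a subset of $\mathbb T^d\times(\mathbb R^d)^*$. *The periodic Aubry set.* A sub-solution at level $a$ is a Lipschitz function $u:\mathbb R^d\to\mathbb R$ such that $H(q,du(q))\le a$ at each point $q$ of differentiability of $u$. Let $\alpha(0)$ be the infimum of the real numbers $a$ such that there is a periodic sub-solution at level $a$; the periodic sub-solutions at level $\alpha(0)$ are called critical. Let $\mathcal A(0)\subset\mathbb T^d$ be the set of points $q$ such that $H(q,du(q))=\alpha(0)$ for all $C^1$ critical periodic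 sub-solutions $u$. **Statement.** There exists a $C^{1,1}$ critical periodic sub-solution $u_0$ such that $H(q,du_0(q))<\alpha(0)$ for each $q\notin\mathcal A(0)$, and, for every such $u_0$, the periodic Aubry set $$\mathcal A^*(0):=\{(q,du_0(q)) : q\in\mathcal A(0)\}\subset\mathbb T^d\times(\mathbb R^d)^*$$ satisfies $$\mathcal A^*(0)=\bigcap_u\mathcal I^*(u),$$ where the intersection is taken over all periodic weak KAM solutions $u$. -/

import Mathlib

set_option maxSynthPendingDepth 3

noncomputable section

namespace WeakKAM

/-- The configuration space `ℝ^d` with its Euclidean norm. -/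
abbrev Pos (d : ℕ) : Type := EuclideanSpace ℝ (Fin d)

/-- The space of momenta `(ℝ^d)^*`, with the dual of the Euclidean norm. -/
abbrev Mom (d : ℕ) : Type := Pos d →L[ℝ] ℝ

/-- The phase space `ℝ^d × (ℝ^d)^*`. -/
abbrev Phase (d : ℕ) : Type := Pos d × Mom d

/-- The vector of `ℝ^d` with integer coordinates `w`. -/
def intVec {d : ℕ} (w : Fin d → ℤ) : Pos d := WithLp.toLp 2 fun i => (w i : ℝ)

/-- The projection `ℝ^d × (ℝ^d)^* → 𝕋^d × (ℝ^d)^*`, where `𝕋^d = ℝ^d / ℤ^d`. -/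
def toTorus {d : ℕ} (x : Phase d) : UnitAddTorus (Fin d) × Mom d :=
  (fun i => ((x.1 i : ℝ) : UnitAddCircle), x.2)

/-- The standing assumptions on an autonomous Hamiltonian `H(q,p)`: it is `C²` with second
differential bounded by `M`, `∂²_{pp} H ≥ m Id` with `m > 0`, it has quadratic growth in `p`, and it
is `ℤ^d`-periodic in `q`. -/
structure IsPeriodicHamiltonian {d : ℕ} (H : Phase d → ℝ) (m M : ℝ) : Prop where
  contDiff : ContDiff ℝ 2 H
  hessian_le : ∀ x, ‖fderiv ℝ (fderiv ℝ H) x‖ ≤ M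
  m_pos : 0 < m
  convex : ∀ (x : Phase d) (l : Mom d), m * ‖l‖ ^ 2 ≤ fderiv ℝ (fderiv ℝ H) x (0, l) (0, l)
  lower : ∀ (q : Pos d) (p : Mom d), m / 2 * ‖p‖ ^ 2 - M ≤ H (q, p)
  upper : ∀ (q : Pos d) (p : Mom d), H (q, p) ≤ M / 2 * ‖p‖ ^ 2 + M
  periodic : ∀ (w : Fin d → ℤ) (q : Pos d) (p : Mom d), H (q + intVec w, p) = H (q, p)

/-- The Hamiltonian vector field `(∂_p H, -∂_q H)`. The `i`-th coordinate of `∂_p H ∈ ℝ^d` is the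
derivative of `H` along the `i`-th coordinate form of `(ℝ^d)^*`. -/
def hamVF {d : ℕ} (H : Phase d → ℝ) (x : Phase d) : Phase d :=
  (WithLp.toLp 2 fun i => fderiv ℝ H x (0, EuclideanSpace.proj i),
    -(fderiv ℝ H x).comp (ContinuousLinearMap.inl ℝ (Pos d) (Mom d)))

/-- `γ : ℝ → ℝ^d × (ℝ^d)^*` is an orbit of the Hamiltonian system. -/
def IsOrbit {d : ℕ} (H : Phase d → ℝ) (γ : ℝ → Phase d) : Prop :=
  ∀ t : ℝ, HasDerivAt γ (hamVF H (γ t)) t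

open Classical in
/-- The Hamiltonian flow `φ^t`: `flow H t x` is the value at time `t` of the orbit which is equal to
`x` at time `0` (it exists and is unique when the vector field is Lipschitz; the value `x` in the
other case is a convention). -/
def flow {d : ℕ} (H : Phase d → ℝ) (t : ℝ) (x : Phase d) : Phase d :=
  if h : ∃ γ : ℝ → Phase d, IsOrbit H γ ∧ γ 0 = x then h.choose t else x

/-- The Hamiltonian action `∫_0^t p · q̇ - H(q,p) ds` of the orbit starting at `x`. -/
def orbitAction {d : ℕ} (H : Phase d → ℝ) (t : ℝ) (x : Phase d) : ℝ :=
  ∫ s in (0 : ℝ)..t, ((flow H s x).2 (hamVF H (flow H s x)).1 - H (flow H s x))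

open Classical in
/-- The generating function `S^t(q₀,q₁)`: the action of the orbit joining `q₀` to `q₁` between the
times `0` and `t`. It is meaningful when `t > 0` is small enough: this orbit then exists and is
unique for all `q₀`, `q₁`. -/
def genFun {d : ℕ} (H : Phase d → ℝ) (t : ℝ) (q₀ q₁ : Pos d) : ℝ :=
  if h : ∃ p : Mom d, (flow H t (q₀, p)).1 = q₁ then orbitAction H t (q₀, h.choose) else 0

/-- The minimum over `θ₀ = q₀, θ₁, …, θ_n = q₁` of
`S^{t/n}(θ₀,θ₁) + S^{t/n}(θ₁,θ₂) + ⋯ + S^{t/n}(θ_{n-1},θ_n)`. -/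
def brokenAction {d : ℕ} (H : Phase d → ℝ) (n : ℕ) (t : ℝ) (q₀ q₁ : Pos d) : ℝ :=
  ⨅ θ : {θ : Fin (n + 1) → Pos d // θ 0 = q₀ ∧ θ (Fin.last n) = q₁},
    ∑ i : Fin n, genFun H (t / n) (θ.1 i.castSucc) (θ.1 i.succ)

/-- The minimal action `A^t(q₀,q₁)`, `t > 0`: the common value of `brokenAction H n t q₀ q₁` for
all large enough `n` (this sequence is eventually constant). -/
def minAction {d : ℕ} (H : Phase d → ℝ) (t : ℝ) (q₀ q₁ : Pos d) : ℝ :=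
  Filter.limUnder Filter.atTop fun n : ℕ => brokenAction H n t q₀ q₁

/-- The Lax-Oleinik operator `T^t u (q) = inf_θ (u(θ) + A^t(θ,q))`, `t > 0`, with values in
`[-∞,∞]` since the infimum need not be finite for an arbitrary function `u`. -/
def laxOleinik {d : ℕ} (H : Phase d → ℝ) (t : ℝ) (u : Pos d → ℝ) (q : Pos d) : EReal :=
  ⨅ θ : Pos d, ((u θ + minAction H t θ q : ℝ) : EReal)

/-- `u` is `ℤ^d`-periodic. -/
def IsPeriodic {d : ℕ} (u : Pos d → ℝ) : Prop :=
  ∀ (w : Fin d → ℤ) (q : Pos d), u (q + intVec w) = u q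

/-- `u` is a weak KAM solution: for some level `a`, `T^t u + t a = u` for all `t ≥ 0`
(for `t = 0` this is void, `T^0` being the identity). -/
def IsWeakKAM {d : ℕ} (H : Phase d → ℝ) (u : Pos d → ℝ) : Prop :=
  ∃ a : ℝ, ∀ t : ℝ, 0 < t → ∀ q : Pos d,
    laxOleinik H t u q + ((t * a : ℝ) : EReal) = ((u q : ℝ) : EReal)

/-- `Γ_u`: the graph of the differential of `u` on its domain of definition. -/
def diffGraph {d : ℕ} (u : Pos d → ℝ) : Set (Phase d) :=
  {x | DifferentiableAt ℝ u x.1 ∧ x.2 = fderiv ℝ u x.1}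

/-- `𝓘^*(u) = ⋂_{n ∈ ℕ} φ^{-n}(closure Γ_u)`, as a subset of `ℝ^d × (ℝ^d)^*`. -/
def invSet {d : ℕ} (H : Phase d → ℝ) (u : Pos d → ℝ) : Set (Phase d) :=
  ⋂ n : ℕ, flow H (n : ℝ) ⁻¹' closure (diffGraph u)

/-- `u` is a sub-solution of `H(q,du(q)) = a`: it is Lipschitz and `H(q,du(q)) ≤ a` at each point of
differentiability. -/
def IsSubsolution {d : ℕ} (H : Phase d → ℝ) (a : ℝ) (u : Pos d → ℝ) : Prop :=
  (∃ K, LipschitzWith K u) ∧ ∀ q : Pos d, DifferentiableAt ℝ u q → H (q, fderiv ℝ u q) ≤ a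

/-- The periodic critical value `α(0)`: the infimum of the levels `a` which admit a periodic
sub-solution. -/
def critValue {d : ℕ} (H : Phase d → ℝ) : ℝ :=
  sInf {a : ℝ | ∃ u : Pos d → ℝ, IsPeriodic u ∧ IsSubsolution H a u}

/-- `u` is a critical periodic sub-solution. -/
def IsCriticalSub {d : ℕ} (H : Phase d → ℝ) (u : Pos d → ℝ) : Prop :=
  IsPeriodic u ∧ IsSubsolution H (critValue H) u

/-- The projected periodic Aubry set `𝓐(0)`, lifted to `ℝ^d`: the points `q` such that
`H(q,du(q)) = α(0)` for all `C¹` critical periodic sub-solutions `u`. -/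
def projAubry {d : ℕ} (H : Phase d → ℝ) : Set (Pos d) :=
  {q | ∀ u : Pos d → ℝ, ContDiff ℝ 1 u → IsCriticalSub H u → H (q, fderiv ℝ u q) = critValue H}

/-- `u` is a `C^{1,1}` critical periodic sub-solution which is strict outside of `𝓐(0)`. -/
structure IsStrictCriticalSub {d : ℕ} (H : Phase d → ℝ) (u : Pos d → ℝ) : Prop where
  critical : IsCriticalSub H u
  contDiff : ContDiff ℝ 1 u
  lipschitz : ∃ K, LipschitzWith K (fderiv ℝ u)
  strict : ∀ q : Pos d, q ∉ projAubry H → H (q, fderiv ℝ u q) < critValue H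

/-- The graph over `𝓐(0)` of the differential of `u`, in `𝕋^d × (ℝ^d)^*`. This is the periodic Aubry
set `𝓐^*(0)` when `u` is a `C^{1,1}` critical periodic sub-solution strict outside of `𝓐(0)`. -/
def aubryGraph {d : ℕ} (H : Phase d → ℝ) (u : Pos d → ℝ) : Set (UnitAddTorus (Fin d) × Mom d) :=
  toTorus '' {x : Phase d | x.1 ∈ projAubry H ∧ x.2 = fderiv ℝ u x.1}

end WeakKAM

end

/-! The proof rests on the short-time generating functions `genFun`. Since `H` is uniformly convex
in `p`, an action gap estimate shows that they satisfy the triangle inequality, with equality at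
suitable intermediate points, are strongly convex in each variable with modulus of order `1 / r`,
and have Lipschitz differentials. These facts are packaged in `ActionKernel`, which is stable under
time reversal. A sub-solution at level `a` is the same as a dominated function, `u y ≤ u x + k r x y
+ a * r` for small `r`: one direction differentiates along an orbit, the other integrates the
Fenchel inequality along almost every translate of an orbit. Weak KAM solutions are the dominated
functions for which the inequality is attained at each `y`.

The operator `T` preserves domination and makes any function semi-concave; applied in short time to
a semi-convex function it gives a `C^{1,1}` function. A forward step followed by a short backward
step thus regularizes periodic dominated functions. To keep strictness at a point `q` outside the
Aubry set, a small potential `V` with `V q > 0` is first added to `H` and the regularization is done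
for `H + V`. By the Lindelöf property countably many of these functions suffice, and an infinite
convex combination of them is strict at every point outside the Aubry set.

By strict convexity all `C¹` critical sub-solutions share their differential on the Aubry set.
Applying this to `u₀` and to its short-time evolutions, which are still `C^{1,1}`, shows that the
lifted Aubry set is invariant under the flow. Its orbits are then calibrated by every `C¹` critical
sub-solution, hence by every periodic weak KAM solution `u`, which is compared with its backward
regularization. A calibrated dominated function is differentiable inside the orbit, with the
momentum as differential, so the Aubry set lies in each invariant set.

For the converse one weak KAM solution is enough: the largest critical sub-solution `maxSub` equal
to `u₀` on the Aubry set. Along an orbit of its invariant set, `maxSub - u₀` is non-negative and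
non-decreasing, and its speed bounds both the energy defect of `u₀` and the squared distance of the
momentum to `fderiv ℝ u₀`. The orbit accumulates on the Aubry set, where the difference vanishes.
Hence the difference is identically zero along the orbit, its speed is zero, and the orbit lies in
the Aubry set. -/

noncomputable section

namespace WeakKAM

open Set Filter Topology Metric
open scoped NNReal Manifold ContDiff

/-! ### Global integral curves of Lipschitz vector fields and short-time estimates. -/

section ODE

variable {F : Type*} [NormedAddCommGroup F] [NormedSpace ℝ F]

/-- A Lipschitz `C¹` vector field on a Banach space has global integral curves. -/
theorem exists_global_integralCurve [CompleteSpace F] {v : F → F} {K : ℝ≥0} (hv : LipschitzWith K v)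
    (hv1 : ContDiff ℝ 1 v) (x : F) : ∃ γ : ℝ → F, γ 0 = x ∧ ∀ t, HasDerivAt γ (v (γ t)) t := by
  have hsec : CMDiff 1 (fun x : F ↦ (⟨x, v x⟩ : TangentBundle 𝓘(ℝ, F) F)) :=
    contMDiff_vectorSpace_iff_contDiff.2 hv1
  -- With a ball of radius `‖v x‖ + 1`, growing with the speed at `x`, the local existence time does
  -- not depend on `x`, so local curves can be continued for all times.
  set ε : ℝ := 1 / (2 * (K + 1)) with hε
  have hεpos : 0 < ε := by positivity
  have hloc : ∀ x : F, ∃ γ : ℝ → F, γ 0 = x ∧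
      IsMIntegralCurveOn (I := 𝓘(ℝ, F)) γ (v : (x : F) → TangentSpace 𝓘(ℝ, F) x) (Ioo (-ε) ε) := by
    intro x
    have h0 : (0 : ℝ) ∈ Icc (-ε) ε := ⟨by linarith, hεpos.le⟩
    set a : ℝ≥0 := ‖v x‖₊ + 1
    have hPL : IsPicardLindelof (fun _ => v) (⟨0, h0⟩ : Icc (-ε) ε) x a 0 (‖v x‖₊ + K * a) K := by
      refine IsPicardLindelof.of_time_independent (fun y hy => ?_) hv.lipschitzOnWith ?_
      · have h1 : ‖v y - v x‖ ≤ K * ‖y - x‖ := hv.norm_sub_le y x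
        have h2 : ‖y - x‖ ≤ a := by simpa [dist_eq_norm] using hy
        have h3 : ‖v y‖ ≤ ‖v x‖ + ‖v y - v x‖ := by
          simpa using norm_add_le (v x) (v y - v x)
        have : ‖v y‖ ≤ ‖v x‖ + K * a := by
          nlinarith [mul_le_mul_of_nonneg_left h2 K.coe_nonneg]
        simpa using this
      · simp only [sub_neg_eq_add, zero_add, sub_zero, max_self, NNReal.coe_add, NNReal.coe_mul,
          coe_nnnorm, NNReal.coe_zero]
        have ha : (a : ℝ) = ‖v x‖ + 1 := by simp [a]
        have hK := K.coe_nonneg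
        have : (‖v x‖ + K * (a : ℝ)) ≤ (2 * (K + 1)) * a := by
          rw [ha]; nlinarith [norm_nonneg (v x), mul_nonneg hK (norm_nonneg (v x))]
        calc (‖v x‖ + K * (a : ℝ)) * ε ≤ ((2 * (K + 1)) * a) * ε := by gcongr
          _ = a := by rw [hε]; field_simp
    obtain ⟨γ, hγ0, hγ⟩ := hPL.exists_eq_forall_mem_Icc_hasDerivWithinAt₀
    refine ⟨γ, hγ0, fun t ht => ?_⟩
    have := (hγ t (Ioo_subset_Icc_self ht)).mono Ioo_subset_Icc_self
    exact this.hasFDerivWithinAt.hasMFDerivWithinAt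
  obtain ⟨γ, hγ0, hγ⟩ := exists_isMIntegralCurve_of_isMIntegralCurveOn hsec hεpos hloc x
  refine ⟨γ, hγ0, fun t => ?_⟩
  have h1 : HasFDerivAt γ ((1 : ℝ →L[ℝ] ℝ).smulRight (v (γ t)) : ℝ →L[ℝ] F) t := (hγ t).hasFDerivAt
  simpa using h1.hasDerivAt

theorem integralCurve_unique {v : F → F} {K : ℝ≥0} (hv : LipschitzWith K v) {γ γ' : ℝ → F}
    (h : ∀ t, HasDerivAt γ (v (γ t)) t) (h' : ∀ t, HasDerivAt γ' (v (γ' t)) t) {t₀ : ℝ}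
    (h0 : γ t₀ = γ' t₀) : γ = γ' :=
  ODE_solution_unique_univ (v := fun _ => v) (s := fun _ => univ) (K := K)
    (fun _ => hv.lipschitzOnWith) (fun t => ⟨h t, mem_univ _⟩) (fun t => ⟨h' t, mem_univ _⟩) h0

theorem hasDerivAt_reverse {v : F → F} {γ : ℝ → F} (h : ∀ t, HasDerivAt γ (v (γ t)) t) (t : ℝ) :
    HasDerivAt (fun s => γ (-s)) ((-v) (γ (-t))) t := by
  have := (h (-t)).scomp t (hasDerivAt_neg t)
  simpa [Function.comp_def] using this

theorem dist_integralCurve_le {v : F → F} {K : ℝ≥0} (hv : LipschitzWith K v) {γ γ' : ℝ → F}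
    (h : ∀ t, HasDerivAt γ (v (γ t)) t) (h' : ∀ t, HasDerivAt γ' (v (γ' t)) t) (t : ℝ) :
    ‖γ t - γ' t‖ ≤ ‖γ 0 - γ' 0‖ * Real.exp (K * |t|) := by
  have key : ∀ {w : F → F} {c c' : ℝ → F}, LipschitzWith K w → (∀ t, HasDerivAt c (w (c t)) t) →
      (∀ t, HasDerivAt c' (w (c' t)) t) → ∀ t, 0 ≤ t →
      ‖c t - c' t‖ ≤ ‖c 0 - c' 0‖ * Real.exp (K * t) := by
    intro w c c' hw hc hc' t ht
    have := dist_le_of_trajectories_ODE (v := fun _ => w) (K := K) (a := 0) (b := t)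
      (δ := ‖c 0 - c' 0‖) (fun _ => hw) (fun s _ => (hc s).continuousAt.continuousWithinAt)
      (fun s _ => (hc s).hasDerivWithinAt) (fun s _ => (hc' s).continuousAt.continuousWithinAt)
      (fun s _ => (hc' s).hasDerivWithinAt) (by rw [dist_eq_norm]) t ⟨ht, le_rfl⟩
    simpa [dist_eq_norm] using this
  rcases le_total 0 t with ht | ht
  · rw [abs_of_nonneg ht]; exact key hv h h' t ht
  · rw [abs_of_nonpos ht]
    have := key (w := -v) (c := fun s => γ (-s)) (c' := fun s => γ' (-s)) hv.neg
      (hasDerivAt_reverse h) (hasDerivAt_reverse h') (-t) (by linarith)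
    simpa using this

/-- A curve whose speed is bounded by `C` on `[-T, T]` moves at most `C |t|` from its
starting point. -/
theorem norm_sub_le_of_norm_deriv_le {γ γ' : ℝ → F} {T C : ℝ}
    (h : ∀ t, HasDerivAt γ (γ' t) t) (hC : ∀ t, |t| ≤ T → ‖γ' t‖ ≤ C) {t : ℝ} (ht : |t| ≤ T) :
    ‖γ t - γ 0‖ ≤ C * |t| := by
  have := (convex_Icc (-T) T).norm_image_sub_le_of_norm_hasDerivWithin_le
    (f := γ) (f' := γ') (C := C) (fun s _ => (h s).hasDerivWithinAt)
    (fun s hs => hC s (abs_le.2 hs)) (x := 0) (y := t) ⟨by linarith [abs_nonneg t], by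
      linarith [abs_nonneg t]⟩ (abs_le.1 ht)
  simpa using this

theorem exp_le_two_of_le {x : ℝ} (hx : x ≤ 1 / 2) : Real.exp x ≤ 2 := by
  have h1 : Real.exp x ≤ Real.exp (1 / 2) := Real.exp_le_exp.2 hx
  have h2 : Real.exp (1 / 2) * Real.exp (1 / 2) = Real.exp 1 := by rw [← Real.exp_add]; norm_num
  have h3 := Real.exp_one_lt_d9
  nlinarith [Real.exp_pos (1 / 2)]

/-- While `K * |t| ≤ 1 / 2` the distance of two curves at most doubles, so their difference moves
with speed at most `2 * K` times the initial distance. To leading order the difference of two orbits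
is constant. -/
theorem norm_integralCurve_sub_sub_le {v : F → F} {K : ℝ≥0} (hv : LipschitzWith K v) {γ γ' : ℝ → F}
    (h : ∀ t, HasDerivAt γ (v (γ t)) t) (h' : ∀ t, HasDerivAt γ' (v (γ' t)) t) {t : ℝ}
    (ht : K * |t| ≤ 1 / 2) :
    ‖(γ t - γ' t) - (γ 0 - γ' 0)‖ ≤ 2 * K * ‖γ 0 - γ' 0‖ * |t| := by
  refine norm_sub_le_of_norm_deriv_le (γ := fun s => γ s - γ' s) (T := |t|)
    (fun s => (h s).sub (h' s)) (fun s hs => ?_) le_rfl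
  have h1 : K * |s| ≤ 1 / 2 := le_trans (by gcongr) ht
  calc ‖v (γ s) - v (γ' s)‖ ≤ K * ‖γ s - γ' s‖ := hv.norm_sub_le _ _
    _ ≤ K * (‖γ 0 - γ' 0‖ * 2) := by
        gcongr
        exact (dist_integralCurve_le hv h h' s).trans (by gcongr; exact exp_le_two_of_le h1)
    _ = _ := by ring

theorem norm_integralCurve_sub_le {v : F → F} {K : ℝ≥0} (hv : LipschitzWith K v) {γ : ℝ → F}
    (h : ∀ t, HasDerivAt γ (v (γ t)) t) {t : ℝ} (ht : K * |t| ≤ 1 / 2) :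
    ‖γ t - γ 0‖ ≤ 2 * ‖v (γ 0)‖ * |t| := by
  -- compare the curve with its time translates, whose distance controls the speed
  have hsp : ∀ s, |s| ≤ |t| → ‖v (γ s)‖ ≤ 2 * ‖v (γ 0)‖ := by
    intro s hs
    have h1 : K * |s| ≤ 1 / 2 := le_trans (by gcongr) ht
    have hlim : Tendsto (fun r : ℝ => ‖r⁻¹ • (γ (s + r) - γ s)‖) (𝓝[≠] 0) (𝓝 ‖v (γ s)‖) :=
      ((h s).tendsto_slope_zero).norm
    have hlim0 : Tendsto (fun r : ℝ => 2 * ‖r⁻¹ • (γ (0 + r) - γ 0)‖) (𝓝[≠] 0)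
        (𝓝 (2 * ‖v (γ 0)‖)) := ((h 0).tendsto_slope_zero).norm.const_mul 2
    refine le_of_tendsto_of_tendsto' hlim hlim0 (fun r => ?_)
    have h2 := dist_integralCurve_le hv (γ := fun s => γ (s + r)) (γ' := γ)
      (fun u => by simpa using (h (u + r)).comp_add_const u r) h s
    rw [norm_smul, norm_smul]
    have h3 : ‖γ (s + r) - γ s‖ ≤ ‖γ (0 + r) - γ 0‖ * 2 :=
      h2.trans (by gcongr; exact exp_le_two_of_le h1)
    nlinarith [mul_le_mul_of_nonneg_left h3 (norm_nonneg r⁻¹)]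
  exact norm_sub_le_of_norm_deriv_le h hsp le_rfl

end ODE

end WeakKAM

end

/-! ### The Hamiltonian vector field, its flow, energy and action. -/

noncomputable section

namespace WeakKAM

open Set Filter Topology Metric
open scoped NNReal ContDiff

variable {d : ℕ}

/-- A Hamiltonian satisfying the standing assumptions with normalized constants `m ≤ 1 ≤ M`. -/
structure IsTame (H : Phase d → ℝ) (m M : ℝ) : Prop extends IsPeriodicHamiltonian H m M where
  le_one : m ≤ 1
  one_le : 1 ≤ M

theorem IsPeriodicHamiltonian.isTame {H : Phase d → ℝ} {m M : ℝ}
    (hH : IsPeriodicHamiltonian H m M) : IsTame H (min m 1) (max M 1) where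
  contDiff := hH.contDiff
  hessian_le x := (hH.hessian_le x).trans (le_max_left _ _)
  m_pos := lt_min hH.m_pos one_pos
  convex x l := (mul_le_mul_of_nonneg_right (min_le_left _ _) (by positivity)).trans (hH.convex x l)
  lower q p := by
    refine le_trans ?_ (hH.lower q p)
    have := mul_le_mul_of_nonneg_right (min_le_left m 1) (sq_nonneg ‖p‖)
    linarith [le_max_left M 1]
  upper q p := by
    refine (hH.upper q p).trans ?_
    have := mul_le_mul_of_nonneg_right (le_max_left M 1) (sq_nonneg ‖p‖)
    linarith [le_max_left M 1]
  periodic := hH.periodic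
  le_one := min_le_right _ _
  one_le := le_max_right _ _

theorem apply_eq_sum_coord (l : Mom d) (v : Pos d) :
    l v = ∑ i, v i * l (EuclideanSpace.single i (1 : ℝ)) := by
  conv_lhs => rw [← (EuclideanSpace.basisFun (Fin d) ℝ).sum_repr v]
  simp

/-- `∂_p H` is characterized by its pairing with the momenta. -/
theorem apply_hamVF_fst (H : Phase d → ℝ) (x : Phase d) (l : Mom d) :
    l (hamVF H x).1 = fderiv ℝ H x (0, l) := by
  have hl : l = ∑ i, l (EuclideanSpace.single i (1 : ℝ)) • (EuclideanSpace.proj i : Mom d) := by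
    ext v
    rw [apply_eq_sum_coord]
    simp [mul_comm]
  have h2 : ((0, l) : Phase d) = ∑ i, l (EuclideanSpace.single i (1 : ℝ)) •
      ((0, EuclideanSpace.proj i) : Phase d) := by
    conv_lhs => rw [hl]
    ext1
    · simp [Prod.fst_sum]
    · simp [Prod.snd_sum]
  rw [apply_eq_sum_coord, h2, map_sum]
  simp only [map_smul, smul_eq_mul, hamVF, mul_comm]

theorem hamVF_snd_apply (H : Phase d → ℝ) (x : Phase d) (v : Pos d) :
    (hamVF H x).2 v = -fderiv ℝ H x (v, 0) := by
  simp [hamVF]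

/-- A vector is bounded by `C` as soon as its pairing with every momentum is. -/
theorem norm_le_of_forall_apply_le {v : Pos d} {C : ℝ} (hC : 0 ≤ C) (h : ∀ l : Mom d, l v ≤ C * ‖l‖) :
    ‖v‖ ≤ C := by
  rcases eq_or_ne v 0 with rfl | hv
  · simpa using hC
  have := h (InnerProductSpace.toDual ℝ (Pos d) v)
  simp only [InnerProductSpace.toDual_apply_apply, real_inner_self_eq_norm_sq,
    LinearIsometryEquiv.norm_map] at this
  have hp : 0 < ‖v‖ := norm_pos_iff.2 hv
  nlinarith

theorem mom_le {l : Mom d} {v : Pos d} : l v ≤ ‖l‖ * ‖v‖ := (le_abs_self _).trans (l.le_opNorm v)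

theorem neg_le_mom {l : Mom d} {v : Pos d} : -(‖l‖ * ‖v‖) ≤ l v :=
  neg_le_of_abs_le (l.le_opNorm v)

/-- Mean value inequality on a segment. -/
theorem mul_sub_le_of_le_deriv {f f' : ℝ → ℝ} {a b c : ℝ} (hab : a ≤ b)
    (h : ∀ s, HasDerivAt f (f' s) s) (hc : ∀ s ∈ Icc a b, c ≤ f' s) : c * (b - a) ≤ f b - f a := by
  refine (convex_Icc a b).mul_sub_le_image_sub_of_le_deriv
    (fun s _ => (h s).continuousAt.continuousWithinAt)
    (fun s _ => (h s).differentiableAt.differentiableWithinAt) (fun s hs => ?_) a ⟨le_rfl, hab⟩ b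
    ⟨hab, le_rfl⟩ hab
  rw [(h s).deriv]
  exact hc s (interior_subset hs)

theorem sub_le_mul_of_deriv_le {f f' : ℝ → ℝ} {a b c : ℝ} (hab : a ≤ b)
    (h : ∀ s, HasDerivAt f (f' s) s) (hc : ∀ s ∈ Icc a b, f' s ≤ c) : f b - f a ≤ c * (b - a) := by
  have := mul_sub_le_of_le_deriv (f := fun s => -f s) (c := -c) hab (fun s => (h s).neg)
    (fun s hs => neg_le_neg (hc s hs))
  linarith

theorem taylor_lower {f f' : ℝ → ℝ} {a c : ℝ} (h : ∀ s, HasDerivAt f (f' s) s)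
    (hc : ∀ s ∈ Icc (0 : ℝ) 1, a + c * s ≤ f' s) : f 0 + a + c / 2 ≤ f 1 := by
  have := mul_sub_le_of_le_deriv (f := fun s => f s - (a * s + c / 2 * s ^ 2))
    (f' := fun s => f' s - (a + c * s)) (c := 0) zero_le_one (fun s => by
      refine (h s).sub ?_
      have := ((hasDerivAt_id s).const_mul a).add (((hasDerivAt_id s).pow 2).const_mul (c / 2))
      exact this.congr_deriv (by simp; ring)) (fun s hs => by linarith [hc s hs])
  norm_num at this
  linarith

theorem taylor_upper {f f' : ℝ → ℝ} {a c : ℝ} (h : ∀ s, HasDerivAt f (f' s) s)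
    (hc : ∀ s ∈ Icc (0 : ℝ) 1, f' s ≤ a + c * s) : f 1 ≤ f 0 + a + c / 2 := by
  have := taylor_lower (f := fun s => -f s) (a := -a) (c := -c) (fun s => (h s).neg)
    (fun s hs => by linarith [hc s hs])
  linarith

theorem hasDerivAt_line {F : Type*} [NormedAddCommGroup F] [NormedSpace ℝ F] (x v : F) (s : ℝ) :
    HasDerivAt (fun s : ℝ => x + s • v) v s := by
  simpa using ((hasDerivAt_id s).smul_const v).const_add x

namespace IsTame

variable {H : Phase d → ℝ} {m M : ℝ}

theorem M_pos (hH : IsTame H m M) : 0 < M := lt_of_lt_of_le one_pos hH.one_le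

theorem coe_toNNReal (hH : IsTame H m M) : (M.toNNReal : ℝ) = M := Real.coe_toNNReal _ hH.M_pos.le

theorem contDiff_fderiv (hH : IsTame H m M) : ContDiff ℝ 1 (fderiv ℝ H) :=
  hH.contDiff.fderiv_right (by norm_num)

theorem hasFDerivAt (hH : IsTame H m M) (x : Phase d) : HasFDerivAt H (fderiv ℝ H x) x :=
  (hH.contDiff.differentiable (by norm_num) x).hasFDerivAt

theorem hasFDerivAt_fderiv (hH : IsTame H m M) (x : Phase d) :
    HasFDerivAt (fderiv ℝ H) (fderiv ℝ (fderiv ℝ H) x) x :=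
  (hH.contDiff_fderiv.differentiable (by norm_num) x).hasFDerivAt

theorem lipschitzWith_fderiv (hH : IsTame H m M) : LipschitzWith M.toNNReal (fderiv ℝ H) :=
  lipschitzWith_of_nnnorm_fderiv_le (hH.contDiff_fderiv.differentiable (by norm_num)) fun x => by
    rw [← NNReal.coe_le_coe, hH.coe_toNNReal]
    exact hH.hessian_le x

theorem norm_fderiv_sub_le (hH : IsTame H m M) (x y : Phase d) :
    ‖fderiv ℝ H x - fderiv ℝ H y‖ ≤ M * ‖x - y‖ := by
  simpa [hH.coe_toNNReal] using hH.lipschitzWith_fderiv.norm_sub_le x y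

theorem norm_zero_mom (l : Mom d) : ‖((0, l) : Phase d)‖ = ‖l‖ := by simp [Prod.norm_def]

theorem norm_pos_zero (v : Pos d) : ‖((v, 0) : Phase d)‖ = ‖v‖ := by simp [Prod.norm_def]

/-- Each component is tested by duality against `(0, l)` or `(v, 0)`, which have the norms of `l`
and `v` in the sup norm of the product. No constant is lost. -/
theorem norm_hamVF_sub_le (hH : IsTame H m M) (x y : Phase d) :
    ‖hamVF H x - hamVF H y‖ ≤ M * ‖x - y‖ := by
  have hD := hH.norm_fderiv_sub_le x y
  have hM := mul_nonneg hH.M_pos.le (norm_nonneg (x - y))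
  refine norm_prod_le_iff.2 ⟨norm_le_of_forall_apply_le hM fun l => ?_,
    ContinuousLinearMap.opNorm_le_bound _ hM fun v => ?_⟩
  · have : l (hamVF H x - hamVF H y).1 = (fderiv ℝ H x - fderiv ℝ H y) (0, l) := by
      simp [apply_hamVF_fst]
    rw [this]
    refine (Real.le_norm_self _).trans ((ContinuousLinearMap.le_opNorm _ _).trans ?_)
    rw [norm_zero_mom]
    gcongr
  · have : (hamVF H x - hamVF H y).2 v = -(fderiv ℝ H x - fderiv ℝ H y) (v, 0) := by
      simp [hamVF_snd_apply]; ring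
    rw [this, norm_neg]
    refine (ContinuousLinearMap.le_opNorm _ _).trans ?_
    rw [norm_pos_zero]
    gcongr

theorem lipschitzWith_hamVF (hH : IsTame H m M) : LipschitzWith M.toNNReal (hamVF H) :=
  LipschitzWith.of_dist_le_mul fun x y => by
    rw [dist_eq_norm, dist_eq_norm, hH.coe_toNNReal]
    exact hH.norm_hamVF_sub_le x y

theorem contDiff_hamVF (hH : IsTame H m M) : ContDiff ℝ 1 (hamVF H) := by
  have h := hH.contDiff_fderiv
  refine ContDiff.prodMk ?_ ?_
  · rw [contDiff_euclidean]
    intro i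
    exact h.clm_apply contDiff_const
  · exact (h.clm_comp contDiff_const).neg

/-! ### Second order inequalities -/

theorem hasDerivAt_along (hH : IsTame H m M) (x v : Phase d) (s : ℝ) :
    HasDerivAt (fun s : ℝ => H (x + s • v)) (fderiv ℝ H (x + s • v) v) s :=
  (hH.hasFDerivAt _).comp_hasDerivAt s (hasDerivAt_line x v s)

theorem hasDerivAt_fderiv_along (hH : IsTame H m M) (x v : Phase d) (s : ℝ) :
    HasDerivAt (fun s : ℝ => fderiv ℝ H (x + s • v) v)
      (fderiv ℝ (fderiv ℝ H) (x + s • v) v v) s := by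
  have := (hH.hasFDerivAt_fderiv _).comp_hasDerivAt s (hasDerivAt_line x v s)
  simpa using this.clm_apply (hasDerivAt_const s v)

theorem monotone_fderiv (hH : IsTame H m M) (x : Phase d) (l : Mom d) {s : ℝ} (hs : 0 ≤ s) :
    m * ‖l‖ ^ 2 * s ≤ fderiv ℝ H (x + s • (0, l)) (0, l) - fderiv ℝ H x (0, l) := by
  simpa using mul_sub_le_of_le_deriv hs (hH.hasDerivAt_fderiv_along x (0, l))
    (fun s _ => hH.convex _ l)

/-- Strong convexity in the momentum. -/
theorem strong_convex (hH : IsTame H m M) (q : Pos d) (p l : Mom d) :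
    H (q, p) + l (hamVF H (q, p)).1 + m / 2 * ‖l‖ ^ 2 ≤ H (q, p + l) := by
  have := taylor_lower (hH.hasDerivAt_along (q, p) (0, l)) (a := fderiv ℝ H (q, p) (0, l))
    (c := m * ‖l‖ ^ 2) (fun s hs => by
      linarith [hH.monotone_fderiv (q, p) l hs.1])
  simp only [zero_smul, add_zero, one_smul, Prod.mk_add_mk] at this
  rw [apply_hamVF_fst]
  linarith

/-- Taylor inequality in the position. -/
theorem taylor_pos (hH : IsTame H m M) (q v : Pos d) (p : Mom d) :
    H (q + v, p) ≤ H (q, p) - (hamVF H (q, p)).2 v + M / 2 * ‖v‖ ^ 2 := by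
  have := taylor_upper (hH.hasDerivAt_along (q, p) (v, 0)) (a := fderiv ℝ H (q, p) (v, 0))
    (c := M * ‖v‖ ^ 2) (fun s hs => by
      have h1 := hH.norm_fderiv_sub_le ((q, p) + s • (v, 0)) (q, p)
      have h2 := (le_abs_self _).trans ((fderiv ℝ H ((q, p) + s • (v, 0)) -
        fderiv ℝ H (q, p)).le_opNorm (v, 0))
      rw [norm_pos_zero] at h2
      rw [add_sub_cancel_left, norm_smul, norm_pos_zero, Real.norm_of_nonneg hs.1] at h1
      have h3 := mul_le_mul_of_nonneg_right h1 (norm_nonneg v)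
      simp only [sub_apply] at h2
      linarith)
  simp only [zero_smul, add_zero, one_smul, Prod.mk_add_mk] at this
  rw [hamVF_snd_apply]
  linarith

/-- Fenchel inequality: the momentum `p` maximizes `l ↦ l · ∂_p H(q, p) - H(q, l)`. -/
theorem fenchel (hH : IsTame H m M) (q : Pos d) (p l : Mom d) :
    l (hamVF H (q, p)).1 - H (q, l) + m / 2 * ‖p - l‖ ^ 2 ≤
      p (hamVF H (q, p)).1 - H (q, p) := by
  have := hH.strong_convex q p (l - p)
  rw [add_sub_cancel, norm_sub_rev] at this
  simp only [sub_apply] at this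
  linarith

/-! ### The flow -/

theorem exists_isOrbit (hH : IsTame H m M) (x : Phase d) : ∃ γ : ℝ → Phase d, IsOrbit H γ ∧ γ 0 = x :=
  let ⟨γ, h0, h⟩ := exists_global_integralCurve hH.lipschitzWith_hamVF hH.contDiff_hamVF x
  ⟨γ, h, h0⟩

theorem flow_eq (hH : IsTame H m M) {γ : ℝ → Phase d} (h : IsOrbit H γ) (t : ℝ) :
    flow H t (γ 0) = γ t := by
  have hex := hH.exists_isOrbit (γ 0)
  rw [flow, dif_pos hex]
  exact congrFun (integralCurve_unique hH.lipschitzWith_hamVF hex.choose_spec.1 h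
    (t₀ := 0) hex.choose_spec.2) t

theorem hasDerivAt_flow (hH : IsTame H m M) (x : Phase d) (t : ℝ) :
    HasDerivAt (fun t => flow H t x) (hamVF H (flow H t x)) t := by
  obtain ⟨γ, h, rfl⟩ := hH.exists_isOrbit x
  simp only [hH.flow_eq h]
  exact h t

theorem flow_zero (hH : IsTame H m M) (x : Phase d) : flow H 0 x = x := by
  obtain ⟨γ, h, rfl⟩ := hH.exists_isOrbit x
  exact hH.flow_eq h 0

theorem flow_add (hH : IsTame H m M) (s t : ℝ) (x : Phase d) :
    flow H (s + t) x = flow H s (flow H t x) := by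
  have h : IsOrbit H (fun s => flow H (s + t) x) := fun s => by
    simpa using (hH.hasDerivAt_flow x (s + t)).comp_add_const s t
  simpa using (hH.flow_eq h s).symm

theorem flow_neg_flow (hH : IsTame H m M) (t : ℝ) (x : Phase d) :
    flow H (-t) (flow H t x) = x := by
  rw [← hH.flow_add, neg_add_cancel, hH.flow_zero]

theorem flow_flow_neg (hH : IsTame H m M) (t : ℝ) (x : Phase d) :
    flow H t (flow H (-t) x) = x := by
  rw [← hH.flow_add, add_neg_cancel, hH.flow_zero]

theorem continuous_flow_time (hH : IsTame H m M) (x : Phase d) : Continuous fun t => flow H t x :=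
  continuous_iff_continuousAt.2 fun t => (hH.hasDerivAt_flow x t).continuousAt

theorem norm_flow_sub_le (hH : IsTame H m M) (t : ℝ) (x y : Phase d) :
    ‖flow H t x - flow H t y‖ ≤ ‖x - y‖ * Real.exp (M * |t|) := by
  simpa [hH.flow_zero, hH.coe_toNNReal] using dist_integralCurve_le hH.lipschitzWith_hamVF
    (hH.hasDerivAt_flow x) (hH.hasDerivAt_flow y) t

theorem continuous_flow (hH : IsTame H m M) (t : ℝ) : Continuous (flow H t) :=
  (LipschitzWith.of_dist_le_mul (K := (Real.exp (M * |t|)).toNNReal) fun x y => by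
    rw [dist_eq_norm, dist_eq_norm, Real.coe_toNNReal _ (Real.exp_pos _).le, mul_comm]
    exact hH.norm_flow_sub_le t x y).continuous

theorem norm_flow_sub_sub_le (hH : IsTame H m M) {t : ℝ} (ht : M * |t| ≤ 1 / 2) (x y : Phase d) :
    ‖(flow H t x - flow H t y) - (x - y)‖ ≤ 2 * M * ‖x - y‖ * |t| := by
  simpa [hH.flow_zero, hH.coe_toNNReal] using norm_integralCurve_sub_sub_le hH.lipschitzWith_hamVF
    (hH.hasDerivAt_flow x) (hH.hasDerivAt_flow y) (t := t) (by rwa [hH.coe_toNNReal])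

theorem norm_flow_sub_self_le (hH : IsTame H m M) {t : ℝ} (ht : M * |t| ≤ 1 / 2) (x : Phase d) :
    ‖flow H t x - x‖ ≤ 2 * ‖hamVF H x‖ * |t| := by
  simpa [hH.flow_zero, hH.coe_toNNReal] using norm_integralCurve_sub_le hH.lipschitzWith_hamVF
    (hH.hasDerivAt_flow x) (t := t) (by rwa [hH.coe_toNNReal])

theorem continuous_flow_uncurry (hH : IsTame H m M) :
    Continuous fun z : ℝ × Phase d => flow H z.1 z.2 := by
  rw [continuous_iff_continuousAt]
  rintro ⟨t, x⟩
  have h1 : Tendsto (fun z : ℝ × Phase d => ‖z.2 - x‖ * Real.exp (M * |z.1|)) (𝓝 (t, x)) (𝓝 0) := by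
    have : Continuous fun z : ℝ × Phase d => ‖z.2 - x‖ * Real.exp (M * |z.1|) := by fun_prop
    simpa using this.tendsto (t, x)
  have h2 : Tendsto (fun z : ℝ × Phase d => flow H z.1 z.2 - flow H z.1 x) (𝓝 (t, x)) (𝓝 0) :=
    squeeze_zero_norm (fun z => hH.norm_flow_sub_le z.1 z.2 x) h1
  have h3 : Tendsto (fun z : ℝ × Phase d => flow H z.1 x) (𝓝 (t, x)) (𝓝 (flow H t x)) :=
    ((hH.continuous_flow_time x).comp continuous_fst).tendsto (t, x)
  simpa [ContinuousAt] using h2.add h3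

/-! ### Energy and action along the flow -/

theorem hasDerivAt_flow_fst (hH : IsTame H m M) (x : Phase d) (t : ℝ) :
    HasDerivAt (fun t => (flow H t x).1) (hamVF H (flow H t x)).1 t :=
  (hH.hasDerivAt_flow x t).fst

theorem hasDerivAt_flow_snd (hH : IsTame H m M) (x : Phase d) (t : ℝ) :
    HasDerivAt (fun t => (flow H t x).2) (hamVF H (flow H t x)).2 t :=
  (hH.hasDerivAt_flow x t).snd

theorem energy_flow (hH : IsTame H m M) (t : ℝ) (x : Phase d) : H (flow H t x) = H x := by
  have h : ∀ s, HasDerivAt (fun s => H (flow H s x)) 0 s := fun s => by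
    have h1 := (hH.hasFDerivAt (flow H s x)).comp_hasDerivAt s (hH.hasDerivAt_flow x s)
    refine h1.congr_deriv ?_
    have h2 : hamVF H (flow H s x) = ((hamVF H (flow H s x)).1, 0) + (0, (hamVF H (flow H s x)).2) := by
      simp
    conv_lhs => rw [h2, map_add]
    rw [← apply_hamVF_fst, hamVF_snd_apply]
    ring
  have := is_const_of_deriv_eq_zero (fun s => (h s).differentiableAt) (fun s => (h s).deriv) t 0
  simpa [hH.flow_zero] using this

/-- The Lagrangian density `p · q̇ - H(q, p)`. -/
def _root_.WeakKAM.density {d : ℕ} (H : Phase d → ℝ) (x : Phase d) : ℝ := x.2 (hamVF H x).1 - H x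

theorem continuous_density (hH : IsTame H m M) : Continuous (density H) :=
  (continuous_snd.clm_apply hH.contDiff_hamVF.continuous.fst).sub hH.contDiff.continuous

theorem hasDerivAt_orbitAction (hH : IsTame H m M) (x : Phase d) (t : ℝ) :
    HasDerivAt (fun t => orbitAction H t x) (density H (flow H t x)) t :=
  intervalIntegral.integral_hasDerivAt_right
    ((hH.continuous_density.comp (hH.continuous_flow_time x)).intervalIntegrable 0 t)
    ((hH.continuous_density.comp (hH.continuous_flow_time x)).stronglyMeasurableAtFilter _ _)
    (hH.continuous_density.comp (hH.continuous_flow_time x)).continuousAt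

theorem orbitAction_zero (x : Phase d) : orbitAction H 0 x = 0 := by simp [orbitAction]

theorem orbitAction_add (hH : IsTame H m M) (s t : ℝ) (x : Phase d) :
    orbitAction H (s + t) x = orbitAction H t x + orbitAction H s (flow H t x) := by
  have h : ∀ s, HasDerivAt (fun s => orbitAction H (s + t) x - orbitAction H s (flow H t x)) 0 s := by
    intro s
    have h1 := ((hH.hasDerivAt_orbitAction x (s + t)).comp_add_const s t).sub
      (hH.hasDerivAt_orbitAction (flow H t x) s)
    exact h1.congr_deriv (by simp [← hH.flow_add])
  have := is_const_of_deriv_eq_zero (fun s => (h s).differentiableAt) (fun s => (h s).deriv) s 0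
  simp only [zero_add, orbitAction_zero] at this
  linarith

theorem orbitAction_neg (hH : IsTame H m M) (t : ℝ) (x : Phase d) :
    orbitAction H (-t) (flow H t x) = -orbitAction H t x := by
  have := hH.orbitAction_add (-t) t x
  rw [neg_add_cancel, orbitAction_zero] at this
  linarith

theorem continuous_orbitAction (hH : IsTame H m M) (t : ℝ) : Continuous (orbitAction H t) :=
  intervalIntegral.continuous_parametric_intervalIntegral_of_continuous'
    (f := fun x s => density H (flow H s x))
    (hH.continuous_density.comp (hH.continuous_flow_uncurry.comp continuous_swap)) 0 t

/-! ### Periodicity -/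

theorem fderiv_translate (hH : IsTame H m M) (w : Fin d → ℤ) (x : Phase d) :
    fderiv ℝ H (x + (intVec w, 0)) = fderiv ℝ H x := by
  rw [← fderiv_comp_add_right]
  congr 1
  ext ⟨q, p⟩
  simpa using hH.periodic w q p

theorem hamVF_translate (hH : IsTame H m M) (w : Fin d → ℤ) (x : Phase d) :
    hamVF H (x + (intVec w, 0)) = hamVF H x := by
  simp only [hamVF, hH.fderiv_translate]

theorem flow_translate (hH : IsTame H m M) (w : Fin d → ℤ) (t : ℝ) (x : Phase d) :
    flow H t (x + (intVec w, 0)) = flow H t x + (intVec w, 0) := by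
  have h : IsOrbit H fun t => flow H t x + (intVec w, 0) := fun t => by
    rw [hH.hamVF_translate]
    exact (hH.hasDerivAt_flow x t).add_const _
  simpa [hH.flow_zero] using hH.flow_eq h t

theorem density_translate (hH : IsTame H m M) (w : Fin d → ℤ) (x : Phase d) :
    density H (x + (intVec w, 0)) = density H x := by
  obtain ⟨q, p⟩ := x
  have := hH.periodic w q p
  rw [density, density, hH.hamVF_translate]
  simp [this]

theorem orbitAction_translate (hH : IsTame H m M) (w : Fin d → ℤ) (t : ℝ) (x : Phase d) :
    orbitAction H t (x + (intVec w, 0)) = orbitAction H t x := by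
  change ∫ s in (0 : ℝ)..t, density H (flow H s (x + (intVec w, 0))) =
    ∫ s in (0 : ℝ)..t, density H (flow H s x)
  simp only [hH.flow_translate, hH.density_translate]

end IsTame

end WeakKAM

end

/-! ### Action gap, twist, and orbits joining two points in short time. -/

noncomputable section

namespace WeakKAM

open Set Filter Topology Metric
open scoped NNReal ContDiff

variable {d : ℕ}

/-! ### Integer translations -/

theorem exists_translate_abs_le (c q : Pos d) :
    ∃ w : Fin d → ℤ, ∀ i, |(q + intVec w - c) i| ≤ 1 / 2 := by
  refine ⟨fun i => -round (q i - c i), fun i => ?_⟩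
  have := abs_sub_round (q i - c i)
  have e : (q + intVec (fun i => -round (q i - c i)) - c) i = q i - c i - round (q i - c i) := by
    simp [intVec]; ring
  rwa [e]

theorem norm_le_sqrt_of_abs_le {v : Pos d} (h : ∀ i, |v i| ≤ 1 / 2) : ‖v‖ ≤ √d := by
  rw [EuclideanSpace.norm_eq]
  refine Real.sqrt_le_sqrt ?_
  calc ∑ i, ‖v i‖ ^ 2 ≤ ∑ _i : Fin d, (1 : ℝ) := Finset.sum_le_sum fun i _ => by
        have := h i
        rw [Real.norm_eq_abs]
        nlinarith [abs_nonneg (v i)]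
    _ = d := by simp

theorem exists_translate_mem_closedBall (q : Pos d) :
    ∃ w : Fin d → ℤ, q + intVec w ∈ closedBall (0 : Pos d) (√d) := by
  obtain ⟨w, hw⟩ := exists_translate_abs_le 0 q
  exact ⟨w, by simpa using norm_le_sqrt_of_abs_le hw⟩

theorem exists_norm_le_of_periodic {F : Type*} [SeminormedAddCommGroup F] {f : Pos d → F}
    (hf : Continuous f) (hp : ∀ (w : Fin d → ℤ) q, f (q + intVec w) = f q) : ∃ C, ∀ q, ‖f q‖ ≤ C := by
  obtain ⟨C, hC⟩ := (isCompact_closedBall (0 : Pos d) (√d)).exists_bound_of_continuousOn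
    hf.continuousOn
  refine ⟨C, fun q => ?_⟩
  obtain ⟨w, hw⟩ := exists_translate_mem_closedBall q
  rw [← hp w q]
  exact hC _ hw

/-- The length of the time interval on which the action has a generating function. -/
def smallTime (m M : ℝ) : ℝ := m / (16 * M ^ 2)

namespace IsTame

variable {H : Phase d → ℝ} {m M : ℝ}

theorem smallTime_pos (hH : IsTame H m M) : 0 < smallTime m M := by
  have := hH.M_pos; have := hH.m_pos
  unfold smallTime; positivity

theorem mul_smallTime (hH : IsTame H m M) : 16 * M * (M * smallTime m M) = m := by
  have := hH.M_pos
  unfold smallTime; field_simp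

/-- In this form, errors of relative size `M * |t|`, even multiplied by `M`, are absorbed by the
convexity constant `m`. -/
theorem mul_le_of_small (hH : IsTame H m M) {t : ℝ} (ht : |t| ≤ smallTime m M) :
    16 * M * (M * |t|) ≤ m := by
  rw [← hH.mul_smallTime]
  have := hH.M_pos
  gcongr

theorem mul_le_of_small' (hH : IsTame H m M) {t : ℝ} (ht : |t| ≤ smallTime m M) :
    16 * (M * |t|) ≤ 1 := by
  have h1 := hH.mul_le_of_small ht
  have h2 : 0 ≤ M * |t| := mul_nonneg hH.M_pos.le (abs_nonneg t)
  nlinarith [hH.one_le, hH.le_one]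

theorem abs_le_of_small (hH : IsTame H m M) {t : ℝ} (ht : |t| ≤ smallTime m M) : 16 * |t| ≤ 1 := by
  have h1 := hH.mul_le_of_small' ht
  nlinarith [hH.one_le, abs_nonneg t]

theorem norm_flow_sub_sub_le_small (hH : IsTame H m M) {t : ℝ} (ht : |t| ≤ smallTime m M)
    (x y : Phase d) : ‖(flow H t x - flow H t y) - (x - y)‖ ≤ 2 * M * ‖x - y‖ * |t| :=
  hH.norm_flow_sub_sub_le (by linarith [hH.mul_le_of_small' ht]) x y

theorem norm_flow_sub_le_two (hH : IsTame H m M) {t : ℝ} (ht : |t| ≤ smallTime m M)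
    (x y : Phase d) : ‖flow H t x - flow H t y‖ ≤ 2 * ‖x - y‖ := by
  have h1 := hH.norm_flow_sub_sub_le_small ht x y
  have h2 := norm_le_norm_add_norm_sub' (flow H t x - flow H t y) (x - y)
  nlinarith [hH.mul_le_of_small' ht, norm_nonneg (x - y)]

/-- The density of the action along an orbit, compared with the one along another curve. -/
theorem density_gap (hH : IsTame H m M) (x x' : Phase d) :
    (hamVF H x).2 (x'.1 - x.1) + x.2 ((hamVF H x').1 - (hamVF H x).1) + m / 2 * ‖x'.2 - x.2‖ ^ 2
      - M / 2 * ‖x'.1 - x.1‖ ^ 2 ≤ density H x' - density H x := by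
  obtain ⟨q, p⟩ := x
  obtain ⟨q', p'⟩ := x'
  have h1 := hH.fenchel q' p' p
  have h2 := hH.taylor_pos q (q' - q) p
  rw [add_sub_cancel] at h2
  simp only [density, map_sub] at *
  linarith

/-- The first variation of the action is the boundary term `p · δq`. Once it is subtracted, the
derivative is exactly the remainder estimated in `density_gap`. -/
theorem hasDerivAt_action_gap (hH : IsTame H m M) (x x' : Phase d) (t : ℝ) :
    HasDerivAt (fun t => orbitAction H t x' - orbitAction H t x -
        (flow H t x).2 ((flow H t x').1 - (flow H t x).1))
      (density H (flow H t x') - density H (flow H t x) -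
        ((hamVF H (flow H t x)).2 ((flow H t x').1 - (flow H t x).1) +
          (flow H t x).2 ((hamVF H (flow H t x')).1 - (hamVF H (flow H t x)).1))) t :=
  ((hH.hasDerivAt_orbitAction x' t).sub (hH.hasDerivAt_orbitAction x t)).sub
    ((hH.hasDerivAt_flow_snd x t).clm_apply
      ((hH.hasDerivAt_flow_fst x' t).sub (hH.hasDerivAt_flow_fst x t)))

theorem norm_sub_of_fst_eq {x x' : Phase d} (h : x.1 = x'.1) : ‖x' - x‖ = ‖x'.2 - x.2‖ := by
  simp [Prod.norm_def, h]

/-- Orbits with a common initial position differ mainly in momentum: the momentum gap stays above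
7/8 of its initial value, the position gap below `m / (8 * M)` times it. Convexity in `p` then beats
the term `-M / 2 * ‖δq‖ ^ 2`. -/
theorem action_gap_deriv (hH : IsTame H m M) {x x' : Phase d} (h : x.1 = x'.1) {t : ℝ}
    (ht : |t| ≤ smallTime m M) :
    m / 4 * ‖x'.2 - x.2‖ ^ 2 ≤ density H (flow H t x') - density H (flow H t x) -
        ((hamVF H (flow H t x)).2 ((flow H t x').1 - (flow H t x).1) +
          (flow H t x).2 ((hamVF H (flow H t x')).1 - (hamVF H (flow H t x)).1)) := by
  have h0 := hH.density_gap (flow H t x) (flow H t x')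
  have h1 := hH.norm_flow_sub_sub_le_small ht x' x
  rw [norm_sub_of_fst_eq h] at h1
  obtain ⟨h2, h3⟩ := norm_prod_le_iff.1 h1
  simp only [Prod.fst_sub, Prod.snd_sub, h, sub_self, sub_zero] at h2 h3
  set e := ‖x'.2 - x.2‖
  set a := ‖(flow H t x').1 - (flow H t x).1‖
  set b := ‖(flow H t x').2 - (flow H t x).2‖
  have h4 : e - b ≤ ‖(flow H t x').2 - (flow H t x).2 - (x'.2 - x.2)‖ := by
    have := norm_le_norm_add_norm_sub ((flow H t x').2 - (flow H t x).2) (x'.2 - x.2)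
    linarith
  have he : 0 ≤ e := norm_nonneg _
  have ha : 0 ≤ a := norm_nonneg _
  have hm := hH.m_pos
  have hM := hH.one_le
  have hs1 := hH.mul_le_of_small ht
  have hs2 := hH.mul_le_of_small' ht
  have h5 : 7 / 8 * e ≤ b := by nlinarith
  have h6 : 8 * M * a ≤ m * e := by
    have : 8 * M * a ≤ 8 * M * (2 * M * e * |t|) := by gcongr
    nlinarith
  have h7 : 49 / 64 * e ^ 2 ≤ b ^ 2 := by nlinarith
  have h8 : 64 * M * a ^ 2 ≤ m * e ^ 2 := by
    have h9 : (8 * M * a) ^ 2 ≤ (m * e) ^ 2 := by gcongr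
    have h10 : m ^ 2 * e ^ 2 ≤ m * e ^ 2 := by
      gcongr; nlinarith [hH.le_one]
    have h11 : 64 * M * a ^ 2 ≤ (8 * M * a) ^ 2 := by nlinarith [mul_nonneg (sub_nonneg.2 hM) (sq_nonneg a), sq_nonneg a]
    nlinarith
  nlinarith [mul_nonneg hm.le (sq_nonneg e)]

theorem action_gap_forward (hH : IsTame H m M) {x x' : Phase d} (h : x.1 = x'.1) {t : ℝ}
    (ht0 : 0 ≤ t) (ht : t ≤ smallTime m M) :
    orbitAction H t x + (flow H t x).2 ((flow H t x').1 - (flow H t x).1) +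
      m / 4 * ‖x'.2 - x.2‖ ^ 2 * t ≤ orbitAction H t x' := by
  have := mul_sub_le_of_le_deriv ht0 (hH.hasDerivAt_action_gap x x')
    (fun s hs => hH.action_gap_deriv h (abs_le.2 ⟨by linarith [hs.1], hs.2.trans ht⟩))
  simp only [orbitAction_zero, hH.flow_zero, h, sub_self, map_zero] at this
  linarith

/-- The same derivative bound, integrated over `[-t, 0]` from the common endpoint; only the boundary
term at the initial time remains, with the opposite sign. -/
theorem action_gap_backward (hH : IsTame H m M) {x x' : Phase d}
    {t : ℝ} (h : (flow H t x).1 = (flow H t x').1) (ht0 : 0 ≤ t) (ht : t ≤ smallTime m M) :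
    orbitAction H t x - x.2 (x'.1 - x.1) +
      m / 4 * ‖(flow H t x').2 - (flow H t x).2‖ ^ 2 * t ≤ orbitAction H t x' := by
  have := mul_sub_le_of_le_deriv (a := -t) (b := 0) (by linarith)
    (hH.hasDerivAt_action_gap (flow H t x) (flow H t x'))
    (fun s hs => hH.action_gap_deriv h (abs_le.2 ⟨by linarith [hs.1], by linarith [hs.2]⟩))
  simp only [orbitAction_zero, hH.flow_zero, h, sub_self, map_zero, hH.flow_neg_flow,
    hH.orbitAction_neg] at this
  linarith

/-! ### Existence and uniqueness of joining orbits -/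

/-- Twist property: the endpoint of the orbit is a strongly monotone function of the momentum. -/
theorem twist (hH : IsTame H m M) {x x' : Phase d} (h : x.1 = x'.1) {t : ℝ}
    (ht0 : 0 ≤ t) (ht : t ≤ smallTime m M) :
    m / 2 * ‖x'.2 - x.2‖ ^ 2 * t ≤ (x'.2 - x.2) ((flow H t x').1 - (flow H t x).1) := by
  set l := x'.2 - x.2 with hl
  have := mul_sub_le_of_le_deriv ht0 (c := m / 2 * ‖l‖ ^ 2)
    (f := fun t => l ((flow H t x').1 - (flow H t x).1))
    (f' := fun t => l ((hamVF H (flow H t x')).1 - (hamVF H (flow H t x)).1))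
    (fun s => l.hasFDerivAt.comp_hasDerivAt s
      ((hH.hasDerivAt_flow_fst x' s).sub (hH.hasDerivAt_flow_fst x s)))
    (fun s hs => by
      have hs' : |s| ≤ smallTime m M := abs_le.2 ⟨by linarith [hs.1], hs.2.trans ht⟩
      have h1 := hH.norm_flow_sub_sub_le_small hs' x' x
      rw [norm_sub_of_fst_eq h, ← hl] at h1
      set X := flow H s x
      set X' := flow H s x'
      have h2 := hH.monotone_fderiv X l zero_le_one
      rw [one_smul, ← apply_hamVF_fst, ← apply_hamVF_fst] at h2
      have h3 : X' - (X + (0, l)) = (X' - X) - (x' - x) := by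
        have : x' - x = (0, l) := by ext1 <;> simp [h, hl]
        rw [this]; abel
      have h4 := hH.norm_hamVF_sub_le X' (X + (0, l))
      rw [h3] at h4
      have h5 := (norm_prod_le_iff.1 h4).1
      have h6 := neg_le_mom (l := l) (v := (hamVF H X' - hamVF H (X + (0, l))).1)
      have h7 : l ((hamVF H X' - hamVF H (X + (0, l))).1) =
        l ((hamVF H X').1) - l ((hamVF H (X + (0, l))).1) := by simp
      rw [map_sub]
      have hs1 := hH.mul_le_of_small hs'
      have hM := hH.M_pos
      have h8 : M * ‖(X' - X) - (x' - x)‖ ≤ m / 8 * ‖l‖ := by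
        calc M * ‖(X' - X) - (x' - x)‖ ≤ M * (2 * M * ‖l‖ * |s|) := by gcongr
          _ ≤ m / 8 * ‖l‖ := by nlinarith [norm_nonneg l]
      have h9 := mul_le_mul_of_nonneg_left (h5.trans h8) (norm_nonneg l)
      nlinarith [mul_nonneg hH.m_pos.le (sq_nonneg ‖l‖)])
  simpa [hH.flow_zero, h] using this

/-- The intermediate point `(x'.1, x.2)` separates the change of momentum, handled by `twist`, from
the change of position, which the flow at most doubles. It makes the joining momentum unique and
Lipschitz in the two endpoints. -/
theorem norm_snd_sub_le (hH : IsTame H m M) {t : ℝ}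
    (ht0 : 0 ≤ t) (ht : t ≤ smallTime m M) (x x' : Phase d) :
    m / 2 * t * ‖x'.2 - x.2‖ ≤ ‖(flow H t x').1 - (flow H t x).1‖ + 2 * ‖x'.1 - x.1‖ := by
  have h1 := hH.twist (x := (x'.1, x.2)) (x' := x') rfl ht0 ht
  have h2 := (norm_prod_le_iff.1 (hH.norm_flow_sub_le_two (abs_le.2 ⟨by linarith, ht⟩)
    x (x'.1, x.2))).1
  have h3 : ‖x - (x'.1, x.2)‖ = ‖x'.1 - x.1‖ := by
    simp [Prod.norm_def, norm_sub_rev]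
  rw [h3] at h2
  have h4 := mom_le (l := x'.2 - x.2) (v := (flow H t x').1 - (flow H t (x'.1, x.2)).1)
  have h5 : ‖(flow H t x').1 - (flow H t (x'.1, x.2)).1‖ ≤
      ‖(flow H t x').1 - (flow H t x).1‖ + 2 * ‖x'.1 - x.1‖ :=
    (norm_sub_le_norm_sub_add_norm_sub _ (flow H t x).1 _).trans (by gcongr; simpa using h2)
  rcases (norm_nonneg (x'.2 - x.2)).eq_or_lt with h0 | h0
  · rw [← h0, mul_zero]; positivity
  · refine le_of_mul_le_mul_left ?_ h0
    calc ‖x'.2 - x.2‖ * (m / 2 * t * ‖x'.2 - x.2‖) = m / 2 * ‖x'.2 - x.2‖ ^ 2 * t := by ring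
      _ ≤ _ := h1
      _ ≤ _ := h4
      _ ≤ _ := by gcongr

end IsTame

/-- A Lipschitz strongly monotone map of a Hilbert space is onto. -/
theorem surjective_of_strongly_monotone {F : Type*} [NormedAddCommGroup F] [InnerProductSpace ℝ F]
    [CompleteSpace F] {G : F → F} {c C : ℝ} (hc : 0 < c) (hmono : ∀ x y,
      c * ‖x - y‖ ^ 2 ≤ inner ℝ (x - y) (G x - G y)) (hlip : ∀ x y, ‖G x - G y‖ ≤ C * ‖x - y‖) :
    Function.Surjective G := by
  intro z
  set C' := max C c with hC'
  have hC'0 : 0 < C' := lt_of_lt_of_le hc (le_max_right _ _)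
  have hlip' : ∀ x y, ‖G x - G y‖ ≤ C' * ‖x - y‖ := fun x y =>
    (hlip x y).trans (by gcongr; exact le_max_left _ _)
  -- This minimizes `1 - 2 * lam * c + lam ^ 2 * C' ^ 2`, the bound for the squared contraction
  -- ratio of `T`, with minimum `ρ`. Enlarging `C` to `C' ≥ c` ensures `0 ≤ ρ`.
  set lam := c / C' ^ 2
  have hlam : 0 < lam := by positivity
  set T : F → F := fun x => x - lam • (G x - z)
  set ρ : ℝ := 1 - c ^ 2 / C' ^ 2
  have hcC : c ^ 2 / C' ^ 2 ≤ 1 := by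
    rw [div_le_one (by positivity)]
    exact pow_le_pow_left₀ hc.le (le_max_right _ _) 2
  have hρ0 : 0 ≤ ρ := by linarith
  have hρ1 : ρ < 1 := by
    have : 0 < c ^ 2 / C' ^ 2 := by positivity
    linarith
  have hsq : ∀ x y, ‖T x - T y‖ ^ 2 ≤ ρ * ‖x - y‖ ^ 2 := by
    intro x y
    have h1 : T x - T y = (x - y) - lam • (G x - G y) := by
      simp only [T]; module
    have h2 : ‖G x - G y‖ ^ 2 ≤ C' ^ 2 * ‖x - y‖ ^ 2 := by
      rw [← mul_pow]; exact pow_le_pow_left₀ (norm_nonneg _) (hlip' x y) 2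
    rw [h1, norm_sub_sq_real, inner_smul_right, norm_smul, mul_pow, Real.norm_of_nonneg hlam.le]
    have h3 : lam * c = c ^ 2 / C' ^ 2 := by simp only [lam]; ring
    have h4 : lam ^ 2 * C' ^ 2 = c ^ 2 / C' ^ 2 := by simp only [lam]; field_simp
    have h5 := mul_le_mul_of_nonneg_left (hmono x y) hlam.le
    have h6 := mul_le_mul_of_nonneg_left h2 (sq_nonneg lam)
    calc ‖x - y‖ ^ 2 - 2 * (lam * inner ℝ (x - y) (G x - G y)) + lam ^ 2 * ‖G x - G y‖ ^ 2
        ≤ ‖x - y‖ ^ 2 - 2 * (lam * (c * ‖x - y‖ ^ 2)) + lam ^ 2 * (C' ^ 2 * ‖x - y‖ ^ 2) := by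
          linarith
      _ = ‖x - y‖ ^ 2 - 2 * ((lam * c) * ‖x - y‖ ^ 2) + (lam ^ 2 * C' ^ 2) * ‖x - y‖ ^ 2 := by ring
      _ = ρ * ‖x - y‖ ^ 2 := by rw [h3, h4]; simp only [ρ]; ring
  have hcontr : ContractingWith (√ρ).toNNReal T := by
    refine ⟨?_, LipschitzWith.of_dist_le_mul fun x y => ?_⟩
    · rw [← NNReal.coe_lt_coe, Real.coe_toNNReal _ (Real.sqrt_nonneg _), NNReal.coe_one]
      exact (Real.sqrt_lt' one_pos).2 (by simpa using hρ1)
    · rw [Real.coe_toNNReal _ (Real.sqrt_nonneg _), dist_eq_norm, dist_eq_norm]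
      have := Real.sqrt_le_sqrt (hsq x y)
      rwa [Real.sqrt_sq (norm_nonneg _), Real.sqrt_mul hρ0, Real.sqrt_sq (norm_nonneg _)] at this
  have hfix := hcontr.fixedPoint_isFixedPt
  refine ⟨ContractingWith.fixedPoint T hcontr, ?_⟩
  have h0 : lam • (G (ContractingWith.fixedPoint T hcontr) - z) = 0 := by
    have : T (ContractingWith.fixedPoint T hcontr) = _ := hfix
    simpa [T] using this
  exact sub_eq_zero.1 ((smul_eq_zero.1 h0).resolve_left hlam.ne')

namespace IsTame

variable {H : Phase d → ℝ} {m M : ℝ}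

theorem exists_join (hH : IsTame H m M) {t : ℝ} (ht0 : 0 < t) (ht : t ≤ smallTime m M)
    (q₀ q₁ : Pos d) : ∃ p : Mom d, (flow H t (q₀, p)).1 = q₁ := by
  have hm := hH.m_pos
  have := surjective_of_strongly_monotone (F := Pos d) (c := m / 2 * t) (C := 2)
    (G := fun v => (flow H t (q₀, InnerProductSpace.toDual ℝ (Pos d) v)).1) (by positivity)
    (fun x y => by
      have := hH.twist (x := (q₀, InnerProductSpace.toDual ℝ (Pos d) y))
        (x' := (q₀, InnerProductSpace.toDual ℝ (Pos d) x)) rfl ht0.le ht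
      simp only [← map_sub, LinearIsometryEquiv.norm_map, InnerProductSpace.toDual_apply_apply] at this
      linarith)
    (fun x y => by
      have := (norm_prod_le_iff.1 (hH.norm_flow_sub_le_two (abs_le.2 ⟨by linarith, ht⟩)
        (q₀, InnerProductSpace.toDual ℝ (Pos d) x) (q₀, InnerProductSpace.toDual ℝ (Pos d) y))).1
      refine this.trans (le_of_eq ?_)
      rw [Prod.mk_sub_mk, sub_self, norm_zero_mom, ← map_sub, LinearIsometryEquiv.norm_map]) q₁
  obtain ⟨v, hv⟩ := this
  exact ⟨_, hv⟩

theorem join_unique (hH : IsTame H m M) {t : ℝ} (ht0 : 0 < t) (ht : t ≤ smallTime m M)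
    {x x' : Phase d} (h : x.1 = x'.1) (h' : (flow H t x).1 = (flow H t x').1) : x = x' := by
  have h1 := hH.norm_snd_sub_le ht0.le ht x x'
  simp only [h, h', sub_self, norm_zero, mul_zero, add_zero] at h1
  have h2 : 0 < m / 2 * t := by have := hH.m_pos; positivity
  have h3 : ‖x'.2 - x.2‖ = 0 := le_antisymm (by nlinarith [norm_nonneg (x'.2 - x.2)]) (norm_nonneg _)
  exact Prod.ext h (sub_eq_zero.1 (norm_eq_zero.1 h3)).symm

open Classical in
/-- The initial point in phase space of the orbit joining `q₀` to `q₁` in time `t`. -/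
def _root_.WeakKAM.joinPt {d : ℕ} (H : Phase d → ℝ) (t : ℝ) (q₀ q₁ : Pos d) : Phase d :=
  (q₀, if h : ∃ p : Mom d, (flow H t (q₀, p)).1 = q₁ then h.choose else 0)

theorem joinPt_fst (t : ℝ) (q₀ q₁ : Pos d) : (joinPt H t q₀ q₁).1 = q₀ := rfl

theorem flow_joinPt_fst (hH : IsTame H m M) {t : ℝ} (ht0 : 0 < t) (ht : t ≤ smallTime m M)
    (q₀ q₁ : Pos d) : (flow H t (joinPt H t q₀ q₁)).1 = q₁ := by
  rw [joinPt, dif_pos (hH.exists_join ht0 ht q₀ q₁)]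
  exact (hH.exists_join ht0 ht q₀ q₁).choose_spec

theorem genFun_eq (hH : IsTame H m M) {t : ℝ} (ht0 : 0 < t) (ht : t ≤ smallTime m M)
    (q₀ q₁ : Pos d) : genFun H t q₀ q₁ = orbitAction H t (joinPt H t q₀ q₁) := by
  rw [genFun, joinPt, dif_pos (hH.exists_join ht0 ht q₀ q₁),
    dif_pos (hH.exists_join ht0 ht q₀ q₁)]

theorem joinPt_flow (hH : IsTame H m M) {t : ℝ} (ht0 : 0 < t) (ht : t ≤ smallTime m M)
    (x : Phase d) : joinPt H t x.1 (flow H t x).1 = x :=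
  hH.join_unique ht0 ht rfl (hH.flow_joinPt_fst ht0 ht _ _)

theorem genFun_flow (hH : IsTame H m M) {t : ℝ} (ht0 : 0 < t) (ht : t ≤ smallTime m M)
    (x : Phase d) : genFun H t x.1 (flow H t x).1 = orbitAction H t x := by
  rw [hH.genFun_eq ht0 ht, hH.joinPt_flow ht0 ht]

end IsTame

end WeakKAM

end

/-! ### Semi-convex functions, action kernels and Lax-Oleinik regularization. -/

noncomputable section

namespace WeakKAM

open Set Filter Topology Metric
open scoped NNReal ContDiff

variable {d : ℕ}

/-! ### Semi-convex functions -/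

/-- `f + a ‖·‖²` is convex. -/
def SemiConv (a : ℝ) (f : Pos d → ℝ) : Prop :=
  ∀ (x y : Pos d) (s : ℝ), s ∈ Icc (0 : ℝ) 1 →
    f (x + s • (y - x)) ≤ (1 - s) * f x + s * f y + a * (s * (1 - s)) * ‖y - x‖ ^ 2

/-- The paraboloid touching `f` from below at the intermediate point is evaluated at both ends; with
weights `1 - s` and `s` the linear terms cancel. -/
theorem semiConv_of_touch {a : ℝ} {f : Pos d → ℝ}
    (h : ∀ z, ∃ p : Mom d, ∀ x, f z + p (x - z) - a * ‖x - z‖ ^ 2 ≤ f x) : SemiConv a f := by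
  intro x y s hs
  obtain ⟨p, hp⟩ := h (x + s • (y - x))
  have h1 := hp x
  have h2 := hp y
  have e1 : x - (x + s • (y - x)) = (-s) • (y - x) := by module
  have e2 : y - (x + s • (y - x)) = (1 - s) • (y - x) := by module
  rw [e1, map_smul, norm_smul, mul_pow, Real.norm_eq_abs, sq_abs, smul_eq_mul] at h1
  rw [e2, map_smul, norm_smul, mul_pow, Real.norm_eq_abs, sq_abs, smul_eq_mul] at h2
  have h3 := mul_le_mul_of_nonneg_left h1 (sub_nonneg.2 hs.2)
  have h4 := mul_le_mul_of_nonneg_left h2 hs.1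
  linarith

theorem SemiConv.add {a b : ℝ} {f g : Pos d → ℝ} (hf : SemiConv a f) (hg : SemiConv b g) :
    SemiConv (a + b) (fun x => f x + g x) := by
  intro x y s hs
  have h1 := hf x y s hs
  have h2 := hg x y s hs
  simp only
  linarith

/-- Minimality at `z` is inserted in the convexity inequality on the segment from `z` to `x`;
dividing by `s` and letting `s → 0` gives quadratic growth. -/
theorem SemiConv.le_of_min {a : ℝ} {f : Pos d → ℝ} (hf : SemiConv (-a) f) {z : Pos d}
    (hz : ∀ x, f z ≤ f x) (x : Pos d) : f z + a * ‖x - z‖ ^ 2 ≤ f x := by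
  have hlim : Tendsto (fun s : ℝ => f z + a * (1 - s) * ‖x - z‖ ^ 2) (𝓝[>] 0)
      (𝓝 (f z + a * (1 - 0) * ‖x - z‖ ^ 2)) := by
    have : Continuous fun s : ℝ => f z + a * (1 - s) * ‖x - z‖ ^ 2 := by fun_prop
    exact (this.tendsto 0).mono_left nhdsWithin_le_nhds
  rw [sub_zero, mul_one] at hlim
  refine le_of_tendsto hlim ?_
  filter_upwards [Ioc_mem_nhdsGT (zero_lt_one' ℝ)] with s hs
  have h1 := (hz _).trans (hf z x s ⟨hs.1.le, hs.2⟩)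
  refine le_of_mul_le_mul_left ?_ hs.1
  linarith

/-! ### Differentiability from two-sided bounds -/

theorem hasFDerivAt_of_abs_sub_le {f : Pos d → ℝ} {x : Pos d} {D : Mom d} {C : ℝ}
    (h : ∀ x', |f x' - f x - D (x' - x)| ≤ C * ‖x' - x‖ ^ 2) : HasFDerivAt f D x := by
  refine HasFDerivAt.of_isLittleO ?_
  have h1 : (fun x' => f x' - f x - D (x' - x)) =O[𝓝 x] fun x' => ‖x' - x‖ ^ 2 :=
    Asymptotics.IsBigO.of_bound C (Eventually.of_forall fun x' => by simpa using h x')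
  exact h1.trans_isLittleO (Asymptotics.isLittleO_norm_pow_id one_lt_two |>.comp_tendsto
    (tendsto_sub_nhds_zero_iff.2 tendsto_id))

/-- A function squeezed between two functions with the same derivative. -/
theorem hasFDerivAt_of_squeeze {f g h : Pos d → ℝ} {x : Pos d} {D : Mom d}
    (hg : HasFDerivAt g D x) (hh : HasFDerivAt h D x) (hgf : ∀ y, g y ≤ f y) (hfh : ∀ y, f y ≤ h y)
    (hgx : g x = f x) (hhx : h x = f x) : HasFDerivAt f D x := by
  refine HasFDerivAt.of_isLittleO (Asymptotics.isLittleO_iff.2 fun c hc => ?_)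
  filter_upwards [Asymptotics.isLittleO_iff.1 hg.isLittleO hc,
    Asymptotics.isLittleO_iff.1 hh.isLittleO hc] with y h1 h2
  rw [Real.norm_eq_abs, abs_le] at *
  have := hgf y
  have := hfh y
  constructor <;> linarith [h1.1, h1.2, h2.1, h2.2]

/-! ### `C^{1,1}` functions -/

/-- `C¹` functions with a Lipschitz differential. -/
def IsC11 (f : Pos d → ℝ) : Prop := ContDiff ℝ 1 f ∧ ∃ K, LipschitzWith K (fderiv ℝ f)

theorem isC11_of_hasFDerivAt {f : Pos d → ℝ} {f' : Pos d → Mom d} (h : ∀ x, HasFDerivAt f (f' x) x)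
    {K : ℝ≥0} (hK : LipschitzWith K f') : IsC11 f := by
  have : fderiv ℝ f = f' := funext fun x => (h x).fderiv
  refine ⟨contDiff_one_iff_fderiv.2 ⟨fun x => (h x).differentiableAt, ?_⟩, K, ?_⟩
  · rw [this]; exact hK.continuous
  · rwa [this]

theorem IsC11.hasFDerivAt {f : Pos d → ℝ} (hf : IsC11 f) (x : Pos d) :
    HasFDerivAt f (fderiv ℝ f x) x :=
  (hf.1.differentiable one_ne_zero x).hasFDerivAt

theorem IsC11.neg {f : Pos d → ℝ} (hf : IsC11 f) : IsC11 (-f) := by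
  obtain ⟨h1, K, hK⟩ := hf
  refine isC11_of_hasFDerivAt (f' := -fderiv ℝ f) (fun x => ?_) hK.neg
  exact (h1.differentiable one_ne_zero x).hasFDerivAt.neg

theorem IsC11.exists_semiConv {f : Pos d → ℝ} (hf : IsC11 f) : ∃ a, SemiConv a f := by
  obtain ⟨h1, K, hK⟩ := hf
  refine ⟨K, semiConv_of_touch fun z => ⟨fderiv ℝ f z, fun x => ?_⟩⟩
  have h2 : ∀ s : ℝ, HasDerivAt (fun s : ℝ => f (z + s • (x - z)))
      (fderiv ℝ f (z + s • (x - z)) (x - z)) s := fun s =>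
    (h1.differentiable one_ne_zero _).hasFDerivAt.comp_hasDerivAt s (hasDerivAt_line z (x - z) s)
  have h3 := taylor_lower h2 (a := fderiv ℝ f z (x - z)) (c := -(K * ‖x - z‖ ^ 2)) (fun s hs => by
    have h4 := hK.norm_sub_le (z + s • (x - z)) z
    rw [add_sub_cancel_left, norm_smul, Real.norm_of_nonneg hs.1] at h4
    have h5 := neg_le_mom (l := fderiv ℝ f (z + s • (x - z)) - fderiv ℝ f z) (v := x - z)
    simp only [sub_apply] at h5
    have h6 := mul_le_mul_of_nonneg_right h4 (norm_nonneg (x - z))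
    linarith)
  simp only [zero_smul, add_zero, one_smul, add_sub_cancel] at h3
  nlinarith [mul_nonneg K.coe_nonneg (sq_nonneg ‖x - z‖)]

/-! ### Lipschitz functions -/

theorem lipschitzWith_of_local {u : Pos d → ℝ} {Λ : ℝ≥0} {δ : ℝ} (hδ : 0 < δ)
    (h : ∀ x y, ‖x - y‖ ≤ δ → u y ≤ u x + Λ * ‖x - y‖) : LipschitzWith Λ u := by
  have key : ∀ x y, u y ≤ u x + Λ * ‖x - y‖ := by
    intro x y
    obtain ⟨n, hn⟩ := exists_nat_gt (‖x - y‖ / δ)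
    have hn0 : (0 : ℝ) < n := lt_of_le_of_lt (by positivity) hn
    have hstep : ∀ i : ℕ, u (x + ((i : ℝ) / n) • (y - x)) ≤ u x + i * (Λ * (‖x - y‖ / n)) := by
      intro i
      induction i with
      | zero => simp
      | succ i ih =>
        have e : (x + ((i : ℝ) / n) • (y - x)) - (x + (((i + 1 : ℕ) : ℝ) / n) • (y - x)) =
            (1 / (n : ℝ)) • (x - y) := by
          push_cast; rw [add_div]; module
        have h1 : ‖(x + ((i : ℝ) / n) • (y - x)) - (x + (((i + 1 : ℕ) : ℝ) / n) • (y - x))‖ =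
            ‖x - y‖ / n := by
          rw [e, norm_smul, Real.norm_of_nonneg (by positivity)]; ring
        have h2 := h (x + ((i : ℝ) / n) • (y - x)) (x + (((i + 1 : ℕ) : ℝ) / n) • (y - x)) (by
          rw [h1, div_le_iff₀ hn0]
          rw [div_lt_iff₀ hδ] at hn
          linarith)
        rw [h1] at h2
        push_cast at *
        linarith
    have := hstep n
    rw [div_self hn0.ne', one_smul, add_sub_cancel] at this
    have e : (n : ℝ) * (Λ * (‖x - y‖ / n)) = Λ * ‖x - y‖ := by field_simp
    linarith
  refine LipschitzWith.of_dist_le_mul fun x y => ?_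
  rw [Real.dist_eq, dist_eq_norm, abs_le]
  have h1 := key x y
  have h2 := key y x
  rw [norm_sub_rev] at h2
  constructor <;> linarith

theorem IsPeriodic.exists_abs_le {u : Pos d → ℝ} (hu : IsPeriodic u) (hc : Continuous u) :
    ∃ B, ∀ x, |u x| ≤ B :=
  exists_norm_le_of_periodic hc hu

theorem IsPeriodic.neg {u : Pos d → ℝ} (hu : IsPeriodic u) : IsPeriodic (-u) := fun w q => by
  simp [hu w q]

theorem IsPeriodic.fderiv {u : Pos d → ℝ} (hu : IsPeriodic u) (w : Fin d → ℤ) (q : Pos d) :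
    fderiv ℝ u (q + intVec w) = fderiv ℝ u q := by
  rw [← fderiv_comp_add_right]
  congr 1
  ext x
  exact hu w x

/-! ### Action kernels -/

/-- The properties of the generating functions `S^t(x, y)`, `0 < t ≤ 2τ`, on which the variational
theory is based. They are symmetric under the exchange of `x` and `y`. -/
structure ActionKernel (d : ℕ) where
  k : ℝ → Pos d → Pos d → ℝ
  D₁ : ℝ → Pos d → Pos d → Mom d
  D₂ : ℝ → Pos d → Pos d → Mom d
  τ : ℝ
  κ : ℝ
  C : ℝ
  L : ℝ
  τ_pos : 0 < τ
  κ_pos : 0 < κ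
  C_nonneg : 0 ≤ C
  L_nonneg : 0 ≤ L
  tri : ∀ {r s : ℝ} (x y z : Pos d), 0 < r → 0 < s → r + s ≤ 2 * τ →
    k (r + s) x z ≤ k r x y + k s y z
  split : ∀ {r s : ℝ} (x z : Pos d), 0 < r → 0 < s → r + s ≤ 2 * τ →
    ∃ y, k (r + s) x z = k r x y + k s y z
  lower : ∀ {r : ℝ} (x y : Pos d), 0 < r → r ≤ 2 * τ → κ / r * ‖x - y‖ ^ 2 - C * r ≤ k r x y
  upper : ∀ {r : ℝ} (x y : Pos d), 0 < r → r ≤ 2 * τ → ‖x - y‖ ≤ r → k r x y ≤ C * r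
  periodic : ∀ {r : ℝ} (w : Fin d → ℤ) (x y : Pos d), 0 < r → r ≤ 2 * τ →
    k r (x + intVec w) (y + intVec w) = k r x y
  convex₁ : ∀ {r : ℝ} (x x' y : Pos d), 0 < r → r ≤ 2 * τ →
    k r x y + D₁ r x y (x' - x) + κ / r * ‖x' - x‖ ^ 2 ≤ k r x' y
  convex₂ : ∀ {r : ℝ} (x y y' : Pos d), 0 < r → r ≤ 2 * τ →
    k r x y + D₂ r x y (y' - y) + κ / r * ‖y' - y‖ ^ 2 ≤ k r x y'
  lip₁ : ∀ {r : ℝ} (x y x' y' : Pos d), 0 < r → r ≤ 2 * τ →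
    ‖D₁ r x y - D₁ r x' y'‖ ≤ L / r * (‖x - x'‖ + ‖y - y'‖)
  lip₂ : ∀ {r : ℝ} (x y x' y' : Pos d), 0 < r → r ≤ 2 * τ →
    ‖D₂ r x y - D₂ r x' y'‖ ≤ L / r * (‖x - x'‖ + ‖y - y'‖)

namespace ActionKernel

/-- The kernel of the reversed time. -/
def swap (K : ActionKernel d) : ActionKernel d where
  k r x y := K.k r y x
  D₁ r x y := K.D₂ r y x
  D₂ r x y := K.D₁ r y x
  τ := K.τ
  κ := K.κ
  C := K.C
  L := K.L
  τ_pos := K.τ_pos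
  κ_pos := K.κ_pos
  C_nonneg := K.C_nonneg
  L_nonneg := K.L_nonneg
  tri {r s} x y z hr hs h := by
    rw [add_comm r s, add_comm (K.k r y x)]
    exact K.tri z y x hs hr (by linarith)
  split {r s} x z hr hs h := by
    obtain ⟨y, hy⟩ := K.split z x hs hr (by linarith)
    exact ⟨y, by rw [add_comm r s, hy, add_comm]⟩
  lower x y hr h := by rw [norm_sub_rev]; exact K.lower y x hr h
  upper x y hr h hxy := K.upper y x hr h (by rwa [norm_sub_rev])
  periodic w x y hr h := K.periodic w y x hr h
  convex₁ x x' y hr h := K.convex₂ y x x' hr h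
  convex₂ x y y' hr h := K.convex₁ y y' x hr h
  lip₁ x y x' y' hr h := by rw [add_comm]; exact K.lip₂ y x y' x' hr h
  lip₂ x y x' y' hr h := by rw [add_comm]; exact K.lip₁ y x y' x' hr h

variable (K : ActionKernel d) {r s a : ℝ} {u : Pos d → ℝ}

/-- Convexity based at `x'` bounds the increment by `D₁` at `x'`; passing to `D₁` at `x` costs the
Lipschitz constant `L / r`. -/
theorem convex₁_upper (x x' y : Pos d) (hr : 0 < r) (h : r ≤ 2 * K.τ) :
    K.k r x' y ≤ K.k r x y + K.D₁ r x y (x' - x) + K.L / r * ‖x' - x‖ ^ 2 := by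
  have h1 := K.convex₁ x' x y hr h
  have h2 := K.lip₁ x' y x y hr h
  rw [sub_self, norm_zero, add_zero] at h2
  have h3 := mom_le (l := K.D₁ r x' y - K.D₁ r x y) (v := x' - x)
  have h4 := mul_le_mul_of_nonneg_right h2 (norm_nonneg (x' - x))
  have h5 : K.D₁ r x' y (x - x') = -K.D₁ r x' y (x' - x) := by rw [← map_neg, neg_sub]
  rw [h5] at h1
  simp only [sub_apply] at h3
  have h6 : 0 ≤ K.κ / r * ‖x - x'‖ ^ 2 := by have := K.κ_pos; positivity
  linarith

theorem hasFDerivAt₁ (x y : Pos d) (hr : 0 < r) (h : r ≤ 2 * K.τ) :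
    HasFDerivAt (fun x => K.k r x y) (K.D₁ r x y) x := by
  refine hasFDerivAt_of_abs_sub_le (C := K.L / r) fun x' => abs_le.2 ⟨?_, ?_⟩
  · have h1 := K.convex₁ x x' y hr h
    have h6 : 0 ≤ K.κ / r * ‖x' - x‖ ^ 2 := by have := K.κ_pos; positivity
    have h7 : 0 ≤ K.L / r * ‖x' - x‖ ^ 2 := by have := K.L_nonneg; positivity
    linarith
  · linarith [K.convex₁_upper x x' y hr h]

theorem hasFDerivAt₂ (x y : Pos d) (hr : 0 < r) (h : r ≤ 2 * K.τ) :
    HasFDerivAt (fun y => K.k r x y) (K.D₂ r x y) y :=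
  K.swap.hasFDerivAt₁ y x hr h

theorem continuous₁ (y : Pos d) (hr : 0 < r) (h : r ≤ 2 * K.τ) : Continuous fun x => K.k r x y :=
  continuous_iff_continuousAt.2 fun x => (K.hasFDerivAt₁ x y hr h).continuousAt

theorem semiConv₁ (y : Pos d) (hr : 0 < r) (h : r ≤ 2 * K.τ) :
    SemiConv (-(K.κ / r)) fun x => K.k r x y :=
  semiConv_of_touch fun z => ⟨K.D₁ r z y, fun x => by linarith [K.convex₁ z x y hr h]⟩

theorem semiConv₂_neg (x : Pos d) (hr : 0 < r) (h : r ≤ 2 * K.τ) :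
    SemiConv (K.L / r) fun y => -K.k r x y :=
  semiConv_of_touch fun z => ⟨-K.D₂ r x z, fun y => by
    have := K.swap.convex₁_upper z y x hr h
    simp only [swap, neg_apply] at *
    linarith⟩

theorem neg_le_k (x y : Pos d) (hr : 0 < r) (h : r ≤ 2 * K.τ) : -(K.C * r) ≤ K.k r x y := by
  have h6 : 0 ≤ K.κ / r * ‖x - y‖ ^ 2 := by have := K.κ_pos; positivity
  linarith [K.lower x y hr h]

/-- The Lax-Oleinik operator of the kernel. -/
def T (r : ℝ) (u : Pos d → ℝ) (y : Pos d) : ℝ := ⨅ x, (u x + K.k r x y)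

variable {K}

theorem T_le {B : ℝ} (hB : ∀ x, B ≤ u x) (hr : 0 < r) (h : r ≤ 2 * K.τ) (x y : Pos d) :
    K.T r u y ≤ u x + K.k r x y :=
  ciInf_le ⟨B - K.C * r, by
    rintro _ ⟨x, rfl⟩
    have := hB x
    have := K.neg_le_k x y hr h
    simp only
    linarith⟩ x

theorem le_T {b : ℝ} {y : Pos d} (h : ∀ x, b ≤ u x + K.k r x y) : b ≤ K.T r u y := le_ciInf h

theorem exists_T_eq (hu : Continuous u) {B : ℝ} (hB : ∀ x, B ≤ u x) (hr : 0 < r) (h : r ≤ 2 * K.τ)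
    (y : Pos d) : ∃ x, K.T r u y = u x + K.k r x y := by
  have hc : Continuous fun x => u x + K.k r x y := hu.add (K.continuous₁ y hr h)
  have hlim : Tendsto (fun x => u x + K.k r x y) (cocompact (Pos d)) atTop := by
    have h1 : Tendsto (fun x : Pos d => ‖x - y‖) (cocompact (Pos d)) atTop := by
      have := (tendsto_norm_cocompact_atTop (E := Pos d)).comp
        (Homeomorph.subRight y).isClosedEmbedding.tendsto_cocompact
      exact this
    have h2 : Tendsto (fun x : Pos d => (B - K.C * r) + K.κ / r * ‖x - y‖ ^ 2)
        (cocompact (Pos d)) atTop :=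
      tendsto_atTop_add_const_left _ _ (((tendsto_pow_atTop two_ne_zero).comp h1).const_mul_atTop
        (div_pos K.κ_pos hr))
    refine tendsto_atTop_mono (fun x => ?_) h2
    linarith [hB x, K.lower x y hr h]
  obtain ⟨x, hx⟩ := hc.exists_forall_le hlim
  exact ⟨x, le_antisymm (T_le hB hr h x y) (le_T hx)⟩

variable (K) in
/-- `u` is dominated by the kernel at level `a`. -/
def Dom (a : ℝ) (u : Pos d → ℝ) : Prop :=
  ∀ r, 0 < r → r ≤ K.τ → ∀ x y, u y ≤ u x + K.k r x y + a * r

theorem Dom.le_T (hu : K.Dom a u) (hr : 0 < r) (h : r ≤ K.τ) (y : Pos d) :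
    u y ≤ K.T r u y + a * r := by
  have : u y - a * r ≤ K.T r u y := ActionKernel.le_T fun x => by linarith [hu r hr h x y]
  linarith

/-- Time reversal turns `u` into `-u`, so `-K.swap.T r (-u)` is the backward operator and inherits
the properties of `T`. -/
theorem Dom.swap_neg (hu : K.Dom a u) : K.swap.Dom a (-u) := fun r hr h x y => by
  have := hu r hr h y x
  simp only [Pi.neg_apply, ActionKernel.swap]
  linarith

theorem Dom.of_swap_neg (hu : K.swap.Dom a (-u)) : K.Dom a u := by
  have h := hu.swap_neg
  rw [neg_neg] at h
  exact h

/-- Domination is used with time `‖x - y‖`, that is at unit mean speed. The constant depends only on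
the kernel and the level; this equi-Lipschitz property is what passes to limits and to infinite
combinations. -/
theorem Dom.lipschitzWith (hu : K.Dom a u) : LipschitzWith (K.C + |a|).toNNReal u := by
  refine lipschitzWith_of_local K.τ_pos fun x y hxy => ?_
  rw [Real.coe_toNNReal _ (add_nonneg K.C_nonneg (abs_nonneg a))]
  rcases eq_or_ne x y with rfl | hne
  · simp
  have hr : 0 < ‖x - y‖ := norm_pos_iff.2 (sub_ne_zero.2 hne)
  have h1 := hu _ hr hxy x y
  have h2 := K.upper x y hr (by linarith [K.τ_pos]) le_rfl
  nlinarith [le_abs_self a]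

/-- Kernels of different times commute: a path of time `s` then `r` is merged by `tri` and cut again
by `split` into time `r` then `s`. Domination of `u` applies to the first leg. -/
theorem Dom.T (hu : K.Dom a u) {B : ℝ} (hB : ∀ x, B ≤ u x) (hs : 0 < s) (hsτ : s ≤ K.τ) :
    K.Dom a (K.T s u) := by
  intro r hr h x y
  have : K.T s u y - K.k r x y - a * r ≤ K.T s u x := ActionKernel.le_T fun z => by
    have h1 := K.tri z x y hs hr (by linarith)
    obtain ⟨z', hz'⟩ := K.split z y hr hs (by linarith)
    rw [add_comm] at hz'
    have h2 := T_le hB hs (by linarith) z' y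
    have h3 := hu r hr h z z'
    linarith
  linarith

theorem T_periodic (hu : IsPeriodic u) (hr : 0 < r) (h : r ≤ 2 * K.τ) : IsPeriodic (K.T r u) := by
  intro w y
  refine ((Equiv.addRight (intVec w)).iInf_congr fun x => ?_).symm
  simp only [Equiv.coe_addRight]
  rw [hu w x, K.periodic w x y hr h]

/-- An infimum of functions that are semi-concave with a common constant is semi-concave with it,
whatever the regularity of `u`. -/
theorem semiConv_neg_T {B : ℝ} (hB : ∀ x, B ≤ u x) (hr : 0 < r) (h : r ≤ 2 * K.τ) :
    SemiConv (K.L / r) (-K.T r u) := by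
  intro x y t ht
  have : (1 - t) * K.T r u x + t * K.T r u y - K.L / r * (t * (1 - t)) * ‖y - x‖ ^ 2 ≤
      K.T r u (x + t • (y - x)) := ActionKernel.le_T fun z => by
    have h1 := K.semiConv₂_neg z hr h x y t ht
    have h2 := mul_le_mul_of_nonneg_left (T_le hB hr h z x) (sub_nonneg.2 ht.2)
    have h3 := mul_le_mul_of_nonneg_left (T_le hB hr h z y) ht.1
    linarith
  simp only [Pi.neg_apply]
  linarith

/-- The Lax-Oleinik operator maps a semi-convex function to a `C^{1,1}` function in short time. -/
theorem exists_hasFDerivAt_T (hu : Continuous u) {B : ℝ} (hB : ∀ x, B ≤ u x) {b : ℝ}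
    (hb : SemiConv b u) (hr : 0 < r) (h : r ≤ 2 * K.τ) (hbr : b < K.κ / r) :
    ∃ X : Pos d → Pos d, (∀ y, K.T r u y = u (X y) + K.k r (X y) y) ∧
      (∀ y, HasFDerivAt (K.T r u) (K.D₂ r (X y) y) y) ∧
      ∃ Λ, LipschitzWith Λ fun y => K.D₂ r (X y) y := by
  choose X hX using fun y => exists_T_eq hu hB hr h y
  -- The convexity of the kernel exceeds the possible concavity of `u` by `ε`, so minimizers have
  -- quadratic growth. Adding the growth inequalities at `y` and `y'` eliminates `u` and gives a
  -- Lipschitz bound for `X`.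
  set ε := K.κ / r - b with hε
  have hεpos : 0 < ε := by linarith
  have hL : 0 ≤ K.L / r := div_nonneg K.L_nonneg hr.le
  have hmin : ∀ y x, K.T r u y + ε * ‖x - X y‖ ^ 2 ≤ u x + K.k r x y := by
    intro y x
    have hsc := hb.add (K.semiConv₁ y hr h)
    have : b + -(K.κ / r) = -ε := by rw [hε]; ring
    rw [this] at hsc
    rw [hX]
    exact hsc.le_of_min (fun x' => by rw [← hX]; exact T_le hB hr h x' y) x
  have hXlip : ∀ y y', 2 * ε * ‖X y - X y'‖ ≤ K.L / r * ‖y - y'‖ := by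
    intro y y'
    have h1 := hmin y (X y')
    have h2 := hmin y' (X y)
    rw [hX] at h1 h2
    -- the cross difference of the kernel is controlled by the Lipschitz constant of `D₂`
    have h3 : ∀ v : ℝ, HasDerivAt (fun v : ℝ => K.k r (X y') (y + v • (y' - y)) -
        K.k r (X y) (y + v • (y' - y))) ((K.D₂ r (X y') (y + v • (y' - y)) -
          K.D₂ r (X y) (y + v • (y' - y))) (y' - y)) v := fun v =>
      ((K.hasFDerivAt₂ (X y') _ hr h).comp_hasDerivAt v (hasDerivAt_line y (y' - y) v)).sub
        ((K.hasFDerivAt₂ (X y) _ hr h).comp_hasDerivAt v (hasDerivAt_line y (y' - y) v))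
    have h4 := mul_sub_le_of_le_deriv zero_le_one
      (c := -(K.L / r * ‖X y - X y'‖ * ‖y - y'‖)) h3 (fun v _ => by
        have h5 := K.lip₂ (X y') (y + v • (y' - y)) (X y) (y + v • (y' - y)) hr h
        rw [sub_self, norm_zero, add_zero, norm_sub_rev] at h5
        rw [norm_sub_rev (X y') (X y)] at h5
        have h6 := neg_le_mom (l := K.D₂ r (X y') (y + v • (y' - y)) -
          K.D₂ r (X y) (y + v • (y' - y))) (v := y' - y)
        rw [norm_sub_rev] at h5
        rw [norm_sub_rev y' y] at h6
        have h7 := mul_le_mul_of_nonneg_right h5 (norm_nonneg (y - y'))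
        linarith)
    simp only [one_smul, zero_smul, add_zero, add_sub_cancel] at h4
    rw [norm_sub_rev (X y') (X y)] at h1
    rcases (norm_nonneg (X y - X y')).eq_or_lt with h0 | h0
    · rw [← h0, mul_zero]; positivity
    · refine le_of_mul_le_mul_left ?_ h0
      linarith
  refine ⟨X, hX, fun y => ?_, ?_⟩
  · refine hasFDerivAt_of_abs_sub_le (C := K.L / r * (K.L / r / (2 * ε)) + K.L / r + K.L / r)
      fun y' => abs_le.2 ⟨?_, ?_⟩
    · -- lower bound: use the minimizer at `y'`
      have h1 := T_le hB hr h (X y') y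
      have h2 := K.convex₂ (X y') y y' hr h
      have h3 := K.lip₂ (X y') y (X y) y hr h
      rw [sub_self, norm_zero, add_zero] at h3
      have h4 := neg_le_mom (l := K.D₂ r (X y') y - K.D₂ r (X y) y) (v := y' - y)
      simp only [sub_apply] at h4
      have h5 : ‖X y' - X y‖ ≤ K.L / r / (2 * ε) * ‖y' - y‖ := by
        rw [div_mul_eq_mul_div, le_div_iff₀ (by positivity)]
        linarith [hXlip y' y]
      have h6 : 0 ≤ K.κ / r * ‖y' - y‖ ^ 2 := by have := K.κ_pos; positivity
      have h7 : ‖K.D₂ r (X y') y - K.D₂ r (X y) y‖ * ‖y' - y‖ ≤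
          K.L / r * (K.L / r / (2 * ε)) * ‖y' - y‖ ^ 2 := by
        calc _ ≤ (K.L / r * (K.L / r / (2 * ε) * ‖y' - y‖)) * ‖y' - y‖ := by
              gcongr; exact h3.trans (by gcongr)
          _ = _ := by ring
      have h8 : 0 ≤ K.L / r * ‖y' - y‖ ^ 2 := by positivity
      rw [hX y']
      linarith
    · have h1 := T_le hB hr h (X y) y'
      have h2 := K.swap.convex₁_upper y y' (X y) hr h
      have h3 : 0 ≤ K.L / r * (K.L / r / (2 * ε)) * ‖y' - y‖ ^ 2 := by positivity
      have h4 : 0 ≤ K.L / r * ‖y' - y‖ ^ 2 := by positivity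
      simp only [swap] at h2
      rw [hX y]
      linarith
  · refine ⟨(K.L / r * (K.L / r / (2 * ε) + 1)).toNNReal, LipschitzWith.of_dist_le_mul fun y y' => ?_⟩
    rw [Real.coe_toNNReal _ (by positivity), dist_eq_norm, dist_eq_norm, mul_assoc]
    refine (K.lip₂ _ _ _ _ hr h).trans ?_
    gcongr
    have h5 : ‖X y - X y'‖ ≤ K.L / r / (2 * ε) * ‖y - y'‖ := by
      rw [div_mul_eq_mul_div, le_div_iff₀ (by positivity)]
      linarith [hXlip y y']
    linarith

theorem fderiv_of_T_eq {B : ℝ} (hB : ∀ x, B ≤ u x) (hr : 0 < r) (h : r ≤ 2 * K.τ) {x y : Pos d}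
    (hxy : K.T r u y = u x + K.k r x y) (hu : DifferentiableAt ℝ u x) :
    fderiv ℝ u x = -K.D₁ r x y := by
  have h1 : IsLocalMin (fun x => u x + K.k r x y) x :=
    Eventually.of_forall fun x' => by
      simp only [← hxy]; exact T_le hB hr h x' y
  exact eq_neg_of_add_eq_zero_left
    (h1.hasFDerivAt_eq_zero (hu.hasFDerivAt.add (K.hasFDerivAt₁ x y hr h)))

/-- Regularization of dominated functions. -/
theorem Dom.exists_isC11 (hu : K.Dom a u) (hp : IsPeriodic u) :
    ∃ w, IsC11 w ∧ IsPeriodic w ∧ K.Dom a w := by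
  have hτ := K.τ_pos
  obtain ⟨B, hB⟩ := hp.exists_abs_le hu.lipschitzWith.continuous
  have hB' : ∀ x, -B ≤ u x := fun x => neg_le_of_abs_le (hB x)
  -- Forward evolution makes `v` semi-concave. The backward step below is short enough, `L / τ < κ /
  -- e`, for the kernel of time `e` to dominate the semi-convexity constant of `-v`.
  set v := K.T K.τ u
  have hv : K.Dom a v := hu.T hB' hτ le_rfl
  have hvp : IsPeriodic v := T_periodic hp hτ (by linarith)
  have hvs : SemiConv (K.L / K.τ) (-v) := semiConv_neg_T hB' hτ (by linarith)
  obtain ⟨B₁, hB₁⟩ := hvp.exists_abs_le hv.lipschitzWith.continuous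
  have hB₁' : ∀ x, -B₁ ≤ (-v) x := fun x => neg_le_neg (le_of_abs_le (hB₁ x))
  set e := min K.τ (K.κ / (K.L / K.τ + 1))
  have hL : 0 < K.L / K.τ + 1 := by have := K.L_nonneg; positivity
  have he : 0 < e := lt_min hτ (div_pos K.κ_pos hL)
  have heτ : e ≤ K.τ := min_le_left _ _
  have hlt : K.L / K.τ < K.κ / e := by
    rw [lt_div_iff₀ he]
    have : e ≤ K.κ / (K.L / K.τ + 1) := min_le_right _ _
    rw [le_div_iff₀ hL] at this
    linarith
  obtain ⟨X, -, hX, Λ, hΛ⟩ := exists_hasFDerivAt_T (K := K.swap) (r := e)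
    hv.lipschitzWith.continuous.neg hB₁' hvs he (by change e ≤ 2 * K.τ; linarith) hlt
  refine ⟨-(K.swap.T e (-v)), (isC11_of_hasFDerivAt hX hΛ).neg,
    (T_periodic hvp.neg he (by change e ≤ 2 * K.τ; linarith)).neg, Dom.of_swap_neg ?_⟩
  rw [neg_neg]
  exact hv.swap_neg.T hB₁' he heτ

end ActionKernel

end WeakKAM

end

/-! ### The generating functions form an action kernel. -/

noncomputable section

namespace WeakKAM

open Set Filter Topology Metric
open scoped NNReal ContDiff

variable {d : ℕ}

namespace IsTame

variable {H : Phase d → ℝ} {m M : ℝ} {t r s : ℝ}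

theorem abs_le_of_mem {t : ℝ} (h0 : 0 ≤ t) (ht : t ≤ smallTime m M) : |t| ≤ smallTime m M := by
  rwa [abs_of_nonneg h0]

theorem exists_norm_hamVF_zero_le (hH : IsTame H m M) :
    ∃ C, 0 ≤ C ∧ ∀ q, ‖hamVF H (q, 0)‖ ≤ C := by
  obtain ⟨C, hC⟩ := exists_norm_le_of_periodic (f := fun q : Pos d => hamVF H (q, 0))
    (hH.contDiff_hamVF.continuous.comp (by fun_prop)) (fun w q => by
      simpa using hH.hamVF_translate w (q, 0))
  exact ⟨C, (norm_nonneg _).trans (hC 0), hC⟩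

/-- The action of a short orbit whose projection has speed at most one is bounded linearly. -/
theorem exists_action_le (hH : IsTame H m M) : ∃ C, M ≤ C ∧ ∀ (r : ℝ) (x : Phase d), 0 < r →
    r ≤ smallTime m M → ‖x.1 - (flow H r x).1‖ ≤ r → orbitAction H r x ≤ C * r := by
  obtain ⟨C, hC0, hC⟩ := hH.exists_norm_hamVF_zero_le
  have hm := hH.m_pos
  have hM := hH.M_pos
  -- `P` bounds the initial momentum, by comparison with the orbit of zero momentum from the same
  -- position, whose displacement is at most `2 * C * r`. Then `V` bounds the initial Hamiltonian
  -- speed.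
  set P := 2 / m * (1 + 2 * C) with hP
  set V := C + M * P with hV
  have hP0 : 0 ≤ P := by positivity
  have hV0 : 0 ≤ V := by positivity
  refine ⟨(P + V) * (2 * V) + M, by nlinarith [mul_nonneg (add_nonneg hP0 hV0) hV0], ?_⟩
  intro r x hr hrs hx
  have hsm : ∀ s ∈ Icc 0 r, |s| ≤ smallTime m M := fun s hs => abs_le_of_mem hs.1 (hs.2.trans hrs)
  have hp : ‖x.2‖ ≤ P := by
    have h1 := hH.norm_snd_sub_le hr.le hrs (x.1, 0) x
    have h2 := (norm_prod_le_iff.1 (hH.norm_flow_sub_self_le (t := r)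
      (by linarith [hH.mul_le_of_small' (hsm r ⟨hr.le, le_rfl⟩)]) (x.1, 0))).1
    have h3 := hC x.1
    rw [abs_of_pos hr] at h2
    simp only [sub_zero, sub_self, norm_zero, mul_zero, add_zero, Prod.fst_sub] at h1 h2
    have h4 : ‖(flow H r x).1 - (flow H r (x.1, 0)).1‖ ≤ r + 2 * C * r := by
      have h5 := norm_sub_le_norm_sub_add_norm_sub (flow H r x).1 x.1 (flow H r (x.1, 0)).1
      rw [norm_sub_rev] at hx h2
      have : 2 * ‖hamVF H (x.1, 0)‖ * r ≤ 2 * C * r := by gcongr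
      linarith
    have h6 := h1.trans h4
    have h7 : m / 2 * ‖x.2‖ ≤ 1 + 2 * C := le_of_mul_le_mul_right (by linarith) hr
    rw [hP, div_mul_eq_mul_div, le_div_iff₀ hm]
    linarith
  have hv : ‖hamVF H x‖ ≤ V := by
    have h1 := hH.norm_hamVF_sub_le x (x.1, 0)
    have h2 : ‖x - (x.1, 0)‖ = ‖x.2‖ := by simp [Prod.norm_def]
    rw [h2] at h1
    have h3 := norm_le_norm_add_norm_sub' (hamVF H x) (hamVF H (x.1, 0))
    have h4 := hC x.1
    have : M * ‖x.2‖ ≤ M * P := by gcongr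
    linarith
  have hd : ∀ s ∈ Icc 0 r, density H (flow H s x) ≤ (P + V) * (2 * V) + M := by
    intro s hs
    have hs1 := hH.mul_le_of_small' (hsm s hs)
    have hs2 := hH.abs_le_of_small (hsm s hs)
    have h1 := hH.norm_flow_sub_self_le (t := s) (by linarith) x
    have h2 : ‖flow H s x - x‖ ≤ 2 * V * |s| := h1.trans (by gcongr)
    have h3 : ‖(flow H s x).2‖ ≤ P + V := by
      have h4 := (norm_prod_le_iff.1 h2).2
      have h5 := norm_le_norm_add_norm_sub' (flow H s x).2 x.2
      simp only [Prod.snd_sub] at h4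
      nlinarith
    have h6 : ‖(hamVF H (flow H s x)).1‖ ≤ 2 * V := by
      have h7 := (norm_prod_le_iff.1 (hH.norm_hamVF_sub_le (flow H s x) x)).1
      have h8 := norm_le_norm_add_norm_sub' (hamVF H (flow H s x)).1 (hamVF H x).1
      have h9 := (norm_prod_le_iff.1 hv).1
      simp only [Prod.fst_sub] at h7
      have : M * ‖flow H s x - x‖ ≤ M * (2 * V * |s|) := by gcongr
      nlinarith
    have h7 := hH.lower (flow H s x).1 (flow H s x).2
    have h8 : 0 ≤ m / 2 * ‖(flow H s x).2‖ ^ 2 := by positivity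
    have h9 := mom_le (l := (flow H s x).2) (v := (hamVF H (flow H s x)).1)
    have h10 : ‖(flow H s x).2‖ * ‖(hamVF H (flow H s x)).1‖ ≤ (P + V) * (2 * V) := by gcongr
    simp only [density, Prod.mk.eta] at *
    linarith
  have := sub_le_mul_of_deriv_le hr.le (hH.hasDerivAt_orbitAction x) hd
  simpa [orbitAction_zero] using this

/-- Superlinear lower bound on the action. -/
theorem action_ge (hH : IsTame H m M) (hr : 0 < r) (x : Phase d) :
    1 / (2 * M * r) * ‖x.1 - (flow H r x).1‖ ^ 2 - M * r ≤ orbitAction H r x := by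
  have hM := hH.M_pos
  set v := (flow H r x).1 - x.1 with hv
  -- A constant test momentum for the Fenchel inequality: with `H ≤ M / 2 * ‖l‖ ^ 2 + M`, this
  -- choice optimizes the resulting lower bound on the action.
  set l : Mom d := InnerProductSpace.toDual ℝ (Pos d) ((1 / (M * r)) • v)
  have hl : ‖l‖ = 1 / (M * r) * ‖v‖ := by
    rw [LinearIsometryEquiv.norm_map, norm_smul, Real.norm_of_nonneg (by positivity)]
  have hlv : l v = 1 / (M * r) * ‖v‖ ^ 2 := by
    simp only [l, InnerProductSpace.toDual_apply_apply, real_inner_smul_left,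
      real_inner_self_eq_norm_sq]
  have := mul_sub_le_of_le_deriv hr.le (c := -(M / 2 * ‖l‖ ^ 2 + M))
    (f := fun t => orbitAction H t x - l (flow H t x).1)
    (f' := fun t => density H (flow H t x) - l (hamVF H (flow H t x)).1)
    (fun s => (hH.hasDerivAt_orbitAction x s).sub
      (l.hasFDerivAt.comp_hasDerivAt s (hH.hasDerivAt_flow_fst x s)))
    (fun s _ => by
      have h1 := hH.fenchel (flow H s x).1 (flow H s x).2 l
      have h2 := hH.upper (flow H s x).1 l
      have h3 : 0 ≤ m / 2 * ‖(flow H s x).2 - l‖ ^ 2 := by have := hH.m_pos; positivity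
      simp only [density, Prod.mk.eta] at *
      linarith)
  simp only [orbitAction_zero, hH.flow_zero, sub_zero, zero_sub, sub_neg_eq_add] at this
  have e : l (flow H r x).1 = l x.1 + l v := by rw [hv, map_sub]; ring
  rw [e, hlv, hl] at this
  rw [norm_sub_rev, ← hv]
  have e2 : M / 2 * (1 / (M * r) * ‖v‖) ^ 2 * r = 1 / (2 * M * r) * ‖v‖ ^ 2 := by
    field_simp
  have e3 : 1 / (M * r) * ‖v‖ ^ 2 = 2 * (1 / (2 * M * r) * ‖v‖ ^ 2) := by field_simp
  linarith

/-- The generating functions of a Hamiltonian, as an action kernel. -/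
def kernel (hH : IsTame H m M) : ActionKernel d where
  k := genFun H
  D₁ r x y := -(joinPt H r x y).2
  D₂ r x y := (flow H r (joinPt H r x y)).2
  -- The kernel is used up to time `2 * τ`. The value `κ = m / (16 * M ^ 2)` comes from inserting
  -- `‖δq‖ ≤ 2 * M * r * ‖δp‖` in the gap `m / 4 * ‖δp‖ ^ 2 * r`, and `L` from `norm_snd_sub_le`
  -- followed by the doubling of distances under the flow.
  τ := smallTime m M / 2
  κ := smallTime m M
  C := hH.exists_action_le.choose
  L := 8 / m
  τ_pos := half_pos hH.smallTime_pos
  κ_pos := hH.smallTime_pos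
  C_nonneg := hH.M_pos.le.trans hH.exists_action_le.choose_spec.1
  L_nonneg := by have := hH.m_pos; positivity
  tri {r s} x y z hr hs h := by
    have h : r + s ≤ smallTime m M := by linarith
    have hr' : r ≤ smallTime m M := by linarith
    have hs' : s ≤ smallTime m M := by linarith
    set X := joinPt H (r + s) x z
    have hX : (flow H (r + s) X).1 = z := hH.flow_joinPt_fst (add_pos hr hs) h x z
    have hX' : flow H (r + s) X = flow H s (flow H r X) := by rw [add_comm, hH.flow_add]
    rw [hH.genFun_eq (add_pos hr hs) h, hH.genFun_eq hr hr', hH.genFun_eq hs hs',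
      show orbitAction H (r + s) (joinPt H (r + s) x z) = orbitAction H (s + r) X by
        rw [add_comm s r], hH.orbitAction_add s r X]
    -- The true orbit `X` is compared with the broken one, forward from `x` and backward from `z`;
    -- the boundary terms at the junction are opposite and cancel.
    have h1 := hH.action_gap_forward (x := X) (x' := joinPt H r x y) rfl hr.le hr'
    rw [hH.flow_joinPt_fst hr hr'] at h1
    have h2 := hH.action_gap_backward (x := flow H r X) (x' := joinPt H s y z) (by
      rw [hH.flow_joinPt_fst hs hs', ← hX', hX]) hs.le hs'
    rw [joinPt_fst] at h2
    have h3 : 0 ≤ m / 4 * ‖(joinPt H r x y).2 - X.2‖ ^ 2 * r := by have := hH.m_pos; positivity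
    have h4 : 0 ≤ m / 4 * ‖(flow H s (joinPt H s y z)).2 - (flow H s (flow H r X)).2‖ ^ 2 * s := by
      have := hH.m_pos; positivity
    linarith
  split {r s} x z hr hs h := by
    have h : r + s ≤ smallTime m M := by linarith
    set X := joinPt H (r + s) x z
    have hX : (flow H s (flow H r X)).1 = z := by
      rw [← hH.flow_add, add_comm, hH.flow_joinPt_fst (add_pos hr hs) h]
    refine ⟨(flow H r X).1, ?_⟩
    rw [hH.genFun_eq (add_pos hr hs) h,
      show orbitAction H (r + s) (joinPt H (r + s) x z) = orbitAction H (s + r) X by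
        rw [add_comm s r], hH.orbitAction_add s r X]
    have h1 := hH.genFun_flow hr (by linarith) X
    have h2 := hH.genFun_flow hs (by linarith) (flow H r X)
    rw [hX] at h2
    rw [h2, ← h1]
    rfl
  lower {r} x y hr h := by
    have h : r ≤ smallTime m M := by linarith
    have hM := hH.M_pos
    rw [hH.genFun_eq hr h]
    have h1 := hH.action_ge hr (joinPt H r x y)
    rw [hH.flow_joinPt_fst hr h, joinPt_fst] at h1
    have h2 : smallTime m M / r ≤ 1 / (2 * M * r) := by
      rw [div_le_div_iff₀ hr (by positivity)]
      have := hH.mul_smallTime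
      have h5 := hH.smallTime_pos
      nlinarith [hH.le_one, hH.one_le, mul_pos hM h5]
    have h3 := mul_le_mul_of_nonneg_right h2 (sq_nonneg ‖x - y‖)
    have h4 := mul_le_mul_of_nonneg_right hH.exists_action_le.choose_spec.1 hr.le
    linarith
  upper {r} x y hr h hxy := by
    have h : r ≤ smallTime m M := by linarith
    rw [hH.genFun_eq hr h]
    exact hH.exists_action_le.choose_spec.2 r _ hr h (by rwa [hH.flow_joinPt_fst hr h, joinPt_fst])
  periodic {r} w x y hr h := by
    have h : r ≤ smallTime m M := by linarith
    have h1 := hH.genFun_flow hr h (joinPt H r x y + (intVec w, 0))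
    rw [hH.flow_translate, hH.orbitAction_translate, ← hH.genFun_eq hr h] at h1
    simpa [hH.flow_joinPt_fst hr h, joinPt_fst] using h1
  convex₁ {r} x x' y hr h := by
    have h : r ≤ smallTime m M := by linarith
    have hM := hH.M_pos
    have hm := hH.m_pos
    rw [hH.genFun_eq hr h, hH.genFun_eq hr h]
    have hy := hH.flow_joinPt_fst hr h x y
    have hy' := hH.flow_joinPt_fst hr h x' y
    set X := joinPt H r x y
    set X' := joinPt H r x' y
    have h1 := hH.action_gap_backward (x := X) (x' := X') (by rw [hy, hy']) hr.le h
    have h2 := (norm_prod_le_iff.1 (hH.norm_flow_sub_sub_le_small (t := -r)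
      (by rw [abs_neg]; exact abs_le_of_mem hr.le h) (flow H r X') (flow H r X))).1
    rw [hH.flow_neg_flow, hH.flow_neg_flow, norm_sub_of_fst_eq (by rw [hy, hy']), abs_neg,
      abs_of_pos hr] at h2
    simp only [Prod.fst_sub, hy, hy', sub_self, sub_zero] at h2
    change ‖x' - x‖ ≤ _ at h2
    have h3 : ‖x' - x‖ ^ 2 ≤ (2 * M * ‖(flow H r X').2 - (flow H r X).2‖ * r) ^ 2 := by gcongr
    have h4 : smallTime m M / r * ‖x' - x‖ ^ 2 ≤
        m / 4 * ‖(flow H r X').2 - (flow H r X).2‖ ^ 2 * r := by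
      have : smallTime m M = m / (16 * M ^ 2) := rfl
      calc _ ≤ smallTime m M / r * (2 * M * ‖(flow H r X').2 - (flow H r X).2‖ * r) ^ 2 := by
            have := hH.smallTime_pos; gcongr
        _ = _ := by rw [this]; field_simp; ring
    have h5 : (X'.1 - X.1) = x' - x := rfl
    rw [h5] at h1
    simp only [neg_apply]
    linarith
  convex₂ {r} x y y' hr h := by
    have h : r ≤ smallTime m M := by linarith
    have hM := hH.M_pos
    have hm := hH.m_pos
    rw [hH.genFun_eq hr h, hH.genFun_eq hr h]
    have hy := hH.flow_joinPt_fst hr h x y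
    have hy' := hH.flow_joinPt_fst hr h x y'
    set X := joinPt H r x y
    set X' := joinPt H r x y'
    have h1 := hH.action_gap_forward (x := X) (x' := X') rfl hr.le h
    have h2 := (norm_prod_le_iff.1 (hH.norm_flow_sub_sub_le_small
      (abs_le_of_mem hr.le h) X' X)).1
    have h5 : X'.1 - X.1 = 0 := sub_self x
    rw [norm_sub_of_fst_eq (show X.1 = X'.1 from rfl), abs_of_pos hr] at h2
    simp only [Prod.fst_sub, hy, hy', h5, sub_zero] at h2
    rw [hy, hy'] at h1
    have h3 : ‖y' - y‖ ^ 2 ≤ (2 * M * ‖X'.2 - X.2‖ * r) ^ 2 := by gcongr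
    have h4 : smallTime m M / r * ‖y' - y‖ ^ 2 ≤ m / 4 * ‖X'.2 - X.2‖ ^ 2 * r := by
      have : smallTime m M = m / (16 * M ^ 2) := rfl
      calc _ ≤ smallTime m M / r * (2 * M * ‖X'.2 - X.2‖ * r) ^ 2 := by
            have := hH.smallTime_pos; gcongr
        _ = _ := by rw [this]; field_simp; ring
    linarith
  lip₁ {r} x y x' y' hr h := by
    have h : r ≤ smallTime m M := by linarith
    have hm := hH.m_pos
    have h1 := hH.norm_snd_sub_le hr.le h (joinPt H r x y) (joinPt H r x' y')
    rw [hH.flow_joinPt_fst hr h, hH.flow_joinPt_fst hr h, joinPt_fst, joinPt_fst] at h1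
    rw [neg_sub_neg, div_mul_eq_mul_div, le_div_iff₀ hr, div_mul_eq_mul_div, le_div_iff₀ hm]
    rw [norm_sub_rev x x', norm_sub_rev y y']
    nlinarith [norm_nonneg (x' - x), norm_nonneg (y' - y)]
  lip₂ {r} x y x' y' hr h := by
    have h : r ≤ smallTime m M := by linarith
    have hm := hH.m_pos
    have h1 := hH.norm_snd_sub_le hr.le h (joinPt H r x' y') (joinPt H r x y)
    rw [hH.flow_joinPt_fst hr h, hH.flow_joinPt_fst hr h, joinPt_fst, joinPt_fst] at h1
    have h2 := (norm_prod_le_iff.1 (hH.norm_flow_sub_le_two (abs_le_of_mem hr.le h)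
      (joinPt H r x y) (joinPt H r x' y'))).2
    have h3 : ‖joinPt H r x y - joinPt H r x' y'‖ ≤ 4 / m / r * (‖x - x'‖ + ‖y - y'‖) := by
      have hmr : 1 ≤ 4 / m / r := by
        rw [div_div, one_le_div (by positivity)]
        have := hH.abs_le_of_small (abs_le_of_mem hr.le h)
        rw [abs_of_pos hr] at this
        nlinarith [hH.le_one]
      refine norm_prod_le_iff.2 ⟨?_, ?_⟩
      · have h4 : 0 ≤ ‖x - x'‖ + ‖y - y'‖ := by positivity
        have : ‖x - x'‖ ≤ ‖x - x'‖ + ‖y - y'‖ := le_add_of_nonneg_right (norm_nonneg _)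
        exact this.trans (le_mul_of_one_le_left h4 hmr)
      · rw [div_div, div_mul_eq_mul_div, le_div_iff₀ (by positivity), Prod.snd_sub]
        nlinarith [norm_nonneg (x - x'), norm_nonneg (y - y')]
    have e : 8 / m / r * (‖x - x'‖ + ‖y - y'‖) = 2 * (4 / m / r * (‖x - x'‖ + ‖y - y'‖)) := by ring
    rw [e]
    exact h2.trans (by gcongr)

end IsTame

end WeakKAM

end

/-! ### Sub-solutions are the functions dominated by the kernel. -/

noncomputable section

namespace WeakKAM

open Set Filter Topology Metric MeasureTheory
open scoped NNReal ContDiff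

variable {d : ℕ}

namespace IsTame

variable {H : Phase d → ℝ} {m M a r : ℝ} {u : Pos d → ℝ}

theorem kernel_k (hH : IsTame H m M) : hH.kernel.k = genFun H := rfl

theorem le_smallTime (hH : IsTame H m M) {r : ℝ} (h : r ≤ hH.kernel.τ) : r ≤ smallTime m M := by
  have := hH.smallTime_pos
  have h2 : r ≤ smallTime m M / 2 := h
  linarith

theorem le_two_tau (hH : IsTame H m M) {r : ℝ} (h : r ≤ hH.kernel.τ) : r ≤ 2 * hH.kernel.τ := by
  linarith [hH.kernel.τ_pos]

theorem kernel_flow (hH : IsTame H m M) (hr : 0 < r) (h : r ≤ hH.kernel.τ) (x : Phase d) :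
    hH.kernel.k r x.1 (flow H r x).1 = orbitAction H r x :=
  hH.genFun_flow hr (hH.le_smallTime h) x

theorem kernel_D₁_flow (hH : IsTame H m M) (hr : 0 < r) (h : r ≤ hH.kernel.τ) (x : Phase d) :
    hH.kernel.D₁ r x.1 (flow H r x).1 = -x.2 := by
  change -(joinPt H r x.1 (flow H r x).1).2 = -x.2
  rw [hH.joinPt_flow hr (hH.le_smallTime h)]

theorem kernel_D₂_flow (hH : IsTame H m M) (hr : 0 < r) (h : r ≤ hH.kernel.τ) (x : Phase d) :
    hH.kernel.D₂ r x.1 (flow H r x).1 = (flow H r x).2 := by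
  change (flow H r (joinPt H r x.1 (flow H r x).1)).2 = _
  rw [hH.joinPt_flow hr (hH.le_smallTime h)]

theorem exists_flow_eq (hH : IsTame H m M) (hr : 0 < r) (h : r ≤ hH.kernel.τ) (q₀ q₁ : Pos d) :
    ∃ x : Phase d, x.1 = q₀ ∧ (flow H r x).1 = q₁ :=
  ⟨joinPt H r q₀ q₁, rfl, hH.flow_joinPt_fst hr (hH.le_smallTime h) q₀ q₁⟩

/-- Domination is tested along the orbits. -/
theorem dom_iff (hH : IsTame H m M) : hH.kernel.Dom a u ↔ ∀ r, 0 < r → r ≤ hH.kernel.τ →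
    ∀ x : Phase d, u (flow H r x).1 ≤ u x.1 + orbitAction H r x + a * r := by
  refine ⟨fun h r hr hrτ x => ?_, fun h r hr hrτ q₀ q₁ => ?_⟩
  · rw [← hH.kernel_flow hr hrτ]
    exact h r hr hrτ _ _
  · obtain ⟨x, rfl, rfl⟩ := hH.exists_flow_eq hr hrτ q₀ q₁
    rw [hH.kernel_flow hr hrτ]
    exact h r hr hrτ x

/-- Dominated functions are sub-solutions. -/
theorem isSubsolution_of_dom (hH : IsTame H m M) (hu : hH.kernel.Dom a u) :
    IsSubsolution H a u := by
  refine ⟨⟨_, hu.lipschitzWith⟩, fun q hq => ?_⟩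
  -- Along the orbit with initial momentum `fderiv ℝ u q`, the derivative at time 0 of the
  -- domination inequality is exactly `H x - a ≤ 0`.
  set x : Phase d := (q, fderiv ℝ u q) with hx
  have h0 : flow H 0 x = x := hH.flow_zero x
  have h1 : HasDerivAt (fun r => u (flow H r x).1 - orbitAction H r x - a * r)
      (fderiv ℝ u q (hamVF H x).1 - density H x - a) 0 := by
    have h2 := hH.hasDerivAt_flow_fst x 0
    have h3 := hH.hasDerivAt_orbitAction x 0
    rw [h0] at h2 h3
    have h4 : HasFDerivAt u (fderiv ℝ u q) (flow H 0 x).1 := by rw [h0]; exact hq.hasFDerivAt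
    have h5 := ((h4.comp_hasDerivAt (0 : ℝ) h2).sub h3).sub ((hasDerivAt_id (0 : ℝ)).const_mul a)
    exact h5.congr_deriv (by simp)
  have h2 : fderiv ℝ u q (hamVF H x).1 - density H x - a ≤ 0 := by
    refine le_of_tendsto h1.tendsto_slope_zero_right ?_
    filter_upwards [Ioc_mem_nhdsGT hH.kernel.τ_pos] with r hr
    have h3 := hH.dom_iff.1 hu r hr.1 hr.2 x
    simp only [zero_add, h0, orbitAction_zero, mul_zero, sub_zero, smul_eq_mul]
    refine mul_nonpos_of_nonneg_of_nonpos (inv_nonneg.2 hr.1.le) ?_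
    linarith
  simp only [density, hx] at h2
  linarith

/-- The derivative of a Lipschitz function along almost every translate of an orbit. -/
theorem ae_differentiableAt_translate {Λ : ℝ≥0} (hu : LipschitzWith Λ u) {γ : ℝ → Pos d}
    (hγ : Continuous γ) : ∀ᵐ y : Pos d, ∀ᵐ s : ℝ, DifferentiableAt ℝ u (γ s + y) := by
  have hmeas : MeasurableSet {z : Pos d × ℝ | DifferentiableAt ℝ u (γ z.2 + z.1)} :=
    ((by fun_prop : Continuous fun z : Pos d × ℝ => γ z.2 + z.1).measurable)
      (measurableSet_of_differentiableAt ℝ u)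
  -- By Fubini the quantifiers can be exchanged: for fixed `s`, Rademacher's theorem applies to the
  -- translated variable `y`.
  rw [Measure.ae_ae_comm hmeas]
  refine Eventually.of_forall fun s => ?_
  exact (quasiMeasurePreserving_add_left volume (γ s)).ae hu.ae_differentiableAt

/-- Sub-solutions are dominated. -/
theorem dom_of_isSubsolution (hH : IsTame H m M) (hu : IsSubsolution H a u) :
    hH.kernel.Dom a u := by
  obtain ⟨⟨Λ, hΛ⟩, hsub⟩ := hu
  obtain ⟨C, hC0, hC⟩ := hH.exists_norm_hamVF_zero_le
  have hM := hH.M_pos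
  rw [hH.dom_iff]
  intro r hr _ x
  set γ : ℝ → Pos d := fun s => (flow H s x).1
  have hγ : Continuous γ := (hH.continuous_flow_time x).fst
  have hdens : Continuous fun s => density H (flow H s x) :=
    hH.continuous_density.comp (hH.continuous_flow_time x)
  -- The orbit itself may run through points where `u` is not differentiable, so it is translated by
  -- a generic `y`. `E y` bounds the change of `H` at momenta of norm at most `Λ`, and vanishes at
  -- `y = 0`.
  set E : Pos d → ℝ := fun y => (C + M * Λ) * ‖y‖ + M / 2 * ‖y‖ ^ 2
  have hshift : ∀ (q y : Pos d) (l : Mom d), ‖l‖ ≤ Λ → H (q, l) ≤ H (q + y, l) + E y := by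
    intro q y l hl
    have h1 := hH.taylor_pos (q + y) (-y) l
    rw [add_neg_cancel_right, norm_neg, map_neg] at h1
    have h2 := mom_le (l := (hamVF H (q + y, l)).2) (v := y)
    have h3 := (norm_prod_le_iff.1 (hH.norm_hamVF_sub_le (q + y, l) (q + y, 0))).2
    have h4 : ‖((q + y, l) : Phase d) - (q + y, 0)‖ = ‖l‖ := by simp [Prod.norm_def]
    rw [h4, Prod.snd_sub] at h3
    have h5 := norm_le_norm_add_norm_sub' (hamVF H (q + y, l)).2 (hamVF H (q + y, 0)).2
    have h6 := (norm_prod_le_iff.1 (hC (q + y))).2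
    have h7 : ‖(hamVF H (q + y, l)).2‖ ≤ C + M * Λ := by
      have : M * ‖l‖ ≤ M * Λ := by gcongr
      linarith
    have h8 := mul_le_mul_of_nonneg_right h7 (norm_nonneg y)
    simp only [E]
    linarith
  have hgood : ∀ᵐ y : Pos d, u (γ r + y) - u (γ 0 + y) ≤ orbitAction H r x + (a + E y) * r := by
    filter_upwards [ae_differentiableAt_translate hΛ hγ] with y hy
    obtain ⟨V, hV⟩ := (isCompact_Icc (a := (0 : ℝ)) (b := r)).exists_bound_of_continuousOn
      (f := fun s => (hamVF H (flow H s x)).1)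
      (hH.contDiff_hamVF.continuous.comp (hH.continuous_flow_time x)).fst.continuousOn
    have hγL : LipschitzOnWith V.toNNReal (fun s => γ s + y) (uIcc 0 r) := by
      rw [uIcc_of_le hr.le]
      refine (convex_Icc 0 r).lipschitzOnWith_of_nnnorm_hasDerivWithin_le
        (f' := fun s => (hamVF H (flow H s x)).1)
        (fun s _ => ((hH.hasDerivAt_flow_fst x s).add_const y).hasDerivWithinAt) (fun s hs => ?_)
      rw [← NNReal.coe_le_coe, coe_nnnorm]
      exact (hV s hs).trans (Real.le_coe_toNNReal V)
    have hac := (hΛ.comp_lipschitzOnWith hγL).absolutelyContinuousOnInterval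
    have hint := hac.integral_deriv_eq_sub
    have hmono := intervalIntegral.integral_mono_ae hr.le hac.intervalIntegrable_deriv
      ((hdens.add (continuous_const (y := a + E y))).intervalIntegrable 0 r) (μ := volume) (by
        filter_upwards [hy] with s hs
        have h1 := hs.hasFDerivAt.comp_hasDerivAt s ((hH.hasDerivAt_flow_fst x s).add_const y)
        change deriv (u ∘ fun s => γ s + y) s ≤ density H (flow H s x) + (a + E y)
        rw [h1.deriv]
        have h2 := hH.fenchel (flow H s x).1 (flow H s x).2 (fderiv ℝ u (γ s + y))
        have h3 := hshift (γ s) y (fderiv ℝ u (γ s + y)) (norm_fderiv_le_of_lipschitz ℝ hΛ)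
        have h4 := hsub _ hs
        have h5 : 0 ≤ m / 2 * ‖(flow H s x).2 - fderiv ℝ u (γ s + y)‖ ^ 2 := by
          have := hH.m_pos; positivity
        simp only [density, Prod.mk.eta, γ] at *
        linarith)
    rw [hint] at hmono
    simp only [Pi.add_apply] at hmono
    rw [intervalIntegral.integral_add (hdens.intervalIntegrable 0 r)
      intervalIntegrable_const, intervalIntegral.integral_const] at hmono
    simp only [Function.comp_apply, sub_zero, smul_eq_mul] at hmono
    change _ ≤ orbitAction H r x + _ at hmono
    linarith
  have hclosed : IsClosed {y : Pos d | u (γ r + y) - u (γ 0 + y) ≤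
      orbitAction H r x + (a + E y) * r} := by
    have hc := hΛ.continuous
    exact isClosed_le (by fun_prop) (by simp only [E]; fun_prop)
  -- The inequality holds for almost every `y`, hence on a dense set, and it is closed in `y`: it
  -- holds at `y = 0`.
  have h0 := hclosed.closure_subset ((Measure.dense_of_ae hgood) 0)
  simp only [mem_ofPred_eq, add_zero, E, norm_zero, mul_zero, γ, hH.flow_zero] at h0
  norm_num at h0
  linarith

/-- A dominated function is differentiable in the interior of its calibrated orbits. -/
theorem hasFDerivAt_of_calibrated (hH : IsTame H m M) (hu : hH.kernel.Dom a u) (hr : 0 < r)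
    (h : r ≤ hH.kernel.τ) {x : Phase d}
    (h1 : u (flow H r x).1 = u x.1 + orbitAction H r x + a * r)
    (h2 : u (flow H r (flow H r x)).1 = u (flow H r x).1 + orbitAction H r (flow H r x) + a * r) :
    HasFDerivAt u (flow H r x).2 (flow H r x).1 := by
  set y := flow H r x with hy
  have e1 := hH.kernel_flow hr h x
  have e2 := hH.kernel_flow hr h y
  have hD₂ := hH.kernel.hasFDerivAt₂ x.1 y.1 hr (hH.le_two_tau h)
  rw [hy, hH.kernel_D₂_flow hr h, ← hy] at hD₂
  have hD₁ := hH.kernel.hasFDerivAt₁ y.1 (flow H r y).1 hr (hH.le_two_tau h)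
  rw [hH.kernel_D₁_flow hr h] at hD₁
  -- Domination from the past endpoint gives a function above `u`, domination towards the future
  -- endpoint one below. Calibration makes both touch `u` at the middle point, with the same
  -- differential, the momentum.
  refine hasFDerivAt_of_squeeze
    (g := fun z => u (flow H r y).1 - a * r - hH.kernel.k r z (flow H r y).1)
    (h := fun z => u x.1 + a * r + hH.kernel.k r x.1 z)
    (by simpa using hD₁.const_sub (u (flow H r y).1 - a * r)) (hD₂.const_add _)
    (fun z => by linarith [hu r hr h z (flow H r y).1]) (fun z => by linarith [hu r hr h x.1 z])
    ?_ ?_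
  · simp only [e2]; linarith
  · simp only [hy, e1] at *; linarith

end IsTame

end WeakKAM

end

/-! ### Broken orbits, the minimal action, and weak KAM solutions as calibrated functions. -/

noncomputable section

namespace WeakKAM

open Set Filter Topology Metric MeasureTheory
open scoped NNReal ContDiff

variable {d : ℕ}

/-! ### Broken orbits -/

/-- `Chain G n x y s`: some chain of `n` steps from `x` to `y` has total cost `s`. -/
inductive Chain (G : Pos d → Pos d → ℝ) : ℕ → Pos d → Pos d → ℝ → Prop
  | nil (x : Pos d) : Chain G 0 x x 0
  | snoc {n : ℕ} {x y : Pos d} {s : ℝ} (z : Pos d) (h : Chain G n x y s) :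
      Chain G (n + 1) x z (s + G y z)

namespace Chain

variable {G : Pos d → Pos d → ℝ} {n k : ℕ} {x y z : Pos d} {s s' : ℝ}

theorem single (G : Pos d → Pos d → ℝ) (x y : Pos d) : Chain G 1 x y (G x y) := by
  simpa using (Chain.nil x).snoc y

theorem append (h : Chain G n x y s) (h' : Chain G k y z s') : Chain G (n + k) x z (s + s') := by
  induction h' with
  | nil => simpa using h
  | snoc w _ ih => rw [← add_assoc, ← add_assoc]; exact (ih h).snoc w

theorem split (h : Chain G (n + k) x z s) :
    ∃ y s₁ s₂, Chain G n x y s₁ ∧ Chain G k y z s₂ ∧ s = s₁ + s₂ := by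
  induction k generalizing z s with
  | zero => exact ⟨z, s, 0, h, .nil z, by simp⟩
  | succ k ih =>
    obtain _ | ⟨z, h⟩ := h
    obtain ⟨y, s₁, s₂, h₁, h₂, rfl⟩ := ih h
    exact ⟨y, s₁, _, h₁, h₂.snoc z, by ring⟩

theorem eq_of_one (h : Chain G 1 x z s) : s = G x z := by
  obtain _ | ⟨z, h⟩ := h
  obtain _ | _ := h
  simp

theorem of_fun (G : Pos d → Pos d → ℝ) (θ : ℕ → Pos d) (n : ℕ) :
    Chain G n (θ 0) (θ n) (∑ i ∈ Finset.range n, G (θ i) (θ (i + 1))) := by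
  induction n with
  | zero => simpa using Chain.nil (θ 0)
  | succ n ih => rw [Finset.sum_range_succ]; exact ih.snoc _

theorem exists_fun (h : Chain G n x y s) : ∃ θ : ℕ → Pos d, θ 0 = x ∧ θ n = y ∧
    ∑ i ∈ Finset.range n, G (θ i) (θ (i + 1)) = s := by
  induction h with
  | nil x => exact ⟨fun _ => x, rfl, rfl, by simp⟩
  | @snoc n x y s z _ ih =>
    obtain ⟨θ, h0, hn, hs⟩ := ih
    refine ⟨fun i => if i ≤ n then θ i else z, by simpa using h0, by simp, ?_⟩
    rw [Finset.sum_range_succ, ← hs]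
    congr 1
    · refine Finset.sum_congr rfl fun i hi => ?_
      have := Finset.mem_range.1 hi
      simp only [if_pos this.le, if_pos (Nat.succ_le_of_lt this)]
    · simp [hn]

theorem lower {b : ℝ} (hb : ∀ x y, b ≤ G x y) (h : Chain G n x y s) : n * b ≤ s := by
  induction h with
  | nil => simp
  | @snoc n x y s z _ ih => push_cast; linarith [hb y z]

theorem exists_of_pos (G : Pos d → Pos d → ℝ) (hn : n ≠ 0) (x y : Pos d) : ∃ s, Chain G n x y s := by
  obtain ⟨k, rfl⟩ := Nat.exists_eq_succ_of_ne_zero hn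
  have h := of_fun G (fun _ => x) k
  exact ⟨_, h.snoc y⟩

end Chain

theorem brokenAction_eq (H : Phase d → ℝ) (n : ℕ) (t : ℝ) (x y : Pos d) :
    brokenAction H n t x y = sInf {s | Chain (genFun H (t / n)) n x y s} := by
  rw [brokenAction, iInf]
  congr 1
  ext s
  constructor
  · rintro ⟨⟨θ, h0, hn⟩, rfl⟩
    have h := Chain.of_fun (genFun H (t / n)) (fun i => θ (Fin.ofNat (n + 1) i)) n
    rw [Finset.sum_range] at h
    have e1 : Fin.ofNat (n + 1) n = Fin.last n := by ext; simp [Fin.ofNat]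
    have e2 : ∀ i : Fin n, Fin.ofNat (n + 1) i = i.castSucc := fun i => by
      ext; simp [Fin.ofNat, Nat.mod_eq_of_lt (Nat.lt_succ_of_lt i.2)]
    have e3 : ∀ i : Fin n, Fin.ofNat (n + 1) (i + 1) = i.succ := fun i => by
      ext; simp [Fin.ofNat]
    have e4 : Fin.ofNat (n + 1) 0 = 0 := rfl
    simp only [e1, e2, e3, e4, h0, hn] at h
    exact h
  · intro h
    obtain ⟨θ, h0, hn, hs⟩ := Chain.exists_fun h
    refine ⟨⟨fun i => θ i, by simpa using h0, by simpa using hn⟩, ?_⟩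
    rw [← hs, Finset.sum_range]
    simp

namespace ActionKernel

variable {K : ActionKernel d} {r a : ℝ} {n k : ℕ} {x y z : Pos d} {s : ℝ} {u : Pos d → ℝ}

theorem k_le_of_chain (hr : 0 < r) (h : (k + 1 : ℕ) * r ≤ 2 * K.τ) (hs : Chain (K.k r) (k + 1) x y s) :
    K.k ((k + 1 : ℕ) * r) x y ≤ s := by
  induction k generalizing y s with
  | zero => simpa using hs.eq_of_one.ge
  | succ k ih =>
    obtain _ | ⟨y, hs⟩ := hs
    rename_i z s
    have e : ((k + 1 + 1 : ℕ) : ℝ) * r = (k + 1 : ℕ) * r + r := by push_cast; ring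
    have h1 := ih (by rw [e] at h; linarith) hs
    rw [e] at h ⊢
    linarith [K.tri x z y (by positivity : 0 < ((k + 1 : ℕ) : ℝ) * r) hr h]

theorem exists_chain (hr : 0 < r) (h : (k + 1 : ℕ) * r ≤ 2 * K.τ) (x y : Pos d) :
    Chain (K.k r) (k + 1) x y (K.k ((k + 1 : ℕ) * r) x y) := by
  induction k generalizing y with
  | zero => simpa using Chain.single (K.k r) x y
  | succ k ih =>
    have e : ((k + 1 + 1 : ℕ) : ℝ) * r = (k + 1 : ℕ) * r + r := by push_cast; ring
    rw [e] at h ⊢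
    obtain ⟨z, hz⟩ := K.split x y (by positivity : 0 < ((k + 1 : ℕ) : ℝ) * r) hr h
    rw [hz]
    exact (ih (by linarith) z).snoc y

theorem chain_coarsen (hr : 0 < r) (h : (k + 1 : ℕ) * r ≤ 2 * K.τ)
    (hs : Chain (K.k r) (n * (k + 1)) x y s) :
    ∃ s' ≤ s, Chain (K.k ((k + 1 : ℕ) * r)) n x y s' := by
  induction n generalizing y s with
  | zero =>
    rw [zero_mul] at hs
    obtain _ | _ := hs
    exact ⟨0, le_rfl, .nil x⟩
  | succ n ih =>
    rw [Nat.succ_mul] at hs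
    obtain ⟨z, s₁, s₂, h₁, h₂, rfl⟩ := hs.split
    obtain ⟨s', hs', hc⟩ := ih h₁
    exact ⟨_, add_le_add hs' (k_le_of_chain hr h h₂), hc.snoc y⟩

theorem chain_refine (hr : 0 < r) (h : (k + 1 : ℕ) * r ≤ 2 * K.τ)
    (hs : Chain (K.k ((k + 1 : ℕ) * r)) n x y s) : Chain (K.k r) (n * (k + 1)) x y s := by
  induction n generalizing y s with
  | zero =>
    obtain _ | _ := hs
    simpa using Chain.nil x
  | succ n ih =>
    obtain _ | ⟨y, hs⟩ := hs
    rw [Nat.succ_mul]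
    exact (ih hs).append (exists_chain hr h _ y)

theorem bddBelow_chain (hr : 0 < r) (h : r ≤ 2 * K.τ) :
    BddBelow {s | Chain (K.k r) n x y s} :=
  ⟨n * -(K.C * r), fun _ hs => Chain.lower (fun x y => K.neg_le_k x y hr h) hs⟩

/-- Merging steps by `tri` does not increase the cost, and each long step is cut by `split` at equal
cost. -/
theorem sInf_chain_refine (hr : 0 < r) (hn : n ≠ 0) (h : (k + 1 : ℕ) * r ≤ 2 * K.τ) :
    sInf {s | Chain (K.k ((k + 1 : ℕ) * r)) n x y s} =
      sInf {s | Chain (K.k r) (n * (k + 1)) x y s} := by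
  have hr' : r ≤ 2 * K.τ := by
    have : 0 ≤ k * r := by positivity
    push_cast at h; linarith
  refine le_antisymm (le_csInf (Chain.exists_of_pos _ (by positivity) x y) fun s hs => ?_)
    (csInf_le_csInf (bddBelow_chain hr hr') (Chain.exists_of_pos _ hn x y)
      fun s hs => chain_refine hr h hs)
  obtain ⟨s', hs', hc⟩ := chain_coarsen hr h hs
  exact (csInf_le (bddBelow_chain (by positivity) h) hc).trans hs'

theorem Dom.le_add_chain (hu : K.Dom a u) (hr : 0 < r) (h : r ≤ K.τ) (hs : Chain (K.k r) n x y s) :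
    u y ≤ u x + s + a * (n * r) := by
  induction hs with
  | nil => simp
  | @snoc n x y s z _ ih => push_cast; linarith [hu r hr h y z]

theorem exists_calibrated_chain (hmin : ∀ y, ∃ x, u y = u x + K.k r x y + a * r) (n : ℕ) (y : Pos d) :
    ∃ x s, Chain (K.k r) n x y s ∧ u y = u x + s + a * (n * r) := by
  induction n generalizing y with
  | zero => exact ⟨y, 0, .nil y, by simp⟩
  | succ n ih =>
    obtain ⟨x, hx⟩ := hmin y
    obtain ⟨z, s, hs, hz⟩ := ih x
    exact ⟨z, _, hs.snoc y, by push_cast; linarith⟩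

end ActionKernel

namespace IsTame

variable {H : Phase d → ℝ} {m M : ℝ}

theorem brokenAction_refine (hH : IsTame H m M) {t : ℝ} (ht : 0 < t) {n k : ℕ} (hn : n ≠ 0)
    (hk : k ≠ 0) (h : t / n ≤ 2 * hH.kernel.τ) (x y : Pos d) :
    brokenAction H n t x y = brokenAction H (n * k) t x y := by
  obtain ⟨k, rfl⟩ := Nat.exists_eq_succ_of_ne_zero hk
  have hn' : (0 : ℝ) < n := by positivity
  rw [brokenAction_eq, brokenAction_eq]
  have e : t / n = (k + 1 : ℕ) * (t / ((n * (k + 1) : ℕ) : ℝ)) := by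
    push_cast; field_simp
  rw [e] at h ⊢
  exact ActionKernel.sInf_chain_refine (K := hH.kernel) (by positivity) hn h

theorem minAction_eq (hH : IsTame H m M) {t : ℝ} (ht : 0 < t) {n : ℕ} (hn : n ≠ 0)
    (h : t / n ≤ 2 * hH.kernel.τ) (x y : Pos d) :
    minAction H t x y = sInf {s | Chain (genFun H (t / n)) n x y s} := by
  rw [← brokenAction_eq]
  refine Tendsto.limUnder_eq (tendsto_const_nhds.congr' ?_)
  filter_upwards [eventually_ge_atTop n] with k hk
  have hk0 : k ≠ 0 := by omega
  have hn' : (0 : ℝ) < n := by positivity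
  have h' : t / k ≤ 2 * hH.kernel.τ := le_trans (by gcongr) h
  -- Partitions into `n` and `k` steps are compared through their common refinement.
  rw [hH.brokenAction_refine ht hn hk0 h, hH.brokenAction_refine ht hk0 hn h', mul_comm]

theorem minAction_eq_kernel (hH : IsTame H m M) {r : ℝ} (hr : 0 < r) (h : r ≤ hH.kernel.τ)
    (x y : Pos d) : minAction H r x y = hH.kernel.k r x y := by
  rw [hH.minAction_eq hr one_ne_zero (by simpa using hH.le_two_tau h), Nat.cast_one, div_one]
  have : {s | Chain (genFun H r) 1 x y s} = {genFun H r x y} := by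
    ext s
    exact ⟨fun h => h.eq_of_one, fun h => by rw [mem_singleton_iff.1 h]; exact Chain.single _ x y⟩
  rw [this, csInf_singleton]
  rfl

variable {u : Pos d → ℝ} {a : ℝ}

/-- The weak KAM solutions are the calibrated dominated functions. -/
theorem exists_of_isWeakKAM (hH : IsTame H m M) (hp : IsPeriodic u) (hu : IsWeakKAM H u) :
    ∃ a, hH.kernel.Dom a u ∧ ∀ r, 0 < r → r ≤ hH.kernel.τ → ∀ y, ∃ x,
      u y = u x + hH.kernel.k r x y + a * r := by
  obtain ⟨a, ha⟩ := hu
  have hlax : ∀ r, 0 < r → ∀ y, laxOleinik H r u y = ((u y - r * a : ℝ) : EReal) := by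
    intro r hr y
    have h := ha r hr y
    have h2 : laxOleinik H r u y = ((u y : ℝ) : EReal) - ((r * a : ℝ) : EReal) := by
      rw [← h, EReal.add_sub_cancel_right]
    rw [h2, EReal.coe_sub]
  have hdom : hH.kernel.Dom a u := by
    intro r hr h x y
    have h1 : laxOleinik H r u y ≤ ((u x + minAction H r x y : ℝ) : EReal) := iInf_le _ x
    rw [hlax r hr, EReal.coe_le_coe_iff, hH.minAction_eq_kernel hr h] at h1
    linarith
  refine ⟨a, hdom, fun r hr h y => ?_⟩
  obtain ⟨B, hB⟩ := hp.exists_abs_le hdom.lipschitzWith.continuous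
  obtain ⟨x, hx⟩ := ActionKernel.exists_T_eq (K := hH.kernel) hdom.lipschitzWith.continuous
    (fun x => neg_le_of_abs_le (hB x)) hr (hH.le_two_tau h) y
  refine ⟨x, le_antisymm (hdom r hr h x y) ?_⟩
  -- `laxOleinik` is only an infimum: the genuine minimizer `x` is compared with a point `z`
  -- realizing it up to `ε`.
  refine le_of_forall_pos_lt_add fun ε hε => ?_
  have h1 : laxOleinik H r u y < ((u y - r * a + ε : ℝ) : EReal) := by
    rw [hlax r hr, EReal.coe_lt_coe_iff]; linarith
  obtain ⟨z, hz⟩ := iInf_lt_iff.1 h1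
  rw [EReal.coe_lt_coe_iff, hH.minAction_eq_kernel hr h] at hz
  have h2 := ActionKernel.T_le (K := hH.kernel) (fun x => neg_le_of_abs_le (hB x)) hr
    (hH.le_two_tau h) z y
  linarith

/-- An arbitrary time is cut into `n` steps of length at most `τ`. Domination summed along chains
gives one inequality; one-step minimizers, chained backward from `y`, attain it. -/
theorem isWeakKAM_of_calibrated (hH : IsTame H m M) (hu : hH.kernel.Dom a u)
    (hmin : ∀ r, 0 < r → r ≤ hH.kernel.τ → ∀ y, ∃ x, u y = u x + hH.kernel.k r x y + a * r) :
    IsWeakKAM H u := by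
  refine ⟨a, fun t ht y => ?_⟩
  obtain ⟨n, hn⟩ := exists_nat_gt (t / hH.kernel.τ)
  have hτ := hH.kernel.τ_pos
  have hn0 : (0 : ℝ) < n := lt_of_le_of_lt (by positivity) hn
  have hn1 : n ≠ 0 := by rintro rfl; simp at hn0
  have hr : 0 < t / n := by positivity
  have hrτ : t / n ≤ hH.kernel.τ := by
    rw [div_lt_iff₀ hτ] at hn
    rw [div_le_iff₀ hn0]; linarith
  have e : (n : ℝ) * (t / n) = t := by field_simp
  have hlax : laxOleinik H t u y = ((u y - t * a : ℝ) : EReal) := by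
    refine le_antisymm ?_ (le_iInf fun x => EReal.coe_le_coe_iff.2 ?_)
    · obtain ⟨x, s, hs, hx⟩ := ActionKernel.exists_calibrated_chain (hmin _ hr hrτ) n y
      refine iInf_le_of_le x (EReal.coe_le_coe_iff.2 ?_)
      rw [hH.minAction_eq ht hn1 (hH.le_two_tau hrτ)]
      have := csInf_le (ActionKernel.bddBelow_chain (K := hH.kernel) (n := n) (x := x) (y := y) hr
        (hH.le_two_tau hrτ)) hs
      rw [e] at hx
      rw [hH.kernel_k] at this
      linarith
    · rw [hH.minAction_eq ht hn1 (hH.le_two_tau hrτ)]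
      have : u y - t * a - u x ≤ sInf {s | Chain (genFun H (t / n)) n x y s} :=
        le_csInf (Chain.exists_of_pos _ hn1 x y) fun s hs => by
          have := hu.le_add_chain hr hrτ hs
          rw [e] at this
          linarith
      linarith
  rw [hlax, ← EReal.coe_add]
  congr 1
  ring

end IsTame

end WeakKAM

end

/-! ### The critical value and the existence of a strict `C^{1,1}` critical sub-solution. -/

noncomputable section

namespace WeakKAM

open Set Filter Topology Metric MeasureTheory
open scoped NNReal ContDiff

variable {d : ℕ}

theorem fderiv_add_of_invariant {E F : Type*} [NormedAddCommGroup E] [NormedSpace ℝ E]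
    [NormedAddCommGroup F] [NormedSpace ℝ F] {f : E → F} {v : E} (h : ∀ x, f (x + v) = f x) (x : E) :
    fderiv ℝ f (x + v) = fderiv ℝ f x := by
  rw [← fderiv_comp_add_right]
  congr 1
  ext x
  exact h x

/-- Adding a periodic potential to a Hamiltonian. -/
theorem IsPeriodicHamiltonian.add_potential {H : Phase d → ℝ} {m M : ℝ}
    (hH : IsPeriodicHamiltonian H m M) {V : Pos d → ℝ} (hV : ContDiff ℝ 2 V) (hp : IsPeriodic V) :
    ∃ M', IsPeriodicHamiltonian (fun x => H x + V x.1) m M' := by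
  set W : Phase d → ℝ := fun x => V x.1
  have hW : ContDiff ℝ 2 W := hV.comp contDiff_fst
  have hW1 : ContDiff ℝ 1 (fderiv ℝ W) := hW.fderiv_right (by norm_num)
  have hH1 : ContDiff ℝ 1 (fderiv ℝ H) := hH.contDiff.fderiv_right (by norm_num)
  have hinv : ∀ (w : Fin d → ℤ) (p : Mom d) (x : Phase d),
      fderiv ℝ (fderiv ℝ W) (x + (intVec w, p)) = fderiv ℝ (fderiv ℝ W) x := fun w p =>
    fderiv_add_of_invariant (fderiv_add_of_invariant fun x => by simp [W, hp w x.1])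
  obtain ⟨B₁, hB₁⟩ := hp.exists_abs_le hV.continuous
  obtain ⟨B₂, hB₂⟩ := exists_norm_le_of_periodic
    (f := fun q : Pos d => fderiv ℝ (fderiv ℝ W) (q, 0))
    ((hW1.continuous_fderiv one_ne_zero).comp (by fun_prop)) (fun w q => by
      simpa using hinv w 0 (q, 0))
  have hB₁0 : 0 ≤ B₁ := (abs_nonneg _).trans (hB₁ 0)
  have hB₂0 : 0 ≤ B₂ := (norm_nonneg _).trans (hB₂ 0)
  have hsum : ∀ x, fderiv ℝ (fderiv ℝ fun x => H x + W x) x =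
      fderiv ℝ (fderiv ℝ H) x + fderiv ℝ (fderiv ℝ W) x := by
    intro x
    have : fderiv ℝ (fun x => H x + W x) = fun x => fderiv ℝ H x + fderiv ℝ W x := funext fun x =>
      fderiv_fun_add (hH.contDiff.differentiable two_ne_zero x) (hW.differentiable two_ne_zero x)
    rw [this, fderiv_fun_add (hH1.differentiable one_ne_zero x) (hW1.differentiable one_ne_zero x)]
  refine ⟨M + (B₁ + B₂), hH.contDiff.add hW, fun x => ?_, hH.m_pos, fun x l => ?_, fun q p => ?_,
    fun q p => ?_, fun w q p => ?_⟩
  · rw [hsum]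
    have h1 : fderiv ℝ (fderiv ℝ W) x = fderiv ℝ (fderiv ℝ W) (x.1, 0) := by
      have h0 : intVec (0 : Fin d → ℤ) = 0 := by ext i; simp [intVec]
      have := hinv 0 x.2 (x.1, 0)
      rwa [h0, Prod.mk_add_mk, add_zero, zero_add] at this
    have h2 := hB₂ x.1
    rw [← h1] at h2
    linarith [norm_add_le (fderiv ℝ (fderiv ℝ H) x) (fderiv ℝ (fderiv ℝ W) x), hH.hessian_le x]
  · rw [hsum]
    have h1 : fderiv ℝ (fderiv ℝ W) x (0, l) (0, l) = 0 := by
      have h2 : ∀ y : Phase d, fderiv ℝ W y (0, l) = 0 := fun y => by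
        have h3 := (hV.differentiable two_ne_zero y.1).hasFDerivAt.comp y
          (hasFDerivAt_fst (𝕜 := ℝ) (p := y))
        have h4 : HasFDerivAt W _ y := h3
        rw [h4.fderiv]
        simp
      have h3 := ((hW1.differentiable one_ne_zero x).hasFDerivAt.clm_apply
        (hasFDerivAt_const ((0, l) : Phase d) x)).congr_of_eventuallyEq
        (Eventually.of_forall fun y => (h2 y).symm)
      have h4 := congrArg (fun D => D ((0, l) : Phase d)) (h3.unique (hasFDerivAt_const (0 : ℝ) x))
      simpa using h4
    simp only [add_apply, h1, add_zero]
    exact hH.convex x l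
  · have h1 := neg_le_of_abs_le (hB₁ q)
    have h2 := hH.lower q p
    simp only
    linarith
  · have h1 := le_of_abs_le (hB₁ q)
    have h2 := hH.upper q p
    have h3 : 0 ≤ (B₁ + B₂) / 2 * ‖p‖ ^ 2 := by positivity
    simp only
    linarith
  · simp only [hH.periodic w q p, hp w q]

/-- A smooth periodic function below a given continuous periodic function, positive at a given
point. -/
theorem exists_potential_le {δ : Pos d → ℝ} (hδ : Continuous δ) (hp : IsPeriodic δ)
    (h0 : ∀ x, 0 ≤ δ x) {c : Pos d} (hc : 0 < δ c) :
    ∃ V : Pos d → ℝ, ContDiff ℝ 2 V ∧ IsPeriodic V ∧ (∀ x, 0 ≤ V x) ∧ (∀ x, V x ≤ δ x) ∧ 0 < V c := by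
  set ε := δ c / 2 with hε
  have hεpos : 0 < ε := half_pos hc
  -- This periodic function vanishes exactly on the integer translates of `c`. On the compact set
  -- `S`, where `δ ≤ ε` in a unit cube around `c`, it is at least some `η > 0`; cutting off at `g =
  -- η` makes the potential vanish there.
  set g : Pos d → ℝ := fun x => ∑ i, (1 - Real.cos (2 * Real.pi * (x i - c i))) with hg
  have hgd : ContDiff ℝ 2 g := by
    refine ContDiff.sum fun i _ => contDiff_const.sub (Real.contDiff_cos.comp ?_)
    exact contDiff_const.mul ((EuclideanSpace.proj i : Mom d).contDiff.sub contDiff_const)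
  have hgp : IsPeriodic g := fun w x => by
    refine Finset.sum_congr rfl fun i _ => ?_
    have : 2 * Real.pi * ((x + intVec w) i - c i) =
        2 * Real.pi * (x i - c i) + (w i : ℤ) * (2 * Real.pi) := by
      simp [intVec]; ring
    rw [this, Real.cos_add_int_mul_two_pi]
  have hg0 : ∀ i x, 0 ≤ 1 - Real.cos (2 * Real.pi * ((x : Pos d) i - c i)) := fun i x =>
    sub_nonneg.2 (Real.cos_le_one _)
  have hgpos : ∀ x : Pos d, (∀ i, |(x - c) i| ≤ 1 / 2) → g x = 0 → x = c := by
    intro x hx h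
    ext i
    have h1 := (Finset.sum_eq_zero_iff_of_nonneg fun i _ => hg0 i x).1 h i (Finset.mem_univ i)
    have h2 := abs_le.1 (hx i)
    rw [PiLp.sub_apply] at h2
    have hpi := Real.pi_pos
    have h3 := (Real.cos_eq_one_iff_of_lt_of_lt (x := 2 * Real.pi * (x i - c i))
      (by nlinarith) (by nlinarith)).1 (by linarith)
    have h4 := (mul_eq_zero.1 h3).resolve_left (by positivity)
    linarith
  set S : Set (Pos d) := {x | (∀ i, |(x - c) i| ≤ 1 / 2) ∧ δ x ≤ ε}
  have hS : IsCompact S := by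
    refine (isCompact_closedBall c (√d)).of_isClosed_subset ?_ fun x hx => ?_
    · have hcl : IsClosed (⋂ i, {x : Pos d | |(x - c) i| ≤ 1 / 2}) :=
        isClosed_iInter fun i => isClosed_le (by fun_prop) continuous_const
      have e : S = (⋂ i, {x : Pos d | |(x - c) i| ≤ 1 / 2}) ∩ {x | δ x ≤ ε} := by
        ext x
        simp [S]
      rw [e]
      exact hcl.inter (isClosed_le hδ continuous_const)
    · rw [mem_closedBall, dist_eq_norm]
      exact norm_le_sqrt_of_abs_le hx.1
  obtain ⟨η, hη, hηS⟩ : ∃ η : ℝ, 0 < η ∧ ∀ x ∈ S, η ≤ g x := by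
    rcases S.eq_empty_or_nonempty with he | hne
    · exact ⟨1, one_pos, by simp [he]⟩
    · obtain ⟨z, hz, hmin⟩ := hS.exists_isMinOn hne hgd.continuous.continuousOn
      refine ⟨g z, lt_of_le_of_ne (Finset.sum_nonneg fun i _ => hg0 i z) fun h => ?_, fun x hx => hmin hx⟩
      have := hgpos z hz.1 h.symm
      have h2 := hz.2
      rw [this] at h2
      linarith
  refine ⟨fun x => ε * Real.smoothTransition ((η - g x) / η), ?_, fun w x => ?_, fun x => ?_,
    fun x => ?_, ?_⟩
  · exact contDiff_const.mul (Real.smoothTransition.contDiff.comp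
      ((contDiff_const.sub hgd).div_const η))
  · simp only [hgp w x]
  · exact mul_nonneg hεpos.le (Real.smoothTransition.nonneg _)
  · obtain ⟨w, hw⟩ := exists_translate_abs_le c x
    rcases le_or_gt (δ x) ε with hx | hx
    · have h1 := hηS (x + intVec w) ⟨hw, by rwa [hp w x]⟩
      rw [hgp w x] at h1
      have h2 : (η - g x) / η ≤ 0 := div_nonpos_of_nonpos_of_nonneg (by linarith) hη.le
      simp only [Real.smoothTransition.zero_of_nonpos h2, mul_zero]
      exact h0 x
    · exact (mul_le_of_le_one_right hεpos.le (Real.smoothTransition.le_one _)).trans hx.le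
  · have : g c = 0 := by simp [hg]
    simp only [this, sub_zero, div_self hη.ne']
    rw [Real.smoothTransition.one]
    simpa using hεpos

namespace IsTame

variable {H : Phase d → ℝ} {m M a : ℝ} {u : Pos d → ℝ}

theorem critSet_nonempty (hH : IsTame H m M) :
    {a : ℝ | ∃ u : Pos d → ℝ, IsPeriodic u ∧ IsSubsolution H a u}.Nonempty := by
  refine ⟨M, fun _ => 0, fun _ _ => rfl, ⟨0, LipschitzWith.const 0⟩, fun q _ => ?_⟩
  simpa using hH.upper q (fderiv ℝ (fun _ => (0 : ℝ)) q)

/-- A Lipschitz function has a point of differentiability, where `H ≥ -M`. The bound is essential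
because `sInf` of a set unbounded below has the default value 0. -/
theorem critSet_bddBelow (hH : IsTame H m M) :
    BddBelow {a : ℝ | ∃ u : Pos d → ℝ, IsPeriodic u ∧ IsSubsolution H a u} := by
  refine ⟨-M, ?_⟩
  rintro a ⟨u, -, ⟨Λ, hΛ⟩, hu⟩
  obtain ⟨q, hq⟩ := (hΛ.ae_differentiableAt (μ := volume)).exists
  have h1 := hH.lower q (fderiv ℝ u q)
  have h2 : 0 ≤ m / 2 * ‖fderiv ℝ u q‖ ^ 2 := by have := hH.m_pos; positivity
  linarith [hu q hq]

theorem critValue_le (hH : IsTame H m M) (hp : IsPeriodic u) (hu : hH.kernel.Dom a u) :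
    critValue H ≤ a :=
  csInf_le hH.critSet_bddBelow ⟨u, hp, hH.isSubsolution_of_dom hu⟩

theorem isCriticalSub_iff (hH : IsTame H m M) :
    IsCriticalSub H u ↔ IsPeriodic u ∧ hH.kernel.Dom (critValue H) u :=
  ⟨fun h => ⟨h.1, hH.dom_of_isSubsolution h.2⟩, fun h => ⟨h.1, hH.isSubsolution_of_dom h.2⟩⟩

/-- The infimum defining the critical value is attained. -/
theorem exists_isCriticalSub (hH : IsTame H m M) : ∃ u, IsCriticalSub H u := by
  set α := critValue H
  have hex : ∀ n : ℕ, ∃ v : Pos d → ℝ, IsPeriodic v ∧ hH.kernel.Dom (α + 1 / (n + 1)) v ∧ v 0 = 0 := by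
    intro n
    have hn : (0 : ℝ) < 1 / (n + 1) := by positivity
    obtain ⟨a, ⟨u, hp, hu⟩, ha⟩ := exists_lt_of_csInf_lt hH.critSet_nonempty
      (show sInf _ < α + 1 / (n + 1) from lt_add_of_pos_right _ hn)
    refine ⟨fun x => u x - u 0, fun w q => by simp only [hp w q], fun r hr h x y => ?_, sub_self _⟩
    have h1 := hH.dom_of_isSubsolution hu r hr h x y
    have h2 := mul_le_mul_of_nonneg_right ha.le hr.le
    linarith
  choose v hvp hvd hv0 using hex
  have hbound : ∀ n x, v n x ∈ Icc (-((hH.kernel.C + (|α| + 1)) * ‖x‖))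
      ((hH.kernel.C + (|α| + 1)) * ‖x‖) := by
    intro n x
    have h1 := (hvd n).lipschitzWith.dist_le_mul x 0
    rw [Real.dist_eq, hv0, sub_zero, dist_zero_right,
      Real.coe_toNNReal _ (add_nonneg hH.kernel.C_nonneg (abs_nonneg _))] at h1
    have h2 : |α + 1 / ((n : ℝ) + 1)| ≤ |α| + 1 := by
      refine (abs_add_le _ _).trans ?_
      have : 1 / ((n : ℝ) + 1) ≤ 1 := by
        rw [div_le_one (by positivity)]; linarith [n.cast_nonneg (α := ℝ)]
      rw [abs_of_pos (show (0 : ℝ) < 1 / ((n : ℝ) + 1) by positivity)]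
      linarith
    exact abs_le.1 (h1.trans (by gcongr))
  -- Pointwise limits along an ultrafilter suffice, since domination is a closed condition on the
  -- values at pairs of points.
  have hlim : ∀ x, ∃ l, Tendsto (fun n => v n x) (hyperfilter ℕ) (𝓝 l) := by
    intro x
    obtain ⟨l, -, hl⟩ := isCompact_Icc.ultrafilter_le_nhds ((hyperfilter ℕ).map fun n => v n x)
      (le_principal_iff.2 (mem_map.2 (univ_mem' fun n => hbound n x)))
    exact ⟨l, hl⟩
  choose w hw using hlim
  refine ⟨w, hH.isCriticalSub_iff.2 ⟨fun z q => ?_, fun r hr h x y => ?_⟩⟩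
  · refine tendsto_nhds_unique (hw (q + intVec z)) ?_
    simp only [hvp _ z q]
    exact hw q
  · have h1 : Tendsto (fun n : ℕ => α + 1 / ((n : ℝ) + 1)) (hyperfilter ℕ) (𝓝 (α + 0)) :=
      (tendsto_one_div_add_atTop_nhds_zero_nat.mono_left Nat.hyperfilter_le_atTop).const_add α
    rw [add_zero] at h1
    exact le_of_tendsto_of_tendsto' (hw y) (((hw x).add_const _).add (h1.mul_const r))
      fun n => hvd n r hr h x y

theorem le_of_isCriticalSub (hu : IsCriticalSub H u) (h1 : ContDiff ℝ 1 u) (q : Pos d) :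
    H (q, fderiv ℝ u q) ≤ critValue H :=
  hu.2.2 q (h1.differentiable one_ne_zero q)

theorem exists_isC11_critical (hH : IsTame H m M) : ∃ w, IsC11 w ∧ IsCriticalSub H w := by
  obtain ⟨u, hu⟩ := hH.exists_isCriticalSub
  obtain ⟨hp, hd⟩ := hH.isCriticalSub_iff.1 hu
  obtain ⟨w, h1, h2, h3⟩ := hd.exists_isC11 hp
  exact ⟨w, h1, hH.isCriticalSub_iff.2 ⟨h2, h3⟩⟩

/-- Outside of the Aubry set, there are strict `C^{1,1}` critical sub-solutions. -/
theorem exists_isC11_strict_at (hH : IsTame H m M) {q : Pos d} (hq : q ∉ projAubry H) :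
    ∃ w, IsC11 w ∧ IsCriticalSub H w ∧ H (q, fderiv ℝ w q) < critValue H := by
  obtain ⟨v, hv1, hv, hvq⟩ : ∃ v, ContDiff ℝ 1 v ∧ IsCriticalSub H v ∧
      H (q, fderiv ℝ v q) < critValue H := by
    by_contra! h
    exact hq fun u h1 h2 => le_antisymm (le_of_isCriticalSub h2 h1 q) (h u h1 h2)
  have hcont : Continuous fun x => critValue H - H (x, fderiv ℝ v x) :=
    continuous_const.sub (hH.contDiff.continuous.comp
      (continuous_id.prodMk (hv1.continuous_fderiv one_ne_zero)))
  obtain ⟨V, hV, hVp, hV0, hVle, hVq⟩ := exists_potential_le hcont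
    (fun w x => by rw [hv.1.fderiv, hH.periodic])
    (fun x => sub_nonneg.2 (le_of_isCriticalSub hv hv1 x)) (sub_pos.2 hvq)
  obtain ⟨M', hH'⟩ := hH.toIsPeriodicHamiltonian.add_potential hV hVp
  have hT := hH'.isTame
  -- As `V` is below the energy defect of `v`, `v` is still a sub-solution for `H + V`. Regularizing
  -- with the kernel of `H + V` keeps `H ≤ α(0) - V`, hence strictness at `q`.
  obtain ⟨w, hw1, hwp, hwd⟩ := ActionKernel.Dom.exists_isC11 (hT.dom_of_isSubsolution
    (u := v) (a := critValue H) ⟨hv.2.1, fun x hx => by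
      have := hVle x
      simp only
      linarith⟩) hv.1
  have hws := hT.isSubsolution_of_dom hwd
  have hle : ∀ x, H (x, fderiv ℝ w x) + V x ≤ critValue H := fun x =>
    hws.2 x (hw1.1.differentiable one_ne_zero x)
  refine ⟨w, hw1, ⟨hwp, hws.1, fun x _ => ?_⟩, ?_⟩
  · linarith [hV0 x, hle x]
  · linarith [hle q]

/-- Geometric weights divided by `1 + K n`, then normalized to total mass one. -/
theorem _root_.WeakKAM.exists_weights (K : ℕ → ℝ) (hK : ∀ n, 0 ≤ K n) :
    ∃ c : ℕ → ℝ, (∀ n, 0 < c n) ∧ HasSum c 1 ∧ Summable fun n => c n * K n := by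
  set b : ℕ → ℝ := fun n => (1 / 2) ^ n / (1 + K n)
  have hden : ∀ n, 0 < 1 + K n := fun n => by linarith [hK n]
  have hbpos : ∀ n, 0 < b n := fun n => div_pos (by positivity) (hden n)
  have hgeo : Summable fun n : ℕ => (1 / 2 : ℝ) ^ n := summable_geometric_two
  have hbs : Summable b := hgeo.of_nonneg_of_le (fun n => (hbpos n).le)
    fun n => div_le_self (by positivity) (by linarith [hK n])
  have hS : 0 < ∑' n, b n := hbs.tsum_pos (fun n => (hbpos n).le) 0 (hbpos 0)
  have hbK : Summable fun n => b n * K n := hgeo.of_nonneg_of_le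
    (fun n => mul_nonneg (hbpos n).le (hK n)) fun n => by
      rw [div_mul_eq_mul_div, div_le_iff₀ (hden n)]
      gcongr
      linarith
  refine ⟨fun n => b n / ∑' n, b n, fun n => div_pos (hbpos n) hS, ?_, ?_⟩
  · have := hbs.hasSum.div_const (∑' n, b n)
    rwa [div_self hS.ne'] at this
  · exact (hbK.div_const (∑' n, b n)).congr fun n => (div_mul_eq_mul_div _ _ _).symm

/-- Jensen inequality for an infinite convex combination. -/
theorem jensen (hH : IsTame H m M) {c : ℕ → ℝ} (hc : ∀ n, 0 < c n) (hc1 : HasSum c 1)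
    {p : ℕ → Mom d} {P : Mom d} (hP : HasSum (fun n => c n • p n) P) {q : Pos d}
    (hle : ∀ n, H (q, p n) ≤ a) (n : ℕ) : c n * (a - H (q, p n)) ≤ a - H (q, P) := by
  -- The tangent of `H (q, ·)` at the barycenter `P`: the affine excesses sum to `a - H (q, P)`, are
  -- non-negative, and each dominates the corresponding defect.
  set v := (hamVF H (q, P)).1
  have h1 : HasSum (fun n => c n * p n v) (P v) := by
    have := (ContinuousLinearMap.apply ℝ ℝ v).hasSum hP
    simpa only [ContinuousLinearMap.apply_apply, smul_apply, smul_eq_mul] using this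
  have h2 : HasSum (fun n => c n * (a - H (q, P) + P v) - c n * p n v)
      (1 * (a - H (q, P) + P v) - P v) := (hc1.mul_right _).sub h1
  have h3 : ∀ k, c k * (a - H (q, p k)) ≤ c k * (a - H (q, P) + P v) - c k * p k v := by
    intro k
    rw [← mul_sub]
    refine mul_le_mul_of_nonneg_left ?_ (hc k).le
    have h4 := hH.strong_convex q P (p k - P)
    rw [add_sub_cancel, sub_apply] at h4
    have h5 : 0 ≤ m / 2 * ‖p k - P‖ ^ 2 := by have := hH.m_pos; positivity
    linarith
  have h6 : ∀ k, 0 ≤ c k * (a - H (q, P) + P v) - c k * p k v := fun k =>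
    (mul_nonneg (hc k).le (sub_nonneg.2 (hle k))).trans (h3 k)
  have h7 := le_hasSum h2 n (fun k _ => h6 k)
  linarith [h3 n]

/-- Infinite convex combinations of `C^{1,1}` functions. -/
theorem _root_.WeakKAM.exists_hasFDerivAt_combination {f : ℕ → Pos d → ℝ} {K : ℕ → ℝ≥0}
    {c : ℕ → ℝ} {B : ℕ → ℝ} {Λ : ℝ≥0} (hf : ∀ n, IsC11 (f n))
    (hK : ∀ n, LipschitzWith (K n) (fderiv ℝ (f n))) (hB : ∀ n q, |f n q| ≤ B n)
    (hΛ : ∀ n q, ‖fderiv ℝ (f n) q‖ ≤ Λ) (hc : ∀ n, 0 < c n) (hc1 : HasSum c 1)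
    (hcK : Summable fun n => c n * K n) (hcB : Summable fun n => c n * B n) :
    ∃ (u : Pos d → ℝ) (D : Pos d → Mom d) (L : ℝ≥0), (∀ q, u q = ∑' n, c n * f n q) ∧
      (∀ q, HasFDerivAt u (D q) q) ∧ LipschitzWith L D ∧
      (∀ q, HasSum (fun n => c n • fderiv ℝ (f n) q) (D q)) ∧ ∀ q, ‖D q‖ ≤ Λ := by
  have hcΛ : Summable fun n => c n * (Λ : ℝ) := hc1.summable.mul_right _
  have hDn : ∀ n q, ‖c n • fderiv ℝ (f n) q‖ ≤ c n * Λ := fun n q => by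
    rw [norm_smul, Real.norm_of_nonneg (hc n).le]
    exact mul_le_mul_of_nonneg_left (hΛ n q) (hc n).le
  have hDs : ∀ q, Summable fun n => c n • fderiv ℝ (f n) q := fun q =>
    hcΛ.of_norm_bounded fun n => hDn n q
  have hfs : Summable fun n => c n * f n 0 := hcB.of_norm_bounded fun n => by
    rw [norm_mul, Real.norm_of_nonneg (hc n).le]
    exact mul_le_mul_of_nonneg_left (hB n 0) (hc n).le
  refine ⟨fun q => ∑' n, c n * f n q, fun q => ∑' n, c n • fderiv ℝ (f n) q,
    (∑' n, c n * K n).toNNReal, fun _ => rfl, fun q => ?_, ?_, fun q => (hDs q).hasSum, fun q => ?_⟩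
  · exact hasFDerivAt_tsum hcΛ (fun n q => ((hf n).hasFDerivAt q).const_mul (c n)) hDn hfs q
  · refine LipschitzWith.of_dist_le_mul fun x y => ?_
    rw [Real.coe_toNNReal _ (tsum_nonneg fun n => mul_nonneg (hc n).le (K n).coe_nonneg),
      dist_eq_norm, dist_eq_norm, ← (hDs x).tsum_sub (hDs y), ← tsum_mul_right]
    refine tsum_of_norm_bounded (hcK.mul_right _).hasSum fun n => ?_
    rw [← smul_sub, norm_smul, Real.norm_of_nonneg (hc n).le, mul_assoc]
    exact mul_le_mul_of_nonneg_left ((hK n).norm_sub_le x y) (hc n).le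
  · have h1 := hc1.mul_right (Λ : ℝ)
    rw [one_mul] at h1
    exact tsum_of_norm_bounded h1 fun n => hDn n q

/-- Infinite convex combinations of critical sub-solutions. -/
theorem exists_combination (hH : IsTame H m M) {f : ℕ → Pos d → ℝ} (hf : ∀ n, IsC11 (f n))
    (hc : ∀ n, IsCriticalSub H (f n)) : ∃ u, IsC11 u ∧ IsCriticalSub H u ∧
      ∀ n q, H (q, fderiv ℝ (f n) q) < critValue H → H (q, fderiv ℝ u q) < critValue H := by
  choose K hK using fun n => (hf n).2
  choose B hB using fun n => (hc n).1.exists_abs_le (hf n).1.continuous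
  have hB0 : ∀ n, 0 ≤ B n := fun n => (abs_nonneg _).trans (hB n 0)
  obtain ⟨c, hcpos, hc1, hcKB⟩ := exists_weights (fun n => K n + B n)
    fun n => add_nonneg (K n).coe_nonneg (hB0 n)
  have hcK : Summable fun n => c n * K n := hcKB.of_nonneg_of_le
    (fun n => mul_nonneg (hcpos n).le (K n).coe_nonneg)
    (fun n => mul_le_mul_of_nonneg_left (by linarith [hB0 n]) (hcpos n).le)
  have hcB : Summable fun n => c n * B n := hcKB.of_nonneg_of_le
    (fun n => mul_nonneg (hcpos n).le (hB0 n))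
    (fun n => mul_le_mul_of_nonneg_left (by linarith [(K n).coe_nonneg]) (hcpos n).le)
  obtain ⟨u, D, L, hu, hD, hL, hDs, hDΛ⟩ := exists_hasFDerivAt_combination hf hK hB
    (fun n q => norm_fderiv_le_of_lipschitz ℝ (hH.isCriticalSub_iff.1 (hc n)).2.lipschitzWith)
    hcpos hc1 hcK hcB
  have hJ : ∀ n q, c n * (critValue H - H (q, fderiv ℝ (f n) q)) ≤
      critValue H - H (q, fderiv ℝ u q) := fun n q => by
    rw [(hD q).fderiv]
    exact hH.jensen hcpos hc1 (hDs q) (fun k => le_of_isCriticalSub (hc k) (hf k).1 q) n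
  refine ⟨u, isC11_of_hasFDerivAt hD hL, ⟨fun w q => ?_,
    ⟨(hH.kernel.C + |critValue H|).toNNReal, ?_⟩, fun q _ => ?_⟩, fun n q hq => ?_⟩
  · rw [hu, hu]
    exact tsum_congr fun n => by rw [(hc n).1 w q]
  · refine lipschitzWith_of_nnnorm_fderiv_le (fun q => (hD q).differentiableAt) fun q => ?_
    rw [(hD q).fderiv, ← NNReal.coe_le_coe, coe_nnnorm]
    exact hDΛ q
  · have h1 := hJ 0 q
    have h2 := mul_nonneg (hcpos 0).le (sub_nonneg.2 (le_of_isCriticalSub (hc 0) (hf 0).1 q))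
    linarith
  · have h1 := hJ n q
    have h2 := mul_pos (hcpos n) (sub_pos.2 hq)
    linarith

/-- Existence of a `C^{1,1}` critical sub-solution which is strict outside of the Aubry set. -/
theorem exists_isStrictCriticalSub (hH : IsTame H m M) : ∃ u, IsStrictCriticalSub H u := by
  obtain ⟨w₀, hw₀⟩ := hH.exists_isC11_critical
  let ι := {w : Pos d → ℝ // IsC11 w ∧ IsCriticalSub H w}
  let U : ι → Set (Pos d) := fun w => {q | H (q, fderiv ℝ w.1 q) < critValue H}
  have hU : ∀ w, IsOpen (U w) := fun w => isOpen_lt (hH.contDiff.continuous.comp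
    (continuous_id.prodMk (w.2.1.1.continuous_fderiv one_ne_zero))) continuous_const
  obtain ⟨T, hT, hTU⟩ := TopologicalSpace.isOpen_iUnion_countable U hU
  -- The countable subfamily given by the Lindelöf property may be empty; inserting `w₀` allows it
  -- to be enumerated by `ℕ`.
  obtain ⟨f, hf⟩ := (hT.insert (⟨w₀, hw₀⟩ : ι)).exists_eq_range (insert_nonempty _ _)
  obtain ⟨u, hu1, hu2, hu3⟩ := hH.exists_combination (f := fun n => (f n).1)
    (fun n => (f n).2.1) (fun n => (f n).2.2)
  refine ⟨u, hu2, hu1.1, hu1.2, fun q hq => ?_⟩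
  obtain ⟨w, hw1, hw2, hw3⟩ := hH.exists_isC11_strict_at hq
  have h1 : q ∈ ⋃ i, U i := mem_iUnion.2 ⟨⟨w, hw1, hw2⟩, hw3⟩
  rw [← hTU] at h1
  obtain ⟨i, hi, hqi⟩ := mem_iUnion₂.1 h1
  obtain ⟨n, rfl⟩ : i ∈ range f := hf ▸ mem_insert_of_mem _ hi
  exact hu3 n q hqi

end IsTame

end WeakKAM

end

/-! ### Invariance and calibration of the Aubry set; first inclusion. -/

noncomputable section

namespace WeakKAM

open Set Filter Topology Metric MeasureTheory
open scoped NNReal ContDiff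

variable {d : ℕ}

theorem SemiConv.add_const {b : ℝ} {f : Pos d → ℝ} (hf : SemiConv b f) (c : ℝ) :
    SemiConv b (fun x => f x + c) := fun x y s hs => by
  have := hf x y s hs
  simp only
  linarith

namespace IsTame

variable {H : Phase d → ℝ} {m M a : ℝ} {u v u₀ : Pos d → ℝ}

theorem flow_nat_mul_mem (hH : IsTame H m M) {G : Set (Phase d)} {s : ℝ}
    (h : ∀ x ∈ G, flow H s x ∈ G) (n : ℕ) {x : Phase d} (hx : x ∈ G) : flow H (n * s) x ∈ G := by
  induction n with
  | zero => simpa [hH.flow_zero] using hx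
  | succ n ih =>
    have e : ((n + 1 : ℕ) : ℝ) * s = s + n * s := by push_cast; ring
    rw [e, hH.flow_add]
    exact h _ ih

/-- A set which is invariant under the flow in short time is invariant. -/
theorem flow_mem_of_small (hH : IsTame H m M) {G : Set (Phase d)} {ε : ℝ} (hε : 0 < ε)
    (h : ∀ s, |s| ≤ ε → ∀ x ∈ G, flow H s x ∈ G) (t : ℝ) {x : Phase d} (hx : x ∈ G) :
    flow H t x ∈ G := by
  obtain ⟨n, hn⟩ := exists_nat_gt (|t| / ε)
  have hn0 : (0 : ℝ) < n := lt_of_le_of_lt (by positivity) hn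
  have := hH.flow_nat_mul_mem (s := t / n) (h _ (by
    rw [abs_div, abs_of_pos hn0, div_le_iff₀ hn0]
    rw [div_lt_iff₀ hε] at hn
    linarith)) n hx
  rwa [mul_div_cancel₀ _ hn0.ne'] at this

theorem exists_average (hH : IsTame H m M) (hu1 : ContDiff ℝ 1 u) (hu : IsCriticalSub H u)
    (hv1 : ContDiff ℝ 1 v) (hv : IsCriticalSub H v) : ∃ w, ContDiff ℝ 1 w ∧ IsCriticalSub H w ∧
      ∀ q, fderiv ℝ w q = (1 / 2 : ℝ) • (fderiv ℝ u q + fderiv ℝ v q) := by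
  obtain ⟨hup, hud⟩ := hH.isCriticalSub_iff.1 hu
  obtain ⟨hvp, hvd⟩ := hH.isCriticalSub_iff.1 hv
  refine ⟨fun x => (1 / 2 : ℝ) • (u x + v x), (hu1.add hv1).const_smul _,
    hH.isCriticalSub_iff.2 ⟨fun w q => by simp only [hup w q, hvp w q], fun r hr h x y => ?_⟩,
    fun q => ?_⟩
  · have h1 := hud r hr h x y
    have h2 := hvd r hr h x y
    simp only [smul_eq_mul]
    linarith
  · exact (((hu1.differentiable one_ne_zero q).hasFDerivAt.add
      (hv1.differentiable one_ne_zero q).hasFDerivAt).const_smul (1 / 2 : ℝ)).fderiv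

/-- All the `C¹` critical sub-solutions have the same differential on the Aubry set. -/
theorem fderiv_eq_of_mem_projAubry (hH : IsTame H m M) {q : Pos d} (hq : q ∈ projAubry H)
    (hu1 : ContDiff ℝ 1 u) (hu : IsCriticalSub H u) (hv1 : ContDiff ℝ 1 v)
    (hv : IsCriticalSub H v) : fderiv ℝ u q = fderiv ℝ v q := by
  obtain ⟨w, hw1, hw, hwd⟩ := hH.exists_average hu1 hu hv1 hv
  have h1 := hq w hw1 hw
  have h2 := hq u hu1 hu
  have h3 := hq v hv1 hv
  have e1 : fderiv ℝ u q = fderiv ℝ w q + (1 / 2 : ℝ) • (fderiv ℝ u q - fderiv ℝ v q) := by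
    rw [hwd]; module
  have e2 : fderiv ℝ v q = fderiv ℝ w q + (-(1 / 2 : ℝ)) • (fderiv ℝ u q - fderiv ℝ v q) := by
    rw [hwd]; module
  set l := fderiv ℝ u q - fderiv ℝ v q with hl
  -- The two differentials and their average all have energy `α(0)`. Strong convexity from the
  -- average in both directions leaves `m / 4 * ‖l‖ ^ 2 ≤ 0`.
  have h4 := hH.strong_convex q (fderiv ℝ w q) ((1 / 2 : ℝ) • l)
  have h5 := hH.strong_convex q (fderiv ℝ w q) ((-(1 / 2 : ℝ)) • l)
  rw [← e1, h1, h2, norm_smul] at h4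
  rw [← e2, h1, h3, norm_smul] at h5
  simp only [smul_apply, smul_eq_mul] at h4 h5
  norm_num at h4 h5
  have h6 : ‖l‖ = 0 := by
    by_contra h
    have : 0 < m * ‖l‖ ^ 2 := by have := hH.m_pos; positivity
    linarith
  exact sub_eq_zero.1 (norm_eq_zero.1 h6)

end IsTame

theorem IsStrictCriticalSub.isC11 {H : Phase d → ℝ} {u₀ : Pos d → ℝ}
    (h : IsStrictCriticalSub H u₀) : IsC11 u₀ := ⟨h.contDiff, h.lipschitz⟩

/-- The Aubry set in `ℝ^d × (ℝ^d)^*`. -/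
def aubryLift (H : Phase d → ℝ) (u : Pos d → ℝ) : Set (Phase d) :=
  {x | x.1 ∈ projAubry H ∧ x.2 = fderiv ℝ u x.1}

namespace IsTame

variable {H : Phase d → ℝ} {m M a : ℝ} {u v u₀ : Pos d → ℝ}

theorem energy_of_mem_aubryLift (h₀ : IsStrictCriticalSub H u₀) {x : Phase d}
    (hx : x ∈ aubryLift H u₀) : H x = critValue H := by
  obtain ⟨q, p⟩ := x
  obtain ⟨hq, hp⟩ := hx
  change p = fderiv ℝ u₀ q at hp
  rw [hp]
  exact hq u₀ h₀.contDiff h₀.critical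

theorem mem_projAubry_of_energy (h₀ : IsStrictCriticalSub H u₀) {q : Pos d}
    (hq : H (q, fderiv ℝ u₀ q) = critValue H) : q ∈ projAubry H := by
  by_contra h
  exact (h₀.strict q h).ne hq

/-- For small `t`, `T t u₀` is a `C^{1,1}` critical sub-solution up to this time, so it has the
differential of `u₀` on the Aubry set. The orbit minimizing at `q` thus ends at `(q, du₀(q))`, and
it starts on the graph of `du₀` by the first-order condition. Conservation of energy and strictness
of `u₀` put its start in the Aubry set. -/
theorem flow_neg_mem_aubryLift_small (hH : IsTame H m M) (h₀ : IsStrictCriticalSub H u₀) :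
    ∃ ε, 0 < ε ∧ ∀ t, 0 < t → t ≤ ε → ∀ x ∈ aubryLift H u₀, flow H (-t) x ∈ aubryLift H u₀ := by
  obtain ⟨hp, hd⟩ := hH.isCriticalSub_iff.1 h₀.critical
  obtain ⟨b, hb⟩ := h₀.isC11.exists_semiConv
  obtain ⟨B, hB⟩ := hp.exists_abs_le hd.lipschitzWith.continuous
  have hB' : ∀ x, -B ≤ u₀ x := fun x => neg_le_of_abs_le (hB x)
  have hb1 : 0 < |b| + 1 := by positivity
  refine ⟨min hH.kernel.τ (hH.kernel.κ / (|b| + 1)), lt_min hH.kernel.τ_pos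
    (div_pos hH.kernel.κ_pos hb1), fun t ht hte x hx => ?_⟩
  have htτ : t ≤ hH.kernel.τ := hte.trans (min_le_left _ _)
  have htb : b < hH.kernel.κ / t := by
    have h1 := hte.trans (min_le_right _ _)
    rw [le_div_iff₀ hb1] at h1
    rw [lt_div_iff₀ ht]
    nlinarith [le_abs_self b]
  obtain ⟨X, hX, hX', Λ, hΛ⟩ := ActionKernel.exists_hasFDerivAt_T
    hd.lipschitzWith.continuous hB' hb ht (hH.le_two_tau htτ) htb
  have hc : IsCriticalSub H (hH.kernel.T t u₀) := hH.isCriticalSub_iff.2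
    ⟨ActionKernel.T_periodic hp ht (hH.le_two_tau htτ), hd.T hB' ht htτ⟩
  obtain ⟨z, hz1, hz2⟩ := hH.exists_flow_eq ht htτ (X x.1) x.1
  have h1 := ActionKernel.fderiv_of_T_eq hB' ht (hH.le_two_tau htτ) (hX x.1)
    (h₀.isC11.hasFDerivAt _).differentiableAt
  have h2 := (hX' x.1).fderiv
  rw [← hz1, ← hz2, hH.kernel_D₁_flow ht htτ, neg_neg] at h1
  rw [← hz1, ← hz2, hH.kernel_D₂_flow ht htτ, hz2] at h2
  have h3 : flow H t z = x := Prod.ext hz2 (by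
    rw [hx.2, ← h2]
    exact hH.fderiv_eq_of_mem_projAubry hx.1 (isC11_of_hasFDerivAt hX' hΛ).1 hc h₀.contDiff
      h₀.critical)
  rw [← h3, hH.flow_neg_flow]
  refine ⟨mem_projAubry_of_energy h₀ ?_, h1.symm⟩
  rw [h1, Prod.mk.eta, ← hH.energy_flow t z, h3, energy_of_mem_aubryLift h₀ hx]

/-- The same argument for the reversed kernel and `-u₀`. -/
theorem flow_mem_aubryLift_small (hH : IsTame H m M) (h₀ : IsStrictCriticalSub H u₀) :
    ∃ ε, 0 < ε ∧ ∀ t, 0 < t → t ≤ ε → ∀ x ∈ aubryLift H u₀, flow H t x ∈ aubryLift H u₀ := by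
  obtain ⟨hp, hd⟩ := hH.isCriticalSub_iff.1 h₀.critical
  obtain ⟨b, hb⟩ := h₀.isC11.neg.exists_semiConv
  obtain ⟨B, hB⟩ := hp.neg.exists_abs_le hd.lipschitzWith.continuous.neg
  have hB' : ∀ x, -B ≤ (-u₀) x := fun x => neg_le_of_abs_le (hB x)
  have hb1 : 0 < |b| + 1 := by positivity
  refine ⟨min hH.kernel.τ (hH.kernel.κ / (|b| + 1)), lt_min hH.kernel.τ_pos
    (div_pos hH.kernel.κ_pos hb1), fun t ht hte x hx => ?_⟩
  have htτ : t ≤ hH.kernel.τ := hte.trans (min_le_left _ _)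
  have htτ2 : t ≤ 2 * hH.kernel.swap.τ := hH.le_two_tau htτ
  have htb : b < hH.kernel.swap.κ / t := by
    have h1 := hte.trans (min_le_right _ _)
    rw [le_div_iff₀ hb1] at h1
    change b < hH.kernel.κ / t
    rw [lt_div_iff₀ ht]
    nlinarith [le_abs_self b]
  obtain ⟨X, hX, hX', Λ, hΛ⟩ := ActionKernel.exists_hasFDerivAt_T (K := hH.kernel.swap)
    hd.lipschitzWith.continuous.neg hB' hb ht htτ2 htb
  have hc : IsCriticalSub H (-hH.kernel.swap.T t (-u₀)) := hH.isCriticalSub_iff.2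
    ⟨(ActionKernel.T_periodic hp.neg ht htτ2).neg, ActionKernel.Dom.of_swap_neg (by
      rw [neg_neg]; exact hd.swap_neg.T hB' ht htτ)⟩
  obtain ⟨z, hz1, hz2⟩ := hH.exists_flow_eq ht htτ x.1 (X x.1)
  have h1 := ActionKernel.fderiv_of_T_eq hB' ht htτ2 (hX x.1)
    (h₀.isC11.neg.hasFDerivAt _).differentiableAt
  have h2 := (hX' x.1).neg.fderiv
  change fderiv ℝ (-u₀) (X x.1) = -hH.kernel.D₂ t x.1 (X x.1) at h1
  change fderiv ℝ (-hH.kernel.swap.T t (-u₀)) x.1 = -hH.kernel.D₁ t x.1 (X x.1) at h2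
  have e := hH.kernel_D₂_flow ht htτ z
  have e' := hH.kernel_D₁_flow ht htτ z
  rw [hz1, hz2] at e e'
  rw [fderiv_neg, neg_inj, e] at h1
  rw [e', neg_neg] at h2
  have h3 : z = x := Prod.ext hz1 (by
    rw [hx.2, ← h2]
    exact hH.fderiv_eq_of_mem_projAubry hx.1 (isC11_of_hasFDerivAt hX' hΛ).neg.1 hc h₀.contDiff
      h₀.critical)
  subst h3
  rw [← hz2] at h1
  refine ⟨mem_projAubry_of_energy h₀ ?_, h1.symm⟩
  rw [h1, Prod.mk.eta, hH.energy_flow, energy_of_mem_aubryLift h₀ hx]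

/-- The Aubry set is invariant under the flow. -/
theorem flow_mem_aubryLift (hH : IsTame H m M) (h₀ : IsStrictCriticalSub H u₀) (t : ℝ)
    {x : Phase d} (hx : x ∈ aubryLift H u₀) : flow H t x ∈ aubryLift H u₀ := by
  obtain ⟨ε₁, hε₁, h1⟩ := hH.flow_mem_aubryLift_small h₀
  obtain ⟨ε₂, hε₂, h2⟩ := hH.flow_neg_mem_aubryLift_small h₀
  refine hH.flow_mem_of_small (lt_min hε₁ hε₂) (fun s hs x hx => ?_) t hx
  rcases lt_trichotomy s 0 with h | rfl | h
  · rw [abs_of_neg h] at hs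
    simpa using h2 (-s) (by linarith) (hs.trans (min_le_right _ _)) x hx
  · rwa [hH.flow_zero]
  · rw [abs_of_pos h] at hs
    exact h1 s h (hs.trans (min_le_left _ _)) x hx

/-- The orbits of the Aubry set are calibrated by the `C¹` critical sub-solutions. -/
theorem calibrated_of_contDiff (hH : IsTame H m M) (h₀ : IsStrictCriticalSub H u₀)
    (hv1 : ContDiff ℝ 1 v) (hv : IsCriticalSub H v) {x : Phase d} (hx : x ∈ aubryLift H u₀) (r : ℝ) :
    v (flow H r x).1 = v x.1 + orbitAction H r x + critValue H * r := by
  have h : ∀ s, HasDerivAt (fun s => v (flow H s x).1 - orbitAction H s x - critValue H * s) 0 s := by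
    intro s
    have hs := hH.flow_mem_aubryLift h₀ s hx
    have h1 := (hv1.differentiable one_ne_zero (flow H s x).1).hasFDerivAt.comp_hasDerivAt s
      (hH.hasDerivAt_flow_fst x s)
    have h2 := (h1.sub (hH.hasDerivAt_orbitAction x s)).sub
      ((hasDerivAt_id s).const_mul (critValue H))
    refine h2.congr_deriv ?_
    rw [hH.fderiv_eq_of_mem_projAubry hs.1 hv1 hv h₀.contDiff h₀.critical, ← hs.2, density,
      energy_of_mem_aubryLift h₀ hs]
    ring
  have := is_const_of_deriv_eq_zero (fun s => (h s).differentiableAt) (fun s => (h s).deriv) r 0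
  simp only [hH.flow_zero, orbitAction_zero, mul_zero, sub_zero] at this
  linarith

/-- The level of a periodic weak KAM solution is the critical value. -/
theorem level_eq_critValue (hH : IsTame H m M) (hp : IsPeriodic u) (hd : hH.kernel.Dom a u)
    (hmin : ∀ r, 0 < r → r ≤ hH.kernel.τ → ∀ y, ∃ x, u y = u x + hH.kernel.k r x y + a * r) :
    a = critValue H := by
  refine le_antisymm ?_ (hH.critValue_le hp hd)
  obtain ⟨v, hv⟩ := hH.exists_isCriticalSub
  obtain ⟨hvp, hvd⟩ := hH.isCriticalSub_iff.1 hv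
  obtain ⟨B₁, hB₁⟩ := hp.exists_abs_le hd.lipschitzWith.continuous
  obtain ⟨B₂, hB₂⟩ := hvp.exists_abs_le hvd.lipschitzWith.continuous
  have hbdd : BddBelow (range fun x => u x - v x) := ⟨-B₁ - B₂, by
    rintro _ ⟨x, rfl⟩
    linarith [neg_le_of_abs_le (hB₁ x), le_of_abs_le (hB₂ x)]⟩
  set c := ⨅ x, (u x - v x)
  have hτ := hH.kernel.τ_pos
  -- Going back along a calibrated step of `u`, where `v` is only dominated, lowers `u - v` by at
  -- least `(a - α(0)) * τ`. The infimum is finite, so `a ≤ α(0)`.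
  have : c + (a - critValue H) * hH.kernel.τ ≤ c := le_ciInf fun y => by
    obtain ⟨x, hx⟩ := hmin _ hτ le_rfl y
    have h1 := hvd _ hτ le_rfl x y
    have h2 : c ≤ u x - v x := ciInf_le hbdd x
    linarith
  nlinarith

/-- The orbits of the Aubry set are calibrated by the weak KAM solutions. -/
theorem calibrated_of_weakKAM (hH : IsTame H m M) (h₀ : IsStrictCriticalSub H u₀)
    (hp : IsPeriodic u) (hd : hH.kernel.Dom (critValue H) u)
    (hmin : ∀ r, 0 < r → r ≤ hH.kernel.τ → ∀ y, ∃ x,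
      u y = u x + hH.kernel.k r x y + critValue H * r)
    {x : Phase d} (hx : x ∈ aubryLift H u₀) (r : ℝ) :
    u (flow H r x).1 = u x.1 + orbitAction H r x + critValue H * r := by
  set α := critValue H
  have hτ := hH.kernel.τ_pos
  obtain ⟨B, hB⟩ := hp.exists_abs_le hd.lipschitzWith.continuous
  -- A weak KAM solution is its own forward evolution up to a constant, hence already semi-concave:
  -- a single backward step makes it `C^{1,1}`.
  have hsemi : SemiConv (hH.kernel.L / hH.kernel.τ) (-u) := by
    have h1 := (ActionKernel.semiConv_neg_T (K := hH.kernel) (fun x => neg_le_of_abs_le (hB x)) hτ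
      (hH.le_two_tau le_rfl)).add_const (-(α * hH.kernel.τ))
    convert h1 using 1
    ext y
    have h2 := hd.le_T hτ le_rfl y
    obtain ⟨z, hz⟩ := hmin _ hτ le_rfl y
    have h3 := ActionKernel.T_le (K := hH.kernel) (fun x => neg_le_of_abs_le (hB x)) hτ
      (hH.le_two_tau le_rfl) z y
    simp only [Pi.neg_apply]
    linarith
  set s := min hH.kernel.τ (hH.kernel.κ / (hH.kernel.L / hH.kernel.τ + 1))
  have hL : 0 < hH.kernel.L / hH.kernel.τ + 1 := by have := hH.kernel.L_nonneg; positivity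
  have hs : 0 < s := lt_min hτ (div_pos hH.kernel.κ_pos hL)
  have hsτ : s ≤ hH.kernel.τ := min_le_left _ _
  have hsτ2 : s ≤ 2 * hH.kernel.swap.τ := hH.le_two_tau hsτ
  have hlt : hH.kernel.L / hH.kernel.τ < hH.kernel.swap.κ / s := by
    change _ < hH.kernel.κ / s
    rw [lt_div_iff₀ hs]
    have : s ≤ hH.kernel.κ / (hH.kernel.L / hH.kernel.τ + 1) := min_le_right _ _
    rw [le_div_iff₀ hL] at this
    linarith
  have hB' : ∀ x, -B ≤ (-u) x := fun x => neg_le_neg (le_of_abs_le (hB x))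
  obtain ⟨X, hX, hX', Λ, hΛ⟩ := ActionKernel.exists_hasFDerivAt_T (K := hH.kernel.swap)
    hd.lipschitzWith.continuous.neg hB' hsemi hs hsτ2 hlt
  set w := -hH.kernel.swap.T s (-u) with hw
  have hw1 : IsC11 w := (isC11_of_hasFDerivAt hX' hΛ).neg
  have hwc : IsCriticalSub H w := hH.isCriticalSub_iff.2
    ⟨(ActionKernel.T_periodic hp.neg hs hsτ2).neg, ActionKernel.Dom.of_swap_neg (by
      rw [hw, neg_neg]; exact hd.swap_neg.T hB' hs hsτ)⟩
  -- on the Aubry set, `u` differs from the `C¹` sub-solution `w` by a constant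
  have key : ∀ y ∈ aubryLift H u₀, u y.1 = w y.1 - α * s := by
    intro y hy
    -- Domination gives `u ≥ w - α * s`. For the converse, `y` is a competitor in the backward
    -- operator at `z = φ^{-s}(y)`, and `w` is calibrated from `z` to `y`.
    have h1 := hd.swap_neg.le_T (K := hH.kernel.swap) hs hsτ y.1
    set z := flow H (-s) y
    have hz : flow H s z = y := hH.flow_flow_neg s y
    have h2 := hH.calibrated_of_contDiff h₀ hw1.1 hwc (hH.flow_mem_aubryLift h₀ (-s) hy) s
    change w (flow H s z).1 = w z.1 + orbitAction H s z + α * s at h2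
    have h3 := ActionKernel.T_le (K := hH.kernel.swap) hB' hs hsτ2 y.1 z.1
    change hH.kernel.swap.T s (-u) z.1 ≤ -u y.1 + hH.kernel.k s z.1 y.1 at h3
    have h4 := hH.kernel_flow hs hsτ z
    rw [hz] at h2 h4
    simp only [hw, Pi.neg_apply] at *
    linarith
  have h1 := key _ hx
  have h2 := key _ (hH.flow_mem_aubryLift h₀ r hx)
  have h3 := hH.calibrated_of_contDiff h₀ hw1.1 hwc hx r
  rw [h1, h2, h3]
  ring

/-- The Aubry set is contained in the invariant set of each periodic weak KAM solution. -/
theorem aubryLift_subset_invSet (hH : IsTame H m M) (h₀ : IsStrictCriticalSub H u₀)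
    (hp : IsPeriodic u) (hu : IsWeakKAM H u) : aubryLift H u₀ ⊆ invSet H u := by
  obtain ⟨a, hd, hmin⟩ := hH.exists_of_isWeakKAM hp hu
  obtain rfl := hH.level_eq_critValue hp hd hmin
  have hτ := hH.kernel.τ_pos
  -- Each point of the Aubry set is the middle of an orbit segment of times `[-τ, τ]` calibrated by
  -- `u`.
  have key : ∀ y ∈ aubryLift H u₀, y ∈ diffGraph u := by
    intro y hy
    have hcal := fun z hz => hH.calibrated_of_weakKAM h₀ hp hd hmin (x := z) hz hH.kernel.τ
    have h1 := hH.hasFDerivAt_of_calibrated hd hτ le_rfl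
      (hcal _ (hH.flow_mem_aubryLift h₀ (-hH.kernel.τ) hy))
      (hcal _ (by rwa [hH.flow_flow_neg]))
    rw [hH.flow_flow_neg] at h1
    exact ⟨h1.differentiableAt, h1.fderiv.symm⟩
  intro x hx
  exact mem_iInter.2 fun n => subset_closure (key _ (hH.flow_mem_aubryLift h₀ n hx))

end IsTame

end WeakKAM

end

/-! ### The maximal critical sub-solution and the reverse inclusion. -/

noncomputable section

namespace WeakKAM

open Set Filter Topology Metric MeasureTheory
open scoped NNReal ContDiff

variable {d : ℕ}

namespace IsTame

variable {H : Phase d → ℝ} {m M a : ℝ} {u v u₀ : Pos d → ℝ}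

theorem continuous_energy (hH : IsTame H m M) (hu : ContDiff ℝ 1 u) :
    Continuous fun q => H (q, fderiv ℝ u q) :=
  hH.contDiff.continuous.comp (continuous_id.prodMk (hu.continuous_fderiv one_ne_zero))

theorem energy_periodic (hH : IsTame H m M) (hp : IsPeriodic u) :
    IsPeriodic fun q => H (q, fderiv ℝ u q) := fun w q => by
  simp only [hp.fderiv, hH.periodic]

/-- Otherwise `u₀` would be strict everywhere and, by periodicity and compactness, a sub-solution at
a level below `α(0)`. -/
theorem projAubry_nonempty (hH : IsTame H m M) (h₀ : IsStrictCriticalSub H u₀) :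
    (projAubry H).Nonempty := by
  by_contra hne
  rw [not_nonempty_iff_eq_empty] at hne
  have hstrict : ∀ q, H (q, fderiv ℝ u₀ q) < critValue H := fun q => h₀.strict q (by simp [hne])
  have hcont := hH.continuous_energy h₀.contDiff
  have hper := hH.energy_periodic h₀.critical.1
  obtain ⟨z, -, hz⟩ := (isCompact_closedBall (0 : Pos d) (√d)).exists_isMaxOn
    (nonempty_closedBall.2 (Real.sqrt_nonneg _)) hcont.continuousOn
  have hsub : IsSubsolution H (H (z, fderiv ℝ u₀ z)) u₀ := ⟨h₀.critical.2.1, fun q _ => by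
    obtain ⟨w, hw⟩ := exists_translate_mem_closedBall q
    have h1 := hper w q
    simp only at h1
    rw [← h1]
    exact hz hw⟩
  exact (hstrict z).not_ge (hH.critValue_le h₀.critical.1 (hH.dom_of_isSubsolution hsub))

/-- The periodic critical sub-solutions which coincide with `u₀` on the Aubry set. -/
def aubryClass (hH : IsTame H m M) (u₀ : Pos d → ℝ) : Set (Pos d → ℝ) :=
  {v | IsPeriodic v ∧ hH.kernel.Dom (critValue H) v ∧ ∀ q ∈ projAubry H, v q = u₀ q}

/-- The largest element of `aubryClass`. -/
def maxSub (hH : IsTame H m M) (u₀ : Pos d → ℝ) (x : Pos d) : ℝ :=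
  ⨆ v : hH.aubryClass u₀, v.1 x

theorem mem_aubryClass_self (hH : IsTame H m M) (h₀ : IsStrictCriticalSub H u₀) :
    u₀ ∈ hH.aubryClass u₀ :=
  ⟨h₀.critical.1, (hH.isCriticalSub_iff.1 h₀.critical).2, fun _ _ => rfl⟩

/-- The content is that the real supremum is finite: the class is equi-Lipschitz with a prescribed
value at some point of the Aubry set. -/
theorem le_maxSub (hH : IsTame H m M) (h₀ : IsStrictCriticalSub H u₀) (hv : v ∈ hH.aubryClass u₀)
    (x : Pos d) : v x ≤ hH.maxSub u₀ x := by
  obtain ⟨q, hq⟩ := hH.projAubry_nonempty h₀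
  refine le_ciSup (f := fun v : hH.aubryClass u₀ => v.1 x)
    ⟨u₀ q + (hH.kernel.C + |critValue H|).toNNReal * dist x q, ?_⟩ ⟨v, hv⟩
  rintro _ ⟨⟨w, -, hw, hwA⟩, rfl⟩
  rw [← hwA q hq]
  linarith [le_of_abs_le (hw.lipschitzWith.dist_le_mul x q)]

theorem maxSub_le (hH : IsTame H m M) (h₀ : IsStrictCriticalSub H u₀) {x : Pos d} {b : ℝ}
    (h : ∀ v ∈ hH.aubryClass u₀, v x ≤ b) : hH.maxSub u₀ x ≤ b :=
  haveI : Nonempty (hH.aubryClass u₀) := ⟨⟨u₀, hH.mem_aubryClass_self h₀⟩⟩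
  ciSup_le fun v => h v.1 v.2

theorem maxSub_mem_aubryClass (hH : IsTame H m M) (h₀ : IsStrictCriticalSub H u₀) :
    hH.maxSub u₀ ∈ hH.aubryClass u₀ := by
  refine ⟨fun w q => ?_, fun r hr h x y => ?_, fun q hq => le_antisymm ?_ ?_⟩
  · exact congrArg iSup (funext fun v => v.2.1 w q)
  · exact hH.maxSub_le h₀ fun v hv => by
      linarith [hv.2.1 r hr h x y, hH.le_maxSub h₀ hv x]
  · exact hH.maxSub_le h₀ fun v hv => (hv.2.2 q hq).le
  · exact hH.le_maxSub h₀ (hH.mem_aubryClass_self h₀) q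

/-- The evolution of `maxSub`, corrected by `α(0) * r`, stays in the class: it keeps the values of
`u₀` on the Aubry set because the orbits there are calibrated by `u₀`. Maximality bounds it above by
`maxSub`, domination below. -/
theorem exists_maxSub_eq (hH : IsTame H m M) (h₀ : IsStrictCriticalSub H u₀) {r : ℝ} (hr : 0 < r)
    (h : r ≤ hH.kernel.τ) (y : Pos d) : ∃ x, hH.maxSub u₀ y =
      hH.maxSub u₀ x + hH.kernel.k r x y + critValue H * r := by
  obtain ⟨hp, hd, hA⟩ := hH.maxSub_mem_aubryClass h₀
  obtain ⟨B, hB⟩ := hp.exists_abs_le hd.lipschitzWith.continuous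
  have hB' : ∀ x, -B ≤ hH.maxSub u₀ x := fun x => neg_le_of_abs_le (hB x)
  have h2 := hH.le_two_tau h
  have hmem : (fun x => hH.kernel.T r (hH.maxSub u₀) x + critValue H * r) ∈ hH.aubryClass u₀ := by
    refine ⟨fun w q => ?_, fun s hs hsτ x z => ?_, fun q hq => le_antisymm ?_ ?_⟩
    · simp only [ActionKernel.T_periodic hp hr h2 w q]
    · linarith [hd.T hB' hr h s hs hsτ x z]
    · have hx : ((q, fderiv ℝ u₀ q) : Phase d) ∈ aubryLift H u₀ := ⟨hq, rfl⟩
      have hz := hH.flow_mem_aubryLift h₀ (-r) hx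
      have h3 := hH.calibrated_of_contDiff h₀ h₀.contDiff h₀.critical hz r
      have h4 := hH.kernel_flow hr h (flow H (-r) (q, fderiv ℝ u₀ q))
      rw [hH.flow_flow_neg] at h3 h4
      have h5 := ActionKernel.T_le hB' hr h2 (flow H (-r) (q, fderiv ℝ u₀ q)).1 q
      rw [hA _ hz.1] at h5
      simp only at *
      linarith
    · rw [← hA q hq]
      exact hd.le_T hr h q
  obtain ⟨x, hx⟩ := ActionKernel.exists_T_eq (K := hH.kernel) hd.lipschitzWith.continuous hB' hr h2 y
  have h3 := hH.le_maxSub h₀ hmem y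
  have h4 := hd r hr h x y
  exact ⟨x, by linarith⟩

/-- The differential of a weak KAM solution is calibrated in the past. -/
theorem calibrated_of_mem_closure (hH : IsTame H m M) (hd : hH.kernel.Dom a u)
    (hmin : ∀ r, 0 < r → r ≤ hH.kernel.τ → ∀ y, ∃ x, u y = u x + hH.kernel.k r x y + a * r)
    {r : ℝ} (hr : 0 < r) (h : r ≤ hH.kernel.τ) {x : Phase d} (hx : x ∈ closure (diffGraph u)) :
    u x.1 = u (flow H (-r) x).1 + orbitAction H r (flow H (-r) x) + a * r := by
  have hc := hd.lipschitzWith.continuous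
  have hclosed : IsClosed {x : Phase d |
      u x.1 = u (flow H (-r) x).1 + orbitAction H r (flow H (-r) x) + a * r} :=
    isClosed_eq (hc.comp continuous_fst) (((hc.comp (hH.continuous_flow _).fst).add
      ((hH.continuous_orbitAction r).comp (hH.continuous_flow _))).add continuous_const)
  refine closure_minimal (fun y hy => ?_) hclosed hx
  obtain ⟨q, p⟩ := y
  obtain ⟨hq, hp⟩ := hy
  change DifferentiableAt ℝ u q at hq
  change p = fderiv ℝ u q at hp
  obtain ⟨θ, hθ⟩ := hmin r hr h q
  obtain ⟨z, hz1, hz2⟩ := hH.exists_flow_eq hr h θ q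
  -- At a point of differentiability this first-order condition forces the minimizing orbit to end
  -- with momentum `du(q)`. Continuity then extends calibration to the closure.
  have h1 : IsLocalMin (fun y => hH.kernel.k r θ y - u y) q := Eventually.of_forall fun y => by
    linarith [hd r hr h θ y]
  have h2 := h1.hasFDerivAt_eq_zero
    ((hH.kernel.hasFDerivAt₂ θ q hr (hH.le_two_tau h)).sub hq.hasFDerivAt)
  have h3 := hH.kernel_D₂_flow hr h z
  have h4 := hH.kernel_flow hr h z
  rw [hz1, hz2] at h3 h4
  have h5 : flow H r z = (q, p) := Prod.ext hz2 (by rw [← h3, hp]; exact sub_eq_zero.1 h2)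
  change u q = _
  rw [← h5, hH.flow_neg_flow, hz1, ← h4, hθ]

/-- The orbit is calibrated on `[-2 * s, 0]` and the time `-s` is interior. A backward step thus
leads from the closure into `Γ_u` itself. -/
theorem flow_neg_mem_diffGraph (hH : IsTame H m M) (hd : hH.kernel.Dom a u)
    (hmin : ∀ r, 0 < r → r ≤ hH.kernel.τ → ∀ y, ∃ x, u y = u x + hH.kernel.k r x y + a * r)
    {s : ℝ} (hs : 0 < s) (h : 2 * s ≤ hH.kernel.τ) {x : Phase d}
    (hx : x ∈ closure (diffGraph u)) : flow H (-s) x ∈ diffGraph u := by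
  have h1 := hH.calibrated_of_mem_closure hd hmin hs (by linarith) hx
  have h2 := hH.calibrated_of_mem_closure hd hmin (by positivity) h hx
  set z := flow H (-(2 * s)) x with hz
  have hzs : flow H s z = flow H (-s) x := by
    rw [hz, ← hH.flow_add]; congr 1; ring
  have hzss : flow H s (flow H s z) = x := by rw [hzs, hH.flow_flow_neg]
  have h3 : orbitAction H (2 * s) z = orbitAction H s z + orbitAction H s (flow H s z) := by
    rw [two_mul, hH.orbitAction_add]
  rw [← hzs] at h1
  have h4 := hH.hasFDerivAt_of_calibrated hd hs (by linarith) (x := z) (by linarith)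
    (by rw [hzss]; exact h1)
  rw [hzs] at h4
  exact ⟨h4.differentiableAt, h4.fderiv.symm⟩

/-- Every time `t` precedes some integer `n` at which the orbit is in the closure; short backward
steps from `n` reach `t`. -/
theorem flow_mem_diffGraph (hH : IsTame H m M) (hd : hH.kernel.Dom a u)
    (hmin : ∀ r, 0 < r → r ≤ hH.kernel.τ → ∀ y, ∃ x, u y = u x + hH.kernel.k r x y + a * r)
    {x : Phase d} (hx : x ∈ invSet H u) (t : ℝ) : flow H t x ∈ diffGraph u := by
  have hτ := hH.kernel.τ_pos
  obtain ⟨n, hn⟩ := exists_nat_gt t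
  obtain ⟨k, hk⟩ := exists_nat_gt ((n - t) / (hH.kernel.τ / 2))
  have hnt : 0 < (n : ℝ) - t := by linarith
  have hk0 : (0 : ℝ) < k := lt_of_le_of_lt (by positivity) hk
  obtain ⟨j, rfl⟩ := Nat.exists_eq_succ_of_ne_zero (n := k) (by rintro rfl; simp at hk0)
  set s := ((n : ℝ) - t) / (j + 1 : ℕ) with hs
  have hs0 : 0 < s := by positivity
  have hsτ : 2 * s ≤ hH.kernel.τ := by
    rw [div_lt_iff₀ (by positivity)] at hk
    have : s ≤ hH.kernel.τ / 2 := by rw [hs, div_le_iff₀ hk0]; linarith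
    linarith
  have hxn : flow H n x ∈ closure (diffGraph u) := mem_iInter.1 hx n
  have h1 := hH.flow_nat_mul_mem (s := -s)
    (fun y hy => subset_closure (hH.flow_neg_mem_diffGraph hd hmin hs0 hsτ hy)) j hxn
  have h2 := hH.flow_neg_mem_diffGraph hd hmin hs0 hsτ h1
  rw [← hH.flow_add, ← hH.flow_add] at h2
  have e : -s + j * -s + n = t := by
    have : s * (j + 1 : ℕ) = n - t := by rw [hs]; field_simp
    push_cast at this
    linarith
  rwa [e] at h2

/-- The energy of the invariant set of a weak KAM solution. -/
theorem energy_of_mem_invSet (hH : IsTame H m M) (hd : hH.kernel.Dom a u)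
    (hmin : ∀ r, 0 < r → r ≤ hH.kernel.τ → ∀ y, ∃ x, u y = u x + hH.kernel.k r x y + a * r)
    {x : Phase d} (hx : x ∈ invSet H u) : H x = a := by
  have hτ := hH.kernel.τ_pos
  have hmem := hH.flow_mem_diffGraph hd hmin hx
  set g : ℝ → ℝ := fun s => u (flow H s x).1 - orbitAction H s x - a * s with hg
  have hg' : HasDerivAt g (H x - a) 0 := by
    have h1 := (hmem 0).1.hasFDerivAt.comp_hasDerivAt (0 : ℝ) (hH.hasDerivAt_flow_fst x 0)
    refine ((h1.sub (hH.hasDerivAt_orbitAction x 0)).sub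
      ((hasDerivAt_id (0 : ℝ)).const_mul a)).congr_deriv ?_
    rw [← (hmem 0).2, density, hH.energy_flow]
    ring
  have hconst : ∀ s t, 0 < t → t ≤ hH.kernel.τ → g s = g (s - t) := by
    intro s t ht htτ
    have h1 := hH.calibrated_of_mem_closure hd hmin ht htτ (subset_closure (hmem s))
    rw [← hH.flow_add, neg_add_eq_sub] at h1
    have h2 := hH.orbitAction_add t (s - t) x
    rw [add_sub_cancel] at h2
    simp only [hg]
    linarith
  -- All times near 0 are compared with the single earlier time `-τ / 2`, so `g` is locally constant
  -- and its derivative `H x - a` vanishes.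
  have hev : g =ᶠ[𝓝 0] fun _ => g (-hH.kernel.τ / 2) := by
    filter_upwards [Ioo_mem_nhds (show -(hH.kernel.τ / 2) < 0 by linarith)
      (show 0 < hH.kernel.τ / 2 by linarith)] with s hs
    rw [hconst s (s + hH.kernel.τ / 2) (by linarith [hs.1]) (by linarith [hs.2])]
    congr 1; ring
  have := hg'.unique ((hasDerivAt_const (0 : ℝ) _).congr_of_eventuallyEq hev)
  linarith

theorem isWeakKAM_maxSub (hH : IsTame H m M) (h₀ : IsStrictCriticalSub H u₀) :
    IsWeakKAM H (hH.maxSub u₀) :=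
  hH.isWeakKAM_of_calibrated (hH.maxSub_mem_aubryClass h₀).2.1
    fun _ hr h y => hH.exists_maxSub_eq h₀ hr h y

theorem energy_gap_le (hH : IsTame H m M) {q : Pos d} {p l : Mom d} :
    H (q, p) - H (q, l) + m / 2 * ‖p - l‖ ^ 2 ≤ (p - l) (hamVF H (q, p)).1 := by
  have := hH.fenchel q p l
  rw [sub_apply]
  linarith

/-- A Lyapunov argument: `h = maxSub - u₀` is non-negative, non-decreasing along the orbit, and zero
on the Aubry set, where the orbit accumulates forward in time. It therefore vanishes along the whole
orbit. -/
theorem invSet_maxSub_subset (hH : IsTame H m M) (h₀ : IsStrictCriticalSub H u₀) :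
    invSet H (hH.maxSub u₀) ⊆ aubryLift H u₀ := by
  intro x hx
  set α := critValue H with hα
  obtain ⟨hp, hd, hA⟩ := hH.maxSub_mem_aubryClass h₀
  have hmin := fun r hr h y => hH.exists_maxSub_eq h₀ (r := r) hr h y
  have hmem := hH.flow_mem_diffGraph hd hmin hx
  have hE : ∀ t, H (flow H t x) = α := fun t => by
    rw [hH.energy_flow, hH.energy_of_mem_invSet hd hmin hx]
  set f : Pos d → ℝ := fun q => α - H (q, fderiv ℝ u₀ q) with hf
  have hf0 : ∀ q, 0 ≤ f q := fun q =>
    sub_nonneg.2 (le_of_isCriticalSub h₀.critical h₀.contDiff q)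
  have hfc : Continuous f := continuous_const.sub (hH.continuous_energy h₀.contDiff)
  have hfp : IsPeriodic f := fun w q => by
    have := hH.energy_periodic h₀.critical.1 w q
    simp only [hf] at this ⊢
    rw [this]
  set h : Pos d → ℝ := fun q => hH.maxSub u₀ q - u₀ q with hh
  have hhc : Continuous h := hd.lipschitzWith.continuous.sub h₀.contDiff.continuous
  have hhp : IsPeriodic h := fun w q => by
    have h1 := hp w q
    have h2 := h₀.critical.1 w q
    simp only [hh, h1, h2]
  have hh0 : ∀ q, 0 ≤ h q := fun q =>
    sub_nonneg.2 (hH.le_maxSub h₀ (hH.mem_aubryClass_self h₀) q)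
  set G : ℝ → ℝ := fun t => ((flow H t x).2 - fderiv ℝ u₀ (flow H t x).1)
    (hamVF H (flow H t x)).1 with hG
  have hder : ∀ t, HasDerivAt (fun t => h (flow H t x).1) (G t) t := fun t => by
    have h1 := ((hmem t).1.hasFDerivAt.sub
      (h₀.contDiff.differentiable one_ne_zero _).hasFDerivAt).comp_hasDerivAt t
      (hH.hasDerivAt_flow_fst x t)
    rw [← (hmem t).2] at h1
    exact h1
  have hGf : ∀ t, f (flow H t x).1 + m / 2 * ‖(flow H t x).2 - fderiv ℝ u₀ (flow H t x).1‖ ^ 2 ≤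
      G t := fun t => by
    have := hH.energy_gap_le (q := (flow H t x).1) (p := (flow H t x).2)
      (l := fderiv ℝ u₀ (flow H t x).1)
    rw [Prod.mk.eta, hE t] at this
    exact this
  have hm := hH.m_pos
  have hGf' : ∀ t, f (flow H t x).1 ≤ G t := fun t => le_trans (by
    have : 0 ≤ m / 2 * ‖(flow H t x).2 - fderiv ℝ u₀ (flow H t x).1‖ ^ 2 := by positivity
    linarith) (hGf t)
  have hmono : Monotone fun t => h (flow H t x).1 :=
    monotone_of_hasDerivAt_nonneg hder fun t => (hf0 _).trans (hGf' t)
  obtain ⟨B, hB⟩ := hhp.exists_abs_le hhc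
  have hlim : Tendsto (fun t => h (flow H t x).1) atTop (𝓝 (⨆ t, h (flow H t x).1)) :=
    tendsto_atTop_ciSup hmono ⟨B, by rintro _ ⟨t, rfl⟩; exact le_of_abs_le (hB _)⟩
  set ℓ := ⨆ t, h (flow H t x).1
  -- By the mean value theorem on `[n, n + 1]`, the speed of `h` takes values tending to 0 along
  -- times tending to infinity, as `h` converges. The energy defect `f` tends to 0 there too.
  have hslope : ∀ n : ℕ, ∃ t, (n : ℝ) < t ∧
      G t = h (flow H (n + 1) x).1 - h (flow H n x).1 := fun n => by
    obtain ⟨t, ht, hGt⟩ := exists_hasDerivAt_eq_slope (fun t => h (flow H t x).1) G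
      (show (n : ℝ) < n + 1 by linarith)
      (fun t _ => (hder t).continuousAt.continuousWithinAt) (fun t _ => hder t)
    exact ⟨t, ht.1, by rw [hGt]; simp⟩
  choose t htn htG using hslope
  -- Positions are brought back to a compact ball by integer translations, to which `f` and `h` are
  -- insensitive; a limit `z` has `f z = 0`, hence is in the Aubry set.
  choose w hw using fun n => exists_translate_mem_closedBall (flow H (t n) x).1
  obtain ⟨z, -, φ, hφ, hz⟩ := (isCompact_closedBall (0 : Pos d) (√d)).tendsto_subseq hw
  have htlim : Tendsto t atTop atTop :=
    tendsto_atTop_mono (fun n => (htn n).le) tendsto_natCast_atTop_atTop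
  have hGlim : Tendsto (fun n => G (t n)) atTop (𝓝 0) := by
    have h1 := hlim.comp ((tendsto_natCast_atTop_atTop (R := ℝ)).atTop_add
      (tendsto_const_nhds (x := (1 : ℝ))))
    have h2 := h1.sub (hlim.comp (tendsto_natCast_atTop_atTop (R := ℝ)))
    rw [sub_self] at h2
    exact h2.congr fun n => (htG n).symm
  have hfz : f z = 0 := by
    have h1 : Tendsto (fun n => f (flow H (t n) x).1) atTop (𝓝 0) :=
      squeeze_zero (fun n => hf0 _) (fun n => hGf' _) hGlim
    refine tendsto_nhds_unique ((hfc.tendsto z).comp hz) ((h1.comp hφ.tendsto_atTop).congr fun n => ?_)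
    simp only [Function.comp_apply, hfp _ _]
  have hhz : h z = ℓ := by
    refine tendsto_nhds_unique ((hhc.tendsto z).comp hz)
      (((hlim.comp htlim).comp hφ.tendsto_atTop).congr fun n => ?_)
    simp only [Function.comp_apply, hhp _ _]
  have hzA : z ∈ projAubry H := mem_projAubry_of_energy h₀ (sub_eq_zero.1 hfz).symm
  have hℓ : ℓ = 0 := by rw [← hhz]; exact sub_eq_zero.2 (hA z hzA)
  have hzero : ∀ t, h (flow H t x).1 = 0 := fun t =>
    le_antisymm (hℓ ▸ hmono.ge_of_tendsto hlim t) (hh0 _)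
  -- The speed dominates a sum of two non-negative terms; its vanishing at time 0 gives both
  -- membership in the Aubry set and the equality of momenta.
  have hG0 : G 0 = 0 := (hder 0).unique (by
    simp only [hzero]
    exact hasDerivAt_const _ _)
  have h1 := hGf 0
  rw [hG0, hH.flow_zero] at h1
  have h2 := hf0 x.1
  have h3 : 0 ≤ m / 2 * ‖x.2 - fderiv ℝ u₀ x.1‖ ^ 2 := by positivity
  refine ⟨mem_projAubry_of_energy h₀ (sub_eq_zero.1 (show f x.1 = 0 by linarith)).symm, ?_⟩
  have h4 : m / 2 * ‖x.2 - fderiv ℝ u₀ x.1‖ ^ 2 = 0 := by linarith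
  have h5 : ‖x.2 - fderiv ℝ u₀ x.1‖ = 0 := by
    rcases mul_eq_zero.1 h4 with h | h
    · linarith
    · exact pow_eq_zero_iff two_ne_zero |>.1 h
  exact sub_eq_zero.1 (norm_eq_zero.1 h5)

end IsTame

end WeakKAM

end

theorem mainTheorem3 {d : ℕ} (H : WeakKAM.Phase d → ℝ) (m M : ℝ)
    (hH : WeakKAM.IsPeriodicHamiltonian H m M) :
    (∃ u₀ : WeakKAM.Pos d → ℝ, WeakKAM.IsStrictCriticalSub H u₀) ∧
    ∀ u₀ : WeakKAM.Pos d → ℝ, WeakKAM.IsStrictCriticalSub H u₀ →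
      WeakKAM.aubryGraph H u₀ =
        ⋂ u ∈ {u : WeakKAM.Pos d → ℝ | WeakKAM.IsPeriodic u ∧ WeakKAM.IsWeakKAM H u},
          WeakKAM.toTorus '' WeakKAM.invSet H u := by
  have hT := hH.isTame
  refine ⟨hT.exists_isStrictCriticalSub, fun u₀ h₀ => Set.Subset.antisymm ?_ ?_⟩
  · exact Set.subset_iInter₂ fun u hu => Set.image_mono (hT.aubryLift_subset_invSet h₀ hu.1 hu.2)
  -- A single weak KAM solution already cuts the intersection down to the Aubry set, so images in
  -- the torus never have to be intersected.
  · exact (Set.iInter₂_subset (hT.maxSub u₀)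
      ⟨(hT.maxSub_mem_aubryClass h₀).1, hT.isWeakKAM_maxSub h₀⟩).trans
      (Set.image_mono (hT.invSet_maxSub_subset h₀))
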